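/- **Setting.** For $w,x\in\mathbb R^d$ let $h_w(x)=\operatorname{sign}\langle w,x\rangle\in\{-1,+1\}$ with $\operatorname{sign}0=+1$. Let $D$ be a probability distribution on $\mathbb R^d\times\{-1,+1\}$ with marginal $D_X$ on $\mathbb R^d$, and $\mathrm{err}(w)=\mathbb P_{(x,y)\sim D}(h_w(x)\ne y)$. $D$ satisfies the $(A,\alpha)$-*Tsybakov noise condition* with respect to $w^*\neq 0$ if $\eta(x)=\mathbb P_D(y\neq h_{w^*}(x)\mid x)$ satisfies $\mathbb P_D(\tfrac12-\eta(x)\le t)\le A\,t^{\alpha/(1-\alpha)}$ for all $t\in[0,\tfrac12]$. For $\alpha=1$ the exponent is $\infty$ and the right-hand side is read as $0$; the condition is then imposed only for $t\in[0,\tfrac12)$. $D_X$ is $(2,L,R,U,\beta)$-*well-behaved* ($L,R,U,\beta>0$) if for every 2-dimensional subspace $V$ the projection of $D_X$ onto $V$, in orthonormal coordinates, has a density $p_V$ on $\mathbb R^2$ with $p_V(z)\ge L$ for $\|z\|\le R$ and $p_V(z)\le U$ for all $z$, and for every unit vector $w$ and every $t>0$, $\mathbb P_{D_X}(|\langle w,x\rangle|\ge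 t)\le \exp(1-t/\beta)$. **Algorithm.** Let $\phi_\sigma(t)=1/(1+e^{t/\sigma})$. *Active-FO$(w)$*: sample $x\sim D_X$; draw $Z\sim\mathrm{Bernoulli}\big(\sigma|\phi_\sigma'(\langle w/\|w\|,x\rangle)|\big)$; if $Z=1$, query the label $y$ of $x$ and return $-\frac1\sigma y\big(\frac{x}{\|w\|}-\frac{\langle w,x\rangle w}{\|w\|^3}\big)$; otherwise return $0$. *Active-PSGD$(N,\gamma)$*: let $w_0=e_1$; for $i=1,\dots,N$ let $g_i$ be the answer of Active-FO$(w_{i-1})$, $v_i=w_{i-1}-\gamma g_i$ and $w_i=v_i/\|v_i\|$; return $w_R$ with $R$ uniform on $\{0,\dots,N-1\}$. *Main algorithm*, with constants $c_\theta,c_\sigma,c_\rho,c_N,c_\gamma,c_1,c_2>0$ and $k\in\mathbb N$. Put (rounding the integers up) $$\theta_0=\frac{c_\theta}{\ln^2(1/\epsilon)}\frac{\epsilon}{2},\quad \sigma=c_\sigma A^{-\frac{1-\alpha}{3\alpha-1}}\theta_0^{\frac{2\alpha}{3\alpha-1}},\quad \rho=c_\rho A^{-\frac{2(1-\alpha)}{3\alpha-1}}\theta_0^{\frac{2(1-\alpha)}{3\alpha-1}},\quad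 S=\log_2\tfrac6\delta,$$ $$N=c_N\frac{d}{\sigma^2\rho^4}\ln^k\tfrac d\epsilon,\quad \gamma=c_\gamma\frac{\rho^2\sigma^2}{d}\ln^{-k}\tfrac d\epsilon,\quad M_1=c_1\frac{d}{\sigma^2\rho^2}\ln\tfrac S\delta,\quad M_2=c_2A^{\frac{2-2\alpha}{\alpha}}\frac1{\alpha^2}\ln\tfrac6\delta .$$ (1) Run Active-PSGD$(N,\gamma)$ independently $S$ times, with outputs $w_1,\dots,w_S$. (2) For each $s$ let $\bar g_s$ be the average of the answers of $M_1$ fresh calls to Active-FO$(w_s)$, and let $\tilde w=w_{s^*}$ with $s^*\in\arg\min_s\|\bar g_s\|$ (the smallest minimizer). (3) Draw $M_2$ examples from $D_X$, query their labels, and output as $\hat w$ the one of $\pm\tilde w$ with the smaller empirical error on them ($\tilde w$ in a tie). **Theorem.** Let $\alpha\in(\tfrac13,1]$ and $L,R,U,\beta>0$. There are constants $c_\theta,c_\sigma,c_\rho,c_N,c_\gamma,c_1,c_2>0$ and $k\in\mathbb N$ for the main algorithm, and constants $c_0,C>0$ and $m\in\mathbb N$, all depending only on $\alpha,L,R,U,\beta$,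 such that the following holds for every $d\ge2$, every $A>0$, every nonzero $w^*\in\mathbb R^d$ and every $D$ that satisfies the $(A,\alpha)$-Tsybakov noise condition with respect to $w^*$ and whose marginal $D_X$ is $(2,L,R,U,\beta)$-well-behaved. For all $\delta\in(0,1)$ and all $$0<\epsilon\le\min\Big(c_0A\ln^2\tfrac1\epsilon,\ \tfrac12\alpha\big(\tfrac1A\big)^{\frac{1-\alpha}{\alpha}}\Big),$$ with probability at least $1-\delta$ the main algorithm outputs $\hat w$ with $\mathrm{err}(\hat w)-\mathrm{err}(w^*)\le\epsilon$ and its total number of label queries is at most $$C\,d\,A^{\frac{9-9\alpha}{3\alpha-1}}\Big(\frac1\epsilon\Big)^{\frac{8-6\alpha}{3\alpha-1}}\Big(\ln\frac{d}{\epsilon\delta}\Big)^m .$$ -/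

import Mathlib

open MeasureTheory ProbabilityTheory

noncomputable section

namespace ActiveHalfspace

/-- The instance space `ℝ^d` with its Euclidean norm. -/
abbrev E (d : ℕ) : Type := EuclideanSpace ℝ (Fin d)

/-! ### Halfspaces, error, noise and distributional assumptions

A labelled example is a pair `(x, y) : E d × ℝ` with `y ∈ {-1, +1}`; a data distribution is a
probability measure `D` on `E d × ℝ` that is carried by `{y = 1 ∨ y = -1}`. -/

/-- The homogeneous halfspace `h_w(x) = sign ⟨w, x⟩ ∈ {-1, +1}`, with `sign 0 = +1`. -/
def halfspace {d : ℕ} (w x : E d) : ℝ := if 0 ≤ inner ℝ w x then 1 else -1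

/-- The labels are `±1` almost surely. -/
def BinaryLabels {d : ℕ} (D : Measure (E d × ℝ)) : Prop :=
  ∀ᵐ z ∂D, z.2 = 1 ∨ z.2 = -1

/-- The error rate `P_D(h_w(x) ≠ y)`. -/
def err {d : ℕ} (D : Measure (E d × ℝ)) (w : E d) : ℝ :=
  D.real {z | halfspace w z.1 ≠ z.2}

/-- The label flipping probability `η(x) = P_D(y ≠ h_w(x) | x)`, through the regular conditional
distribution of the label given the instance. -/
def flipProb {d : ℕ} (D : Measure (E d × ℝ)) [IsFiniteMeasure D] (w x : E d) : ℝ :=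
  (D.condKernel x).real {y | y ≠ halfspace w x}

/-- The `(A, α)`-Tsybakov noise condition with respect to the halfspace `w`:
`P(1/2 - η(x) ≤ t) ≤ A t^(α/(1-α))` for all `t ∈ [0, 1/2]`.
For `α = 1` the exponent is `∞` and the right-hand side is `0`; this is then imposed for
`t ∈ [0, 1/2)` only, because at `t = 1/2` the left-hand side is always `1`. -/
def TsybakovNoise {d : ℕ} (A α : ℝ) (w : E d) (D : Measure (E d × ℝ)) [IsFiniteMeasure D] :
    Prop :=
  (α < 1 → ∀ t : ℝ, 0 ≤ t → t ≤ 1 / 2 →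
    D.fst.real {x | 1 / 2 - flipProb D w x ≤ t} ≤ A * t ^ (α / (1 - α))) ∧
  (α = 1 → ∀ t : ℝ, 0 ≤ t → t < 1 / 2 →
    D.fst.real {x | 1 / 2 - flipProb D w x ≤ t} = 0)

/-- Coordinates of the orthogonal projection of `x` onto the span of the orthonormal pair `e`. -/
def planeCoords {d : ℕ} (e : Fin 2 → E d) (x : E d) : EuclideanSpace ℝ (Fin 2) :=
  WithLp.toLp 2 fun i => inner ℝ (e i) x

/-- `(2, L, R, U, β)`-well-behaved distributions: every two-dimensional projection (given by an
orthonormal basis `e` of a plane) has a density `p` with `p ≥ L` on the disc of radius `R` and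
`p ≤ U` everywhere, and all one-dimensional projections have exponential tails. -/
def WellBehaved {d : ℕ} (L R U β : ℝ) (DX : Measure (E d)) : Prop :=
  (∀ e : Fin 2 → E d, Orthonormal ℝ e →
    ∃ p : EuclideanSpace ℝ (Fin 2) → ℝ, Measurable p ∧
      DX.map (planeCoords e) = volume.withDensity (fun z => ENNReal.ofReal (p z)) ∧
      (∀ z, ‖z‖ ≤ R → L ≤ p z) ∧ (∀ z, 0 ≤ p z ∧ p z ≤ U)) ∧
  (∀ w : E d, ‖w‖ = 1 → ∀ t : ℝ, 0 < t →
    DX.real {x | t ≤ |inner ℝ w x|} ≤ Real.exp (1 - t / β))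

/-! ### The stochastic gradient oracle `Active-FO` -/

/-- The softmax loss `φ_σ(t) = 1 / (1 + e^(t/σ))`. -/
def softmaxLoss (σ t : ℝ) : ℝ := 1 / (1 + Real.exp (t / σ))

/-- The query probability `q(w, x) = σ |φ_σ'(⟨w/‖w‖, x⟩)|`. -/
def queryProb {d : ℕ} (σ : ℝ) (w x : E d) : ℝ :=
  σ * |deriv (softmaxLoss σ) (inner ℝ (‖w‖⁻¹ • w) x)|

/-- `h(w, x, y) = - (1/σ) y (x/‖w‖ - ⟨w, x⟩ w/‖w‖³)`. -/
def gradVec {d : ℕ} (σ : ℝ) (w x : E d) (y : ℝ) : E d :=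
  (-(1 / σ) * y) • ((1 / ‖w‖) • x - (inner ℝ w x / ‖w‖ ^ 3) • w)

/-- The randomness of one call to the oracle: `((x, y), u)`, with an example `x`, the label `y` that
the labelling oracle would return on `x`, and a uniform `u ∈ [0, 1]` for the Bernoulli coin. -/
abbrev Draw (d : ℕ) : Type := (E d × ℝ) × ℝ

/-- Law of a `Draw`: `(x, y) ∼ D` and, independently, `u` uniform on `[0, 1]`. -/
def drawLaw {d : ℕ} (D : Measure (E d × ℝ)) : Measure (Draw d) :=
  D.prod (volume.restrict (Set.Icc (0 : ℝ) 1))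

/-- `Active-FO(w)`: returns the stochastic gradient together with the number (0 or 1) of label
queries. The coin is `Z = 1` iff `u < q(w, x)`; the label is used only if `Z = 1`. -/
def activeFO {d : ℕ} (σ : ℝ) (w : E d) (ω : Draw d) : E d × ℕ :=
  if ω.2 < queryProb σ w ω.1.1 then (gradVec σ w ω.1.1 ω.1.2, 1) else (0, 0)

/-! ### Projected SGD `Active-PSGD` -/

/-- The first standard basis vector. -/
def e₁ (d : ℕ) : E d := WithLp.toLp 2 fun i => if (i : ℕ) = 0 then 1 else 0

/-- The iterates `w_0 = e₁`, `v_{i+1} = w_i - γ g_{i+1}`, `w_{i+1} = v_{i+1}/‖v_{i+1}‖`, where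
`g_{i+1}` is the answer of `Active-FO(w_i)`, for `i < N`. -/
def psgdIterate {d N : ℕ} (σ γ : ℝ) (ω : Fin N → Draw d) : ℕ → E d
  | 0 => e₁ d
  | i + 1 =>
    if h : i < N then
      let w := psgdIterate σ γ ω i
      let v := w - γ • (activeFO σ w (ω ⟨i, h⟩)).1
      ‖v‖⁻¹ • v
    else psgdIterate σ γ ω i

/-- Number of label queries of the `N` steps of `Active-PSGD`. -/
def psgdQueries {d N : ℕ} (σ γ : ℝ) (ω : Fin N → Draw d) : ℕ :=
  ∑ i : Fin N, (activeFO σ (psgdIterate σ γ ω i) (ω i)).2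

/-! ### The main algorithm -/

/-- Numerical parameters of a run: the smoothing width `σ`, the step size, the number `S` of trials,
the number `N` of steps per trial, the number `M₁` of oracle calls per candidate, and the number
`M₂` of validation examples. -/
structure Params where
  σ : ℝ
  step : ℝ
  S : ℕ
  N : ℕ
  M₁ : ℕ
  M₂ : ℕ

/-- All the randomness of a run: the draws of the `S` trials of `Active-PSGD`, the random indices of
the returned iterates, the draws for the gradient estimates, and the validation examples. -/
abbrev Tape (d : ℕ) (P : Params) : Type :=
  ((Fin P.S → Fin P.N → Draw d) × (Fin P.S → Fin P.N)) ×
    ((Fin P.S → Fin P.M₁ → Draw d) × (Fin P.M₂ → E d × ℝ))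

/-- The law of the tape: everything is independent, draws have law `drawLaw D`, the indices are
uniform on `{0, …, N - 1}`, and validation examples have law `D`. -/
def tapeLaw {d : ℕ} (D : Measure (E d × ℝ)) (P : Params) : Measure (Tape d P) :=
  ((Measure.pi fun _ => Measure.pi fun _ => drawLaw D).prod
      (Measure.pi fun _ => uniformOn (Set.univ : Set (Fin P.N)))).prod
    ((Measure.pi fun _ => Measure.pi fun _ => drawLaw D).prod
      (Measure.pi fun _ => D))

/-- The candidate `w_s`: the output `w_R` of the `s`-th trial of `Active-PSGD`. -/
def candidate {d : ℕ} (P : Params) (ω : Tape d P) (s : Fin P.S) : E d :=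
  psgdIterate P.σ P.step (ω.1.1 s) (ω.1.2 s)

/-- The averaged gradient estimate at the candidate `w_s`. -/
def avgGrad {d : ℕ} (P : Params) (ω : Tape d P) (s : Fin P.S) : E d :=
  (1 / (P.M₁ : ℝ)) • ∑ i : Fin P.M₁, (activeFO P.σ (candidate P ω s) (ω.2.1 s i)).1

/-- The selected candidate: `w_s` with `s` minimizing the norm of the averaged gradient estimate
(the smallest such `s`; the default `0` is used only if there is no trial at all). -/
def selected {d : ℕ} (P : Params) (ω : Tape d P) : E d :=
  ((List.finRange P.S).argmin fun s => ‖avgGrad P ω s‖).elim 0 (candidate P ω)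

/-- Empirical error on the validation examples. -/
def empErr {d : ℕ} (P : Params) (ω : Tape d P) (w : E d) : ℝ :=
  (1 / (P.M₂ : ℝ)) *
    ∑ i : Fin P.M₂, if halfspace w (ω.2.2 i).1 ≠ (ω.2.2 i).2 then (1 : ℝ) else 0

/-- The output of the algorithm: the better of `±w̃` on the validation examples (`w̃` in a tie). -/
def output {d : ℕ} (P : Params) (ω : Tape d P) : E d :=
  if empErr P ω (selected P ω) ≤ empErr P ω (-selected P ω) then selected P ω else -selected P ω

/-- The total number of label queries of the algorithm. -/
def labelQueries {d : ℕ} (P : Params) (ω : Tape d P) : ℕ :=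
  (∑ s : Fin P.S, psgdQueries P.σ P.step (ω.1.1 s)) +
    (∑ s : Fin P.S, ∑ i : Fin P.M₁, (activeFO P.σ (candidate P ω s) (ω.2.1 s i)).2) + P.M₂

/-- The constants hidden in the asymptotic notation of the parameter settings. -/
structure Constants where
  cθ : ℝ
  cσ : ℝ
  cρ : ℝ
  cN : ℝ
  cStep : ℝ
  cM₁ : ℝ
  cM₂ : ℝ
  /-- the exponent of the logarithmic factor in the number of steps and in the step size -/
  k : ℕ

/-- All multiplicative constants are positive. -/
def Constants.Pos (c : Constants) : Prop :=
  0 < c.cθ ∧ 0 < c.cσ ∧ 0 < c.cρ ∧ 0 < c.cN ∧ 0 < c.cStep ∧ 0 < c.cM₁ ∧ 0 < c.cM₂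

/-- `θ₀ = O((1/ln²(1/ε)) ε/2)`. -/
def theta0 (c : Constants) (ε : ℝ) : ℝ := c.cθ * (1 / Real.log (1 / ε) ^ 2 * (ε / 2))

/-- `σ = Θ((1/A)^((1-α)/(3α-1)) θ₀^(2α/(3α-1)))`. -/
def sigmaParam (c : Constants) (A α ε : ℝ) : ℝ :=
  c.cσ * ((1 / A) ^ ((1 - α) / (3 * α - 1)) * theta0 c ε ^ (2 * α / (3 * α - 1)))

/-- `ρ = Θ((1/A)^(2(1-α)/(3α-1)) θ₀^(2(1-α)/(3α-1)))`. -/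
def rhoParam (c : Constants) (A α ε : ℝ) : ℝ :=
  c.cρ * ((1 / A) ^ (2 * (1 - α) / (3 * α - 1)) * theta0 c ε ^ (2 * (1 - α) / (3 * α - 1)))

/-- The number of trials `S = log₂(6/δ)`, rounded up. -/
def numTrials (δ : ℝ) : ℕ := ⌈Real.logb 2 (6 / δ)⌉₊

/-- The parameter settings of the algorithm as functions of the dimension, the noise parameters, the
target excess error `ε` and the failure probability `δ`, up to the constants `c`:
`N = Õ(d/(σ²ρ⁴))`, step size `Θ̃(ρ²σ²/d)`, `M₁ = c d/(σ²ρ²) ln(S/δ)` and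
`M₂ = O(A^((2-2α)/α) α⁻² ln(6/δ))`. -/
def params (c : Constants) (d : ℕ) (A α ε δ : ℝ) : Params :=
  let σ := sigmaParam c A α ε
  let ρ := rhoParam c A α ε
  let S := numTrials δ
  { σ := σ
    step := c.cStep * (ρ ^ 2 * σ ^ 2 / d) / Real.log (d / ε) ^ c.k
    S := S
    N := ⌈c.cN * (d / (σ ^ 2 * ρ ^ 4)) * Real.log (d / ε) ^ c.k⌉₊
    M₁ := ⌈c.cM₁ * (d / (σ ^ 2 * ρ ^ 2)) * Real.log (S / δ)⌉₊
    M₂ := ⌈c.cM₂ * (A ^ ((2 - 2 * α) / α) * (1 / α ^ 2)) * Real.log (6 / δ)⌉₊ }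

end ActiveHalfspace

end

open ActiveHalfspace

open ActiveHalfspace
open scoped ENNReal

/-! The smoothed loss `E φ_σ(y⟨w,x⟩)` differs from `smoothLoss` by a constant, and its tangential
gradient at a unit vector is `lossGrad`, the mean answer of the oracle. The theorem rests on two
facts: stationary points of this loss are good classifiers up to sign, and stationary points can be
found with few labels because each draw is queried with probability of order `σ` up to logarithms.

Structure. Write `w*/‖w*‖ = a w + b u` with `u ⊥ w` a unit vector. Everything then lives in the
plane of `u, w`, where the density bounds apply. If the sine `b` exceeds `θ`, the derivative in
direction `u` has a signal and a loss. The signal comes from a rectangle of mass of order `σ` along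
the boundary of `w`: Tsybakov noise leaves correlation of order `(σ/A)^((1-α)/α)` on half of it. The
loss comes from the wedge where `w*` disagrees with the sign of `⟨u,x⟩`, and is of order `σ²/b²`.
With `X = (θ/A)^((1-α)/(3α-1))` the choice `σ = sθX` makes both terms multiples of `X²`. The signal
wins for small `s` because `(1-α)/α < 2`, which is exactly `α > 1/3`. Hence a gradient below `ρ =
rX²` forces `b ≤ θ` (`le_norm_lossGrad`, `exists_width_constants`), and then one of `±w` has excess
error at most `ε/32` (`excess_err_le_of_norm_lossGrad_lt`, `angle_condition`).

Optimization. A normalized tangential step is a rotation along a great circle. Along it the loss has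
second derivative of order `1/σ` up to logarithms, since a strip of width `σ` has mass of that order
(`lintegral_strip_le`, `smoothLoss_step_le`). The stochastic gradient has second moment of order
`d/σ`. Telescoping bounds the mean of the squared gradient norms along the trajectory, and Markov's
inequality makes each trial succeed with probability at least one half (`measure_trial_fails_le`).
Independence gives failure `2^(-S)` for all trials together.

Selection and validation. A Pinelis-type inequality for Hilbert space valued sums
(`cosh_norm_add_le`, `measure_norm_sum_ge_le`) makes all averaged gradients accurate to `ρ/4`, so
the selected candidate is stationary up to `ρ`. The noise condition keeps the error of `w*` below
`1/2` by a multiple of `A^(-(1-α)/α)`, so `M₂` examples decide the sign by a Hoeffding bound.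

Label count. Each trial uses `N ≈ d/(σ²ρ⁴)` draws, of which a fraction of order `σ` is queried, so
`d/(σρ⁴) ≈ d/(θX⁹)` dominates up to logarithms. Inserting `X` gives the stated powers of `A` and
`1/ε` (`inv_scale_eq`, `label_bound`). -/

namespace ActiveHalfspace

/-! ### Resampling one coordinate of a product measure -/

section Resampling

variable {Ω : Type*} [MeasurableSpace Ω] {N : ℕ}

/-- Replacing one coordinate of a sample of a product probability measure by an independent copy
does not change its law. -/
lemma measurePreserving_update (μ : Measure Ω) [IsProbabilityMeasure μ] (i : Fin N) :
    MeasurePreserving (fun p : (Fin N → Ω) × Ω => Function.update p.1 i p.2)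
      ((Measure.pi fun _ => μ).prod μ) (Measure.pi fun _ => μ) := by
  have hm : Measurable (fun p : (Fin N → Ω) × Ω => Function.update p.1 i p.2) := by
    rw [measurable_pi_iff]
    intro j
    by_cases hj : j = i
    · subst hj; simpa using measurable_snd
    · simp only [Function.update_of_ne hj]
      exact (measurable_pi_apply j).comp measurable_fst
  refine ⟨hm, (Measure.pi_eq fun s hs => ?_).symm⟩
  rw [Measure.map_apply hm (MeasurableSet.univ_pi hs)]
  have : (fun p : (Fin N → Ω) × Ω => Function.update p.1 i p.2) ⁻¹' (Set.univ.pi s)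
      = (Set.univ.pi (Function.update s i Set.univ)) ×ˢ s i := by
    ext p
    simp only [Set.mem_preimage, Set.mem_univ_pi, Set.mem_prod]
    constructor
    · intro h
      refine ⟨fun j => ?_, by simpa using h i⟩
      by_cases hj : j = i
      · subst hj; simp
      · simpa [Function.update_of_ne hj] using h j
    · rintro ⟨h1, h2⟩ j
      by_cases hj : j = i
      · subst hj; simpa using h2
      · simpa [Function.update_of_ne hj] using h1 j
  rw [this, Measure.prod_prod, Measure.pi_pi]
  have h1 : ∀ j, μ (Function.update s i Set.univ j)
      = Function.update (fun j => μ (s j)) i 1 j := by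
    intro j
    by_cases hj : j = i
    · subst hj; simp
    · simp [Function.update_of_ne hj]
  simp_rw [h1]
  rw [Finset.prod_update_of_mem (Finset.mem_univ i), one_mul, mul_comm]
  rw [← Finset.mul_prod_erase Finset.univ (fun j => μ (s j)) (Finset.mem_univ i),
    Finset.sdiff_singleton_eq_erase]

/-- The inner integral plays the role of the conditional expectation given all other coordinates.
Martingale-type arguments below use it in place of filtrations. -/
lemma lintegral_pi_update (μ : Measure Ω) [IsProbabilityMeasure μ] (i : Fin N)
    {F : (Fin N → Ω) → ℝ≥0∞} (hF : Measurable F) :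
    ∫⁻ ω, F ω ∂(Measure.pi fun _ => μ)
      = ∫⁻ ω, ∫⁻ z, F (Function.update ω i z) ∂μ ∂(Measure.pi fun _ => μ) := by
  have h := measurePreserving_update μ i
  rw [← h.lintegral_comp hF]
  exact lintegral_prod _ (hF.comp h.measurable).aemeasurable

/-- A nonnegative process on a product space that grows in conditional mean by at most a factor `c`
in each step. -/
lemma lintegral_le_pow_of_step (μ : Measure Ω) [IsProbabilityMeasure μ]
    {F : ℕ → (Fin N → Ω) → ℝ≥0∞} (hF : ∀ i, Measurable (F i)) (c : ℝ≥0∞)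
    (h : ∀ i (hi : i < N) ω, ∫⁻ z, F (i + 1) (Function.update ω ⟨i, hi⟩ z) ∂μ ≤ c * F i ω) :
    ∀ n ≤ N, ∫⁻ ω, F n ω ∂(Measure.pi fun _ => μ)
      ≤ c ^ n * ∫⁻ ω, F 0 ω ∂(Measure.pi fun _ => μ) := by
  intro n hn
  induction n with
  | zero => simp
  | succ n ih =>
    rw [lintegral_pi_update μ ⟨n, hn⟩ (hF _)]
    calc _ ≤ ∫⁻ ω, c * F n ω ∂(Measure.pi fun _ => μ) := lintegral_mono (h n hn)
      _ = c * ∫⁻ ω, F n ω ∂(Measure.pi fun _ => μ) := lintegral_const_mul _ (hF n)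
      _ ≤ c * (c ^ n * ∫⁻ ω, F 0 ω ∂(Measure.pi fun _ => μ)) := mul_le_mul' le_rfl (ih (by omega))
      _ = _ := by rw [pow_succ, ← mul_assoc, mul_comm c]

/-- A nonnegative process on a product space that grows in conditional mean by at most `e` in each
step. -/
lemma lintegral_le_add_of_step (μ : Measure Ω) [IsProbabilityMeasure μ]
    {F : ℕ → (Fin N → Ω) → ℝ≥0∞} (hF : ∀ i, Measurable (F i)) (e : ℝ≥0∞)
    (h : ∀ i (hi : i < N) ω, ∫⁻ z, F (i + 1) (Function.update ω ⟨i, hi⟩ z) ∂μ ≤ F i ω + e) :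
    ∀ n ≤ N, ∫⁻ ω, F n ω ∂(Measure.pi fun _ => μ)
      ≤ ∫⁻ ω, F 0 ω ∂(Measure.pi fun _ => μ) + n * e := by
  intro n hn
  induction n with
  | zero => simp
  | succ n ih =>
    rw [lintegral_pi_update μ ⟨n, hn⟩ (hF _)]
    calc _ ≤ ∫⁻ ω, (F n ω + e) ∂(Measure.pi fun _ => μ) := lintegral_mono (h n hn)
      _ = ∫⁻ ω, F n ω ∂(Measure.pi fun _ => μ) + e := by
        rw [lintegral_add_left (hF n)]; simp
      _ ≤ ∫⁻ ω, F 0 ω ∂(Measure.pi fun _ => μ) + n * e + e := add_le_add (ih (by omega)) le_rfl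
      _ = _ := by push_cast; ring

end Resampling

/-! ### Exponential inequalities for sums of independent vectors -/

/-- Jensen's inequality for the convex function `z ↦ cosh √z`. -/
lemma cosh_le_sum_mul_cosh {ι : Type*} (s : Finset ι) (w p : ι → ℝ) (y : ℝ)
    (hw : ∀ i ∈ s, 0 ≤ w i) (hw1 : ∑ i ∈ s, w i = 1) (hy : y ^ 2 ≤ ∑ i ∈ s, w i * p i ^ 2) :
    Real.cosh y ≤ ∑ i ∈ s, w i * Real.cosh (p i) := by
  -- `cosh √z` is a power series in `z` with nonnegative coefficients, so Jensen for each `z ^ n`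
  -- can be applied term by term.
  refine hasSum_le (fun n => ?_) (Real.hasSum_cosh y)
    (hasSum_sum fun i _ => (Real.hasSum_cosh (p i)).mul_left (w i))
  have h2 : (y ^ 2) ^ n ≤ ∑ i ∈ s, w i * (p i ^ 2) ^ n := by
    calc (y ^ 2) ^ n ≤ (∑ i ∈ s, w i * p i ^ 2) ^ n := by gcongr
      _ ≤ _ := by
        have := (convexOn_pow (𝕜 := ℝ) n).map_sum_le (t := s) (w := w) (p := fun i => p i ^ 2) hw hw1
          (fun i _ => by simpa using sq_nonneg (p i))
        simpa using this
  rw [pow_mul, div_le_iff₀ (by positivity), Finset.sum_mul]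
  refine h2.trans (le_of_eq (Finset.sum_congr rfl fun i _ => ?_))
  rw [pow_mul]
  field_simp

/-- `cosh (c t) - 1 ≤ c² (cosh t - 1)` for `|c| ≤ 1`. -/
lemma cosh_mul_sub_one_le {c t : ℝ} (hc : c ^ 2 ≤ 1) :
    Real.cosh (c * t) - 1 ≤ c ^ 2 * (Real.cosh t - 1) := by
  have := cosh_le_sum_mul_cosh (Finset.univ : Finset (Fin 2)) ![c ^ 2, 1 - c ^ 2] ![t, 0] (c * t)
    (by
      intro i _; fin_cases i
      · exact sq_nonneg c
      · exact sub_nonneg.2 hc) (by simp) (by simp [mul_pow])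
  simp at this
  linarith

lemma self_le_sinh {b : ℝ} (hb : 0 ≤ b) : b ≤ Real.sinh b := Real.self_le_sinh_iff.2 hb

lemma sinh_sub_self_le {b : ℝ} : Real.sinh b - b ≤ Real.cosh b - 1 := by
  have h1 := Real.add_one_le_exp (-b)
  have h2 := Real.cosh_sub_sinh b
  linarith

variable {H : Type*} [NormedAddCommGroup H] [InnerProductSpace ℝ H]

/-- The pointwise inequality behind Pinelis' martingale inequality in Hilbert spaces. -/
lemma cosh_norm_add_le (s x : H) :
    Real.cosh ‖s + x‖ ≤ Real.cosh ‖s‖ * (2 * Real.cosh ‖x‖ - 1)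
      + (Real.sinh ‖s‖ / ‖s‖) * inner ℝ s x := by
  set a := ‖s‖ with ha
  set b := ‖x‖ with hb
  have hb0 : 0 ≤ b := norm_nonneg _
  have ha0 : 0 ≤ a := norm_nonneg _
  have hcb := Real.one_le_cosh b
  have hca := Real.one_le_cosh a
  rcases eq_or_lt_of_le ha0 with h | hapos
  · have : s = 0 := norm_eq_zero.1 (by rw [← ha, ← h])
    subst this
    simp [← h] ; rw [← hb]; linarith
  rcases eq_or_lt_of_le hb0 with h | hbpos
  · have : x = 0 := norm_eq_zero.1 (by rw [← hb, ← h])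
    subst this
    simp [← h]; rw [← ha]; linarith
  set I : ℝ := inner ℝ s x with hI
  have hIab : |I| ≤ a * b := abs_real_inner_le_norm s x
  set c := I / (a * b) with hc
  have hab : 0 < a * b := by positivity
  have hIc : I = c * (a * b) := by rw [hc]; field_simp
  have hc1 : |c| ≤ 1 := by
    rw [hc, abs_div, abs_of_pos hab, div_le_one hab]; exact hIab
  obtain ⟨hc2, hc3⟩ := abs_le.1 hc1
  -- With `c` the cosine of the angle, `‖s + x‖²` is the average of `(a + b)²` and `(a - b)²` with
  -- weights `(1 ± c)/2`. The averaged `cosh` is `cosh a cosh b + c sinh a sinh b`.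
  have key := cosh_le_sum_mul_cosh (Finset.univ : Finset (Fin 2)) ![(1 + c) / 2, (1 - c) / 2]
    ![a + b, a - b] ‖s + x‖ (by intro i _; fin_cases i <;> simp <;> linarith)
    (by simp; ring) (by
      rw [norm_add_sq_real, ← hI, hIc, ← ha, ← hb]; simp; apply le_of_eq; ring)
  simp only [Fin.sum_univ_two, Matrix.cons_val_zero, Matrix.cons_val_one, Real.cosh_add,
    Real.cosh_sub] at key
  have hsa : Real.sinh a ≤ Real.cosh a := (Real.sinh_lt_cosh a).le
  have hsa0 : 0 ≤ Real.sinh a := Real.sinh_nonneg_iff.2 ha0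
  have hsb : 0 ≤ Real.sinh b - b := sub_nonneg.2 (self_le_sinh hb0)
  have hsb2 := sinh_sub_self_le (b := b)
  have e1 : Real.sinh a / a * I = c * Real.sinh a * b := by rw [hIc]; field_simp
  rw [e1]
  -- Replacing `sinh b` by `b` makes the term with `c` linear in `x`, so that it vanishes in mean
  -- for centred `x`. The remainder costs a second copy of `cosh b - 1`.
  have h3 : c * (Real.sinh a * (Real.sinh b - b)) ≤ Real.cosh a * (Real.cosh b - 1) := by
    calc c * (Real.sinh a * (Real.sinh b - b)) ≤ 1 * (Real.sinh a * (Real.sinh b - b)) := by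
          gcongr
      _ ≤ Real.cosh a * (Real.cosh b - 1) := by rw [one_mul]; gcongr
  nlinarith [h3, key]

/-! ### Tail bounds for sums over a product space -/

section Tails

variable {Ω : Type*} [MeasurableSpace Ω] {N : ℕ}

/-- The sum of the first `i` terms. -/
def partialSum {M : Type*} [AddCommMonoid M] (g : Fin N → M) (i : ℕ) : M :=
  ∑ j : Fin N, if (j : ℕ) < i then g j else 0

lemma partialSum_zero {M : Type*} [AddCommMonoid M] (g : Fin N → M) : partialSum g 0 = 0 := by
  simp [partialSum]

lemma partialSum_full {M : Type*} [AddCommMonoid M] (g : Fin N → M) :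
    partialSum g N = ∑ j, g j := by
  simp [partialSum]

lemma partialSum_succ {M : Type*} [AddCommMonoid M] (g : Fin N → M) {i : ℕ} (hi : i < N) :
    partialSum g (i + 1) = partialSum g i + g ⟨i, hi⟩ := by
  have : g ⟨i, hi⟩ = ∑ j : Fin N, if j = ⟨i, hi⟩ then g j else 0 := by simp
  rw [this, partialSum, partialSum, ← Finset.sum_add_distrib]
  refine Finset.sum_congr rfl fun j _ => ?_
  by_cases hj : j = ⟨i, hi⟩
  · subst hj; simp
  · have : (j : ℕ) ≠ i := fun h => hj (Fin.ext h)
    by_cases h : (j : ℕ) < i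
    · simp [h, hj, Nat.lt_succ_of_lt h]
    · have h' : ¬ (j : ℕ) < i + 1 := by omega
      simp [h, hj, h']

lemma partialSum_congr {M : Type*} [AddCommMonoid M] {g g' : Fin N → M} {i : ℕ}
    (h : ∀ j : Fin N, (j : ℕ) < i → g j = g' j) : partialSum g i = partialSum g' i := by
  refine Finset.sum_congr rfl fun j _ => ?_
  split_ifs with hj
  · exact h j hj
  · rfl

lemma measurable_partialSum {M : Type*} [AddCommMonoid M] [MeasurableSpace M] [MeasurableAdd₂ M]
    {α : Type*} [MeasurableSpace α] {g : Fin N → α → M} (hg : ∀ j, Measurable (g j)) (i : ℕ) :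
    Measurable fun ω => partialSum (fun j => g j ω) i := by
  refine Finset.measurable_fun_sum _ fun j _ => ?_
  split_ifs
  · exact hg j
  · exact measurable_const

/-- Markov's inequality with the exponential function. -/
lemma measure_le_of_lintegral_exp_le {α : Type*} [MeasurableSpace α] {μ : Measure α} {Y : α → ℝ}
    (hY : Measurable Y) {b : ℝ} (h : ∫⁻ ω, ENNReal.ofReal (Real.exp (Y ω)) ∂μ
      ≤ ENNReal.ofReal (Real.exp b)) (t : ℝ) :
    μ {ω | t ≤ Y ω} ≤ ENNReal.ofReal (Real.exp (b - t)) := by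
  have h1 : {ω | t ≤ Y ω}
      ⊆ {ω | ENNReal.ofReal (Real.exp t) ≤ ENNReal.ofReal (Real.exp (Y ω))} := by
    intro ω hω
    exact ENNReal.ofReal_le_ofReal (Real.exp_le_exp.2 hω)
  have hpos : ENNReal.ofReal (Real.exp t) ≠ 0 := by simp [Real.exp_pos]
  refine (measure_mono h1).trans ((meas_ge_le_lintegral_div
    (Real.measurable_exp.comp hY).ennreal_ofReal.aemeasurable hpos ENNReal.ofReal_ne_top).trans ?_)
  rw [Real.exp_sub, ENNReal.ofReal_div_of_pos (Real.exp_pos t)]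
  exact ENNReal.div_le_div_right h _

variable {H : Type*} [NormedAddCommGroup H] [InnerProductSpace ℝ H] [MeasurableSpace H]
  [BorelSpace H] [SecondCountableTopology H] [CompleteSpace H]

/-- A Bernstein-type bound for sums of independent, identically distributed centred vectors. -/
lemma measure_norm_sum_ge_le (μ : Measure Ω) [IsProbabilityMeasure μ] {X : Ω → H}
    (hX : Measurable X) (hint : Integrable X μ) (h0 : ∫ z, X z ∂μ = 0)
    (hc : Integrable (fun z => Real.cosh ‖X z‖) μ) {v : ℝ}
    (hv : ∫ z, (Real.cosh ‖X z‖ - 1) ∂μ ≤ v) (t : ℝ) :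
    (Measure.pi fun _ : Fin N => μ) {ω | t ≤ ‖∑ i, X (ω i)‖}
      ≤ ENNReal.ofReal (2 * Real.exp (2 * N * v - t)) := by
  have hv0 : 0 ≤ v := le_trans (integral_nonneg fun z => sub_nonneg.2 (Real.one_le_cosh _)) hv
  have hXi : ∀ j : Fin N, Measurable fun ω : Fin N → Ω => X (ω j) :=
    fun j => hX.comp (measurable_pi_apply j)
  have hmeas : ∀ i, Measurable fun ω : Fin N → Ω =>
      ENNReal.ofReal (Real.cosh ‖partialSum (fun j => X (ω j)) i‖) := fun i =>
    (Real.continuous_cosh.measurable.comp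
      (measurable_partialSum hXi i).norm).ennreal_ofReal
  have key := lintegral_le_pow_of_step μ hmeas (ENNReal.ofReal (Real.exp (2 * v))) (by
    intro i hi ω
    set s := partialSum (fun j => X (ω j)) i with hs
    have e1 : ∀ z, partialSum (fun j => X (Function.update ω ⟨i, hi⟩ z j)) (i + 1) = s + X z := by
      intro z
      rw [partialSum_succ _ hi, Function.update_self]
      congr 1
      refine partialSum_congr fun j hj => ?_
      rw [Function.update_of_ne]
      intro h; rw [h] at hj; simp at hj
    simp_rw [e1]
    have hI : Integrable (fun z => Real.cosh ‖s‖ * (2 * Real.cosh ‖X z‖ - 1)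
        + (Real.sinh ‖s‖ / ‖s‖) * inner ℝ s (X z)) μ :=
      (((hc.const_mul 2).sub (integrable_const 1)).const_mul _).add
        ((hint.const_inner s).const_mul _)
    calc ∫⁻ z, ENNReal.ofReal (Real.cosh ‖s + X z‖) ∂μ
        ≤ ∫⁻ z, ENNReal.ofReal (Real.cosh ‖s‖ * (2 * Real.cosh ‖X z‖ - 1)
        + (Real.sinh ‖s‖ / ‖s‖) * inner ℝ s (X z)) ∂μ :=
          lintegral_mono fun z => ENNReal.ofReal_le_ofReal (cosh_norm_add_le s (X z))
      _ = ENNReal.ofReal (∫ z, (Real.cosh ‖s‖ * (2 * Real.cosh ‖X z‖ - 1)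
        + (Real.sinh ‖s‖ / ‖s‖) * inner ℝ s (X z)) ∂μ) := by
          rw [ofReal_integral_eq_lintegral_ofReal hI]
          exact Filter.Eventually.of_forall fun z =>
            le_trans (Real.cosh_pos _).le (cosh_norm_add_le s (X z))
      _ ≤ ENNReal.ofReal (Real.exp (2 * v) * Real.cosh ‖s‖) := by
          apply ENNReal.ofReal_le_ofReal
          -- The linear term integrates to zero because `X` is centred. What remains is the factor
          -- `1 + 2 E(cosh ‖X‖ - 1) ≤ exp (2v)`.
          have I1 : Integrable (fun z => Real.cosh ‖s‖ * (2 * Real.cosh ‖X z‖ - 1)) μ :=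
            ((hc.const_mul 2).sub (integrable_const 1)).const_mul _
          rw [integral_add I1 ((hint.const_inner s).const_mul _), integral_const_mul, integral_const_mul,
            integral_inner hint, h0, inner_zero_right, mul_zero, add_zero, mul_comm]
          gcongr
          have h3 : ∫ z, (2 * Real.cosh ‖X z‖ - 1) ∂μ
              = 2 * ∫ z, (Real.cosh ‖X z‖ - 1) ∂μ + 1 := by
            rw [integral_sub (hc.const_mul 2) (integrable_const 1), integral_const_mul,
              integral_sub hc (integrable_const 1)]
            simp; ring
          rw [h3]
          have := Real.add_one_le_exp (2 * v)
          linarith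
      _ = _ := ENNReal.ofReal_mul (Real.exp_pos _).le) N le_rfl
  simp only [partialSum_full, partialSum_zero, norm_zero, Real.cosh_zero, ENNReal.ofReal_one,
    lintegral_const, measure_univ, mul_one] at key
  rw [← ENNReal.ofReal_pow (Real.exp_pos _).le, ← Real.exp_nat_mul] at key
  have hm : Measurable fun ω : Fin N → Ω => ‖∑ i, X (ω i)‖ :=
    (Finset.measurable_fun_sum _ fun j _ => hXi j).norm
  -- The `log 2` pays for `exp x ≤ 2 cosh x`.
  have := measure_le_of_lintegral_exp_le (μ := Measure.pi fun _ : Fin N => μ) hm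
    (b := Real.log 2 + 2 * N * v) ?_ t
  · refine this.trans (ENNReal.ofReal_le_ofReal (le_of_eq ?_))
    rw [add_sub_assoc, Real.exp_add, Real.exp_log two_pos]
  · calc ∫⁻ ω : Fin N → Ω, ENNReal.ofReal (Real.exp ‖∑ i, X (ω i)‖) ∂(Measure.pi fun _ => μ)
        ≤ ∫⁻ ω : Fin N → Ω, ENNReal.ofReal 2 * ENNReal.ofReal (Real.cosh ‖∑ i, X (ω i)‖)
            ∂(Measure.pi fun _ => μ) := by
          refine lintegral_mono fun ω => ?_
          rw [← ENNReal.ofReal_mul two_pos.le]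
          apply ENNReal.ofReal_le_ofReal
          rw [Real.cosh_eq]
          have := Real.exp_pos (-‖∑ i, X (ω i)‖)
          linarith
      _ = ENNReal.ofReal 2 * ∫⁻ ω : Fin N → Ω, ENNReal.ofReal (Real.cosh ‖∑ i, X (ω i)‖)
            ∂(Measure.pi fun _ => μ) := lintegral_const_mul' _ _ ENNReal.ofReal_ne_top
      _ ≤ ENNReal.ofReal 2 * ENNReal.ofReal (Real.exp (N * (2 * v))) := by gcongr
      _ = _ := by
          rw [← ENNReal.ofReal_mul two_pos.le, Real.exp_add, Real.exp_log two_pos]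
          ring_nf

/-- Tail bound for the number of successes in adaptively chosen Bernoulli trials. -/
lemma measure_sum_nat_ge_le (μ : Measure Ω) [IsProbabilityMeasure μ]
    {Z : Fin N → (Fin N → Ω) → ℕ} (hZ : ∀ i, Measurable (Z i)) (hZ1 : ∀ i ω, Z i ω ≤ 1)
    (hadapt : ∀ (i j : Fin N) ω z, j < i → Z j (Function.update ω i z) = Z j ω) {p : ℝ}
    (hp0 : 0 ≤ p)
    (hp : ∀ i ω, μ {z | Z i (Function.update ω i z) = 1} ≤ ENNReal.ofReal p) (t : ℝ) :
    (Measure.pi fun _ : Fin N => μ) {ω | 2 * p * N + t ≤ ((∑ i, Z i ω : ℕ) : ℝ)}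
      ≤ ENNReal.ofReal (Real.exp (-t)) := by
  have hZr : ∀ i : ℕ, Measurable fun ω : Fin N → Ω => ((partialSum (fun j => Z j ω) i : ℕ) : ℝ) :=
    fun i => measurable_from_top.comp (measurable_partialSum hZ i)
  have hmeas : ∀ i, Measurable fun ω : Fin N → Ω =>
      ENNReal.ofReal (Real.exp ((partialSum (fun j => Z j ω) i : ℕ) : ℝ)) := fun i =>
    (Real.measurable_exp.comp (hZr i)).ennreal_ofReal
  have hupd : ∀ (i : Fin N) (ω : Fin N → Ω), Measurable fun z => Function.update ω i z :=
    fun i ω => measurable_update ω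
  have key := lintegral_le_pow_of_step μ hmeas (ENNReal.ofReal (Real.exp (2 * p))) (by
    intro i hi ω
    set s := partialSum (fun j => Z j ω) i with hs
    have e1 : ∀ z, partialSum (fun j => Z j (Function.update ω ⟨i, hi⟩ z)) (i + 1)
        = s + Z ⟨i, hi⟩ (Function.update ω ⟨i, hi⟩ z) := by
      intro z
      rw [partialSum_succ _ hi]
      congr 1
      exact partialSum_congr fun j hj => hadapt _ _ _ _ hj
    simp_rw [e1]
    set B := {z | Z ⟨i, hi⟩ (Function.update ω ⟨i, hi⟩ z) = 1} with hB
    have hBm : MeasurableSet B := ((hZ _).comp (hupd _ _)) (measurableSet_singleton 1)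
    -- For an indicator `Z`, `exp Z ≤ 1 + 2 Z` because `e ≤ 3`. This is the source of the factor 2
    -- in `2 p N`.
    have e2 : ∀ z, ENNReal.ofReal (Real.exp
        ((s + Z ⟨i, hi⟩ (Function.update ω ⟨i, hi⟩ z) : ℕ) : ℝ))
        ≤ ENNReal.ofReal (Real.exp s) * (1 + ENNReal.ofReal 2 * B.indicator 1 z) := by
      intro z
      push_cast
      rw [Real.exp_add, ENNReal.ofReal_mul (Real.exp_pos _).le]
      gcongr
      by_cases hz : z ∈ B
      · have h1 : Z ⟨i, hi⟩ (Function.update ω ⟨i, hi⟩ z) = 1 := hz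
        rw [h1, Set.indicator_of_mem hz, Pi.one_apply, mul_one, ← ENNReal.ofReal_one,
          ← ENNReal.ofReal_add zero_le_one two_pos.le]
        apply ENNReal.ofReal_le_ofReal
        have := Real.exp_one_lt_d9
        norm_num; linarith
      · have h1 : Z ⟨i, hi⟩ (Function.update ω ⟨i, hi⟩ z) = 0 := by
          have := hZ1 ⟨i, hi⟩ (Function.update ω ⟨i, hi⟩ z)
          have h2 : Z ⟨i, hi⟩ (Function.update ω ⟨i, hi⟩ z) ≠ 1 := hz
          omega
        rw [h1]; simp
    refine (lintegral_mono e2).trans ?_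
    rw [lintegral_const_mul' _ _ ENNReal.ofReal_ne_top, lintegral_add_left measurable_const,
      lintegral_const_mul' _ _ ENNReal.ofReal_ne_top, lintegral_indicator_one hBm, mul_comm]
    gcongr
    simp only [lintegral_const, measure_univ, mul_one]
    calc 1 + ENNReal.ofReal 2 * μ B ≤ ENNReal.ofReal 1 + ENNReal.ofReal 2 * ENNReal.ofReal p := by
          rw [ENNReal.ofReal_one]; gcongr; exact hp _ _
      _ = ENNReal.ofReal (1 + 2 * p) := by
          rw [← ENNReal.ofReal_mul two_pos.le, ← ENNReal.ofReal_add zero_le_one (by positivity)]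
      _ ≤ _ := ENNReal.ofReal_le_ofReal (by have := Real.add_one_le_exp (2 * p); linarith))
    N le_rfl
  simp only [partialSum_full, partialSum_zero, Nat.cast_zero, Real.exp_zero, ENNReal.ofReal_one,
    lintegral_const, measure_univ, mul_one] at key
  rw [← ENNReal.ofReal_pow (Real.exp_pos _).le, ← Real.exp_nat_mul] at key
  have hm := hZr N
  simp only [partialSum_full] at hm
  refine (measure_le_of_lintegral_exp_le hm key _).trans (ENNReal.ofReal_le_ofReal ?_)
  apply Real.exp_le_exp.2
  linarith

/-- One-sided Hoeffding bound for bounded independent, identically distributed variables. -/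
lemma measure_sum_nonneg_le (μ : Measure Ω) [IsProbabilityMeasure μ] {X : Ω → ℝ}
    (hX : Measurable X) (hX1 : ∀ z, |X z| ≤ 1) {g : ℝ} (hg0 : 0 ≤ g) (hg1 : g ≤ 1)
    (hg : ∫ z, X z ∂μ ≤ -g) :
    (Measure.pi fun _ : Fin N => μ) {ω | 0 ≤ ∑ i, X (ω i)}
      ≤ ENNReal.ofReal (Real.exp (-(N * (g ^ 2 / 4)))) := by
  have hXi : ∀ j : Fin N, Measurable fun ω : Fin N → Ω => X (ω j) :=
    fun j => hX.comp (measurable_pi_apply j)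
  have hint : Integrable X μ :=
    Integrable.of_bound hX.aestronglyMeasurable 1 (Filter.Eventually.of_forall hX1)
  have hmeas : ∀ i, Measurable fun ω : Fin N → Ω =>
      ENNReal.ofReal (Real.exp (g / 2 * partialSum (fun j => X (ω j)) i)) := fun i =>
    (Real.measurable_exp.comp ((measurable_partialSum hXi i).const_mul _)).ennreal_ofReal
  -- The tilt `g / 2` is tuned to `exp x ≤ 1 + x + x²`: one factor has mean at most `1 - g²/2 +
  -- g²/4`.
  have key := lintegral_le_pow_of_step μ hmeas (ENNReal.ofReal (Real.exp (-(g ^ 2 / 4)))) (by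
    intro i hi ω
    set s := partialSum (fun j => X (ω j)) i with hs
    have e1 : ∀ z, partialSum (fun j => X (Function.update ω ⟨i, hi⟩ z j)) (i + 1) = s + X z := by
      intro z
      rw [partialSum_succ _ hi, Function.update_self]
      congr 1
      refine partialSum_congr fun j hj => ?_
      rw [Function.update_of_ne]
      intro h; rw [h] at hj; simp at hj
    simp_rw [e1]
    have e2 : ∀ z, Real.exp (g / 2 * (s + X z))
        ≤ Real.exp (g / 2 * s) * (1 + g / 2 * X z + (g / 2) ^ 2) := by
      intro z
      rw [mul_add, Real.exp_add]
      gcongr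
      have h1 : |g / 2 * X z| ≤ g / 2 := by
        rw [abs_mul, abs_of_nonneg (by positivity)]
        exact mul_le_of_le_one_right (by positivity) (hX1 z)
      have h2 := (abs_le.1 (Real.abs_exp_sub_one_sub_id_le (h1.trans (by linarith)))).2
      have h3 : (g / 2 * X z) ^ 2 ≤ (g / 2) ^ 2 := sq_le_sq' (by linarith [abs_le.1 h1])
        (abs_le.1 h1).2
      linarith
    have hI : Integrable (fun z => Real.exp (g / 2 * s) * (1 + g / 2 * X z + (g / 2) ^ 2)) μ :=
      (((integrable_const _).add (hint.const_mul _)).add (integrable_const _)).const_mul _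
    refine (lintegral_mono fun z => ENNReal.ofReal_le_ofReal (e2 z)).trans ?_
    rw [← ofReal_integral_eq_lintegral_ofReal hI
      (Filter.Eventually.of_forall fun z => (Real.exp_pos _).le.trans (e2 z)),
      ← ENNReal.ofReal_mul (Real.exp_pos _).le]
    apply ENNReal.ofReal_le_ofReal
    rw [integral_const_mul, mul_comm]
    gcongr
    have I1 : Integrable (fun z => 1 + g / 2 * X z) μ := (integrable_const _).add (hint.const_mul _)
    rw [integral_add I1 (integrable_const _),
      integral_add (integrable_const _) (hint.const_mul _), integral_const_mul]
    simp only [integral_const, probReal_univ, one_smul]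
    have h4 := Real.add_one_le_exp (-(g ^ 2 / 4))
    nlinarith [mul_le_mul_of_nonneg_left hg (by positivity : 0 ≤ g / 2)]) N le_rfl
  simp only [partialSum_full, partialSum_zero, mul_zero, Real.exp_zero, ENNReal.ofReal_one,
    lintegral_const, measure_univ, mul_one] at key
  rw [← ENNReal.ofReal_pow (Real.exp_pos _).le, ← Real.exp_nat_mul] at key
  have hm : Measurable fun ω : Fin N → Ω => g / 2 * ∑ i, X (ω i) :=
    (Finset.measurable_fun_sum _ fun j _ => hXi j).const_mul _
  refine (measure_mono fun ω hω => ?_).trans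
    ((measure_le_of_lintegral_exp_le hm key 0).trans (ENNReal.ofReal_le_ofReal ?_))
  · have h0 : 0 ≤ ∑ i, X (ω i) := hω
    exact mul_nonneg (by positivity) h0
  · apply Real.exp_le_exp.2
    linarith

end Tails

/-! ### The softmax loss -/

/-- The logistic density `φ_σ (1 - φ_σ)`, so that `φ_σ' = - logistic / σ`. -/
noncomputable def logistic (σ t : ℝ) : ℝ := softmaxLoss σ t * (1 - softmaxLoss σ t)

lemma softmaxLoss_pos (σ t : ℝ) : 0 < softmaxLoss σ t := by
  unfold softmaxLoss; positivity

lemma softmaxLoss_lt_one (σ t : ℝ) : softmaxLoss σ t < 1 := by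
  unfold softmaxLoss
  rw [div_lt_one (by positivity)]
  linarith [Real.exp_pos (t / σ)]

lemma logistic_pos (σ t : ℝ) : 0 < logistic σ t :=
  mul_pos (softmaxLoss_pos σ t) (sub_pos.2 (softmaxLoss_lt_one σ t))

lemma logistic_eq (σ t : ℝ) :
    logistic σ t = Real.exp (t / σ) / (1 + Real.exp (t / σ)) ^ 2 := by
  unfold logistic softmaxLoss
  have : 1 + Real.exp (t / σ) ≠ 0 := by positivity
  field_simp
  ring

lemma logistic_neg (σ t : ℝ) : logistic σ (-t) = logistic σ t := by
  rw [logistic_eq, logistic_eq, neg_div, Real.exp_neg]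
  have := Real.exp_pos (t / σ)
  field_simp
  ring

lemma logistic_abs (σ t : ℝ) : logistic σ |t| = logistic σ t := by
  rcases abs_choice t with h | h <;> rw [h]
  exact logistic_neg σ t

lemma logistic_le {σ : ℝ} (t : ℝ) : logistic σ t ≤ Real.exp (-(|t| / σ)) := by
  rw [← logistic_abs, logistic_eq, Real.exp_neg, div_le_iff₀ (by positivity)]
  have := Real.exp_pos (|t| / σ)
  rw [inv_mul_eq_div, le_div_iff₀ this]
  nlinarith

lemma logistic_le_one (σ t : ℝ) : logistic σ t ≤ 1 := by
  have h1 := softmaxLoss_pos σ t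
  have h2 := softmaxLoss_lt_one σ t
  unfold logistic; nlinarith

lemma le_logistic {σ : ℝ} (hσ : 0 < σ) (t : ℝ) : Real.exp (-(|t| / σ)) / 4 ≤ logistic σ t := by
  rw [← logistic_abs, logistic_eq, Real.exp_neg, le_div_iff₀ (by positivity)]
  have h1 : 1 ≤ Real.exp (|t| / σ) := Real.one_le_exp (by positivity)
  have : (1 + Real.exp (|t| / σ)) ^ 2 ≤ (2 * Real.exp (|t| / σ)) ^ 2 := by
    gcongr; linarith
  calc (Real.exp (|t| / σ))⁻¹ / 4 * (1 + Real.exp (|t| / σ)) ^ 2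
      ≤ (Real.exp (|t| / σ))⁻¹ / 4 * (2 * Real.exp (|t| / σ)) ^ 2 := by gcongr
    _ = _ := by field_simp; norm_num

lemma hasDerivAt_softmaxLoss (σ t : ℝ) :
    HasDerivAt (softmaxLoss σ) (-(logistic σ t / σ)) t := by
  have h1 : HasDerivAt (fun t => 1 + Real.exp (t / σ)) (Real.exp (t / σ) * (1 / σ)) t :=
    (((hasDerivAt_id t).div_const σ).exp).const_add 1
  have hne : 1 + Real.exp (t / σ) ≠ 0 := by positivity
  have h2 := h1.inv hne
  have h3 : softmaxLoss σ = (fun t => 1 + Real.exp (t / σ))⁻¹ := by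
    ext s; simp [softmaxLoss]
  rw [h3]
  refine h2.congr_deriv ?_
  rw [logistic_eq]
  ring

lemma hasDerivAt_logistic (σ t : ℝ) :
    HasDerivAt (logistic σ) (-(logistic σ t * (1 - 2 * softmaxLoss σ t) / σ)) t := by
  have h := (hasDerivAt_softmaxLoss σ t).mul ((hasDerivAt_softmaxLoss σ t).const_sub 1)
  refine h.congr_deriv ?_
  unfold logistic
  ring

lemma continuous_softmaxLoss (σ : ℝ) : Continuous (softmaxLoss σ) :=
  continuous_iff_continuousAt.2 fun t => (hasDerivAt_softmaxLoss σ t).continuousAt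

lemma continuous_logistic (σ : ℝ) : Continuous (logistic σ) :=
  (continuous_softmaxLoss σ).mul (continuous_const.sub (continuous_softmaxLoss σ))

lemma queryProb_eq {d : ℕ} {σ : ℝ} (hσ : 0 < σ) (w x : E d) :
    queryProb σ w x = logistic σ (inner ℝ (‖w‖⁻¹ • w) x) := by
  unfold queryProb
  rw [(hasDerivAt_softmaxLoss σ _).deriv, abs_neg,
    abs_of_nonneg (div_nonneg (logistic_pos _ _).le hσ.le)]
  field_simp

lemma queryProb_eq_of_norm {d : ℕ} {σ : ℝ} (hσ : 0 < σ) {w : E d} (hw : ‖w‖ = 1) (x : E d) :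
    queryProb σ w x = logistic σ (inner ℝ w x) := by
  rw [queryProb_eq hσ, hw, inv_one, one_smul]

/-! ### Elementary integrals -/

lemma lintegral_exp_neg_abs_div {σ : ℝ} (hσ : 0 < σ) :
    ∫⁻ x : ℝ, ENNReal.ofReal (Real.exp (-(|x| / σ))) = ENNReal.ofReal (2 * σ) := by
  have h1 : ∫ x : ℝ, Real.exp (-(|x| / σ)) = 2 * σ := by
    rw [integral_comp_abs (f := fun x => Real.exp (-(x / σ)))]
    have := integral_exp_mul_Ioi (a := -σ⁻¹) (by simpa using hσ) 0
    have e : ∀ x : ℝ, -(x / σ) = -σ⁻¹ * x := fun x => by ring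
    simp_rw [e, this]
    simp
  have hI : Integrable fun x : ℝ => Real.exp (-(|x| / σ)) := by
    by_contra h
    rw [integral_undef h] at h1
    linarith
  rw [← ofReal_integral_eq_lintegral_ofReal hI
    (Filter.Eventually.of_forall fun x => (Real.exp_pos _).le), h1]

lemma sq_half_le_exp_abs (x : ℝ) : x ^ 2 / 2 ≤ Real.exp |x| := by
  have := Real.quadratic_le_exp_of_nonneg (abs_nonneg x)
  rw [sq_abs] at this
  linarith [abs_nonneg x]

lemma lintegral_sq_mul_exp_neg_abs_div_le {σ : ℝ} (hσ : 0 < σ) :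
    ∫⁻ x : ℝ, ENNReal.ofReal (x ^ 2 * Real.exp (-(|x| / σ))) ≤ ENNReal.ofReal (32 * σ ^ 3) := by
  -- Half of the exponential rate absorbs the factor `x²`.
  have h : ∀ x : ℝ, x ^ 2 * Real.exp (-(|x| / σ))
      ≤ 8 * σ ^ 2 * Real.exp (-(|x| / (2 * σ))) := by
    intro x
    have h1 := sq_half_le_exp_abs (x / (2 * σ))
    rw [abs_div, abs_of_pos (by positivity : 0 < 2 * σ)] at h1
    have h2 : x ^ 2 ≤ 8 * σ ^ 2 * Real.exp (|x| / (2 * σ)) := by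
      have : x ^ 2 = 8 * σ ^ 2 * ((x / (2 * σ)) ^ 2 / 2) := by field_simp; norm_num
      rw [this]; gcongr
    calc x ^ 2 * Real.exp (-(|x| / σ))
        ≤ 8 * σ ^ 2 * Real.exp (|x| / (2 * σ)) * Real.exp (-(|x| / σ)) := by gcongr
      _ = _ := by rw [mul_assoc, ← Real.exp_add]; congr 2; field_simp; ring
  calc _ ≤ ∫⁻ x : ℝ, ENNReal.ofReal (8 * σ ^ 2) * ENNReal.ofReal (Real.exp (-(|x| / (2 * σ)))) := by
        refine lintegral_mono fun x => ?_
        rw [← ENNReal.ofReal_mul (by positivity)]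
        exact ENNReal.ofReal_le_ofReal (h x)
    _ = _ := by
        rw [lintegral_const_mul' _ _ ENNReal.ofReal_ne_top,
          lintegral_exp_neg_abs_div (by positivity), ← ENNReal.ofReal_mul (by positivity)]
        congr 1; ring

/-! ### Consequences of well-behavedness -/

section WellBehaved

variable {d : ℕ} {L R U β : ℝ} {μ : Measure (E d)}

lemma orthonormal_pair {u w : E d} (hu : ‖u‖ = 1) (hw : ‖w‖ = 1) (huw : inner ℝ u w = 0) :
    Orthonormal ℝ ![u, w] := by
  rw [orthonormal_iff_ite]
  intro i j
  fin_cases i <;> fin_cases j <;> simp [hu, hw, huw, real_inner_comm]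

lemma measurable_planeCoords (e : Fin 2 → E d) : Measurable (planeCoords e) := by
  unfold planeCoords
  fun_prop

lemma measurePreserving_pair :
    MeasurePreserving (fun z : EuclideanSpace ℝ (Fin 2) => (z 0, z 1)) volume volume :=
  (volume_preserving_finTwoArrow ℝ).comp (PiLp.volume_preserving_ofLp (Fin 2))

/-- Integrals of functions of a two-dimensional projection. -/
lemma WellBehaved.exists_density (h : WellBehaved L R U β μ) {u w : E d} (hu : ‖u‖ = 1)
    (hw : ‖w‖ = 1) (huw : inner ℝ u w = 0) :
    ∃ p : EuclideanSpace ℝ (Fin 2) → ℝ, Measurable p ∧ (∀ z, ‖z‖ ≤ R → L ≤ p z) ∧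
      (∀ z, p z ≤ U) ∧ ∀ F : ℝ × ℝ → ℝ≥0∞, Measurable F →
        ∫⁻ x, F (inner ℝ u x, inner ℝ w x) ∂μ = ∫⁻ z, ENNReal.ofReal (p z) * F (z 0, z 1) := by
  obtain ⟨p, hp, hmap, hL, hU⟩ := h.1 _ (orthonormal_pair hu hw huw)
  refine ⟨p, hp, hL, fun z => (hU z).2, fun F hF => ?_⟩
  have hG : Measurable fun z : EuclideanSpace ℝ (Fin 2) => F (z 0, z 1) :=
    hF.comp measurePreserving_pair.measurable
  have h1 := lintegral_map (μ := μ) hG (measurable_planeCoords ![u, w])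
  rw [hmap, lintegral_withDensity_eq_lintegral_mul _ hp.ennreal_ofReal hG] at h1
  rw [show (fun x => F (inner ℝ u x, inner ℝ w x)) = fun x =>
    F ((planeCoords ![u, w] x) 0, (planeCoords ![u, w] x) 1) from by
      ext x; simp [planeCoords]]
  rw [← h1]
  rfl

lemma WellBehaved.lintegral_le (h : WellBehaved L R U β μ) {u w : E d} (hu : ‖u‖ = 1)
    (hw : ‖w‖ = 1) (huw : inner ℝ u w = 0) {F : ℝ × ℝ → ℝ≥0∞} (hF : Measurable F) :
    ∫⁻ x, F (inner ℝ u x, inner ℝ w x) ∂μ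
      ≤ ENNReal.ofReal U * ∫⁻ b : ℝ, ∫⁻ a : ℝ, F (a, b) := by
  obtain ⟨p, -, -, hU, hp⟩ := h.exists_density hu hw huw
  rw [hp F hF]
  calc _ ≤ ∫⁻ z : EuclideanSpace ℝ (Fin 2), ENNReal.ofReal U * F (z 0, z 1) := by
        gcongr with z; exact hU z
    _ = ENNReal.ofReal U * ∫⁻ z : EuclideanSpace ℝ (Fin 2), F (z 0, z 1) :=
        lintegral_const_mul' _ _ ENNReal.ofReal_ne_top
    _ = ENNReal.ofReal U * ∫⁻ q : ℝ × ℝ, F q := by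
        rw [← measurePreserving_pair.lintegral_comp hF]
    _ = _ := by rw [Measure.volume_eq_prod, lintegral_prod_symm _ hF.aemeasurable]

lemma WellBehaved.le_measure (h : WellBehaved L R U β μ) {u w : E d} (hu : ‖u‖ = 1)
    (hw : ‖w‖ = 1) (huw : inner ℝ u w = 0) {S T : Set ℝ} (hS : MeasurableSet S)
    (hT : MeasurableSet T)
    (hR : ∀ a ∈ S, ∀ b ∈ T, a ^ 2 + b ^ 2 ≤ R ^ 2) (hR0 : 0 ≤ R) :
    ENNReal.ofReal L * (volume S * volume T)
      ≤ μ {x | inner ℝ u x ∈ S ∧ inner ℝ w x ∈ T} := by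
  obtain ⟨p, -, hL, -, hp⟩ := h.exists_density hu hw huw
  have hST : MeasurableSet (S ×ˢ T) := hS.prod hT
  have hm : MeasurableSet {x : E d | inner ℝ u x ∈ S ∧ inner ℝ w x ∈ T} :=
    (measurableSet_preimage (by fun_prop : Measurable fun x : E d => inner ℝ u x) hS).inter
      (measurableSet_preimage (by fun_prop : Measurable fun x : E d => inner ℝ w x) hT)
  have h1 := hp ((S ×ˢ T).indicator 1) (measurable_one.indicator hST)
  have h2 : ∫⁻ x, (S ×ˢ T).indicator (1 : ℝ × ℝ → ℝ≥0∞) (inner ℝ u x, inner ℝ w x) ∂μ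
      = μ {x | inner ℝ u x ∈ S ∧ inner ℝ w x ∈ T} := by
    rw [← lintegral_indicator_one hm]
    rfl
  rw [← h2, h1]
  calc ENNReal.ofReal L * (volume S * volume T)
      = ENNReal.ofReal L * ∫⁻ z : EuclideanSpace ℝ (Fin 2), (S ×ˢ T).indicator 1 (z 0, z 1) := by
        rw [measurePreserving_pair.lintegral_comp (measurable_one.indicator hST),
          lintegral_indicator_one hST, Measure.volume_eq_prod, Measure.prod_prod]
    _ = ∫⁻ z : EuclideanSpace ℝ (Fin 2), ENNReal.ofReal L * (S ×ˢ T).indicator 1 (z 0, z 1) :=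
        (lintegral_const_mul' _ _ ENNReal.ofReal_ne_top).symm
    _ ≤ _ := by
        refine lintegral_mono fun z => ?_
        by_cases hz : (z 0, z 1) ∈ S ×ˢ T
        · gcongr
          apply hL
          rw [EuclideanSpace.norm_eq, Fin.sum_univ_two, Real.norm_eq_abs, Real.norm_eq_abs,
            sq_abs, sq_abs, Real.sqrt_le_left hR0]
          exact hR _ hz.1 _ hz.2
        · simp [Set.indicator_of_notMem hz]

end WellBehaved

section WellBehaved

variable {d : ℕ} {L R U β : ℝ} {μ : Measure (E d)}

lemma measurable_inner_right (v : E d) : Measurable fun x : E d => (inner ℝ v x : ℝ) := by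
  fun_prop

/-- Layer-cake formula: at half of the tail rate, the tail `exp (1 - 2t)` times the derivative `exp
t` integrates to `e`. Adding the value 1 at the origin gives `e + 1 ≤ 4`. -/
lemma WellBehaved.lintegral_exp_le_of_unit [IsProbabilityMeasure μ] (h : WellBehaved L R U β μ)
    (hβ : 0 < β) {w : E d} (hw : ‖w‖ = 1) :
    ∫⁻ x, ENNReal.ofReal (Real.exp (|inner ℝ w x| / (2 * β))) ∂μ ≤ ENNReal.ofReal 4 := by
  have hfm : Measurable fun x : E d => |inner ℝ w x| / (2 * β) := by fun_prop
  have hlc := lintegral_comp_eq_lintegral_meas_le_mul μ (f := fun x => |inner ℝ w x| / (2 * β))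
    (g := Real.exp) (Filter.Eventually.of_forall fun x => by
      simp only [Pi.zero_apply]; positivity) hfm.aemeasurable
    (fun t _ => Real.continuous_exp.intervalIntegrable _ _)
    (Filter.Eventually.of_forall fun t => (Real.exp_pos t).le)
  simp only [integral_exp, Real.exp_zero] at hlc
  have h1 : ∫⁻ t in Set.Ioi (0 : ℝ), μ {a : E d | t ≤ |inner ℝ w a| / (2 * β)}
      * ENNReal.ofReal (Real.exp t) ≤ ENNReal.ofReal (Real.exp 1) := by
    calc _ ≤ ∫⁻ t in Set.Ioi (0 : ℝ), ENNReal.ofReal (Real.exp 1 * Real.exp (-t)) := by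
          refine setLIntegral_mono' measurableSet_Ioi fun t ht => ?_
          have ht0 : (0 : ℝ) < t := ht
          have h2 := h.2 w hw (t * (2 * β)) (by positivity)
          have h3 : {a : E d | t ≤ |inner ℝ w a| / (2 * β)}
              = {a : E d | t * (2 * β) ≤ |inner ℝ w a|} := by
            ext a
            simp only [Set.mem_ofPred_eq]
            rw [le_div_iff₀ (by positivity)]
          rw [h3, ← ofReal_measureReal, ← ENNReal.ofReal_mul measureReal_nonneg]
          apply ENNReal.ofReal_le_ofReal
          calc _ ≤ Real.exp (1 - t * (2 * β) / β) * Real.exp t := by gcongr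
            _ = _ := by
              rw [← Real.exp_add, ← Real.exp_add]; congr 1; field_simp; ring
      _ = ENNReal.ofReal (∫ t in Set.Ioi (0 : ℝ), Real.exp 1 * Real.exp (-t)) := by
          rw [ofReal_integral_eq_lintegral_ofReal]
          · exact (by simpa using exp_neg_integrableOn_Ioi 0 one_pos :
              IntegrableOn (fun t => Real.exp (-t)) (Set.Ioi 0)).const_mul _
          · exact Filter.Eventually.of_forall fun t => by positivity
      _ = _ := by rw [integral_const_mul, integral_exp_neg_Ioi_zero, mul_one]
  rw [← hlc] at h1
  calc ∫⁻ x, ENNReal.ofReal (Real.exp (|inner ℝ w x| / (2 * β))) ∂μ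
      = ∫⁻ x, (ENNReal.ofReal (Real.exp (|inner ℝ w x| / (2 * β)) - 1) + 1) ∂μ := by
        refine lintegral_congr fun x => ?_
        rw [← ENNReal.ofReal_one, ← ENNReal.ofReal_add _ zero_le_one, sub_add_cancel]
        exact sub_nonneg.2 (Real.one_le_exp (by positivity))
    _ = ∫⁻ x, ENNReal.ofReal (Real.exp (|inner ℝ w x| / (2 * β)) - 1) ∂μ + 1 := by
        rw [lintegral_add_right _ measurable_const]; simp
    _ ≤ ENNReal.ofReal (Real.exp 1) + ENNReal.ofReal 1 := by
        rw [ENNReal.ofReal_one]; gcongr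
    _ ≤ ENNReal.ofReal 4 := by
        rw [← ENNReal.ofReal_add (Real.exp_pos _).le zero_le_one]
        apply ENNReal.ofReal_le_ofReal
        have := Real.exp_one_lt_d9
        linarith

lemma WellBehaved.lintegral_exp_le [IsProbabilityMeasure μ] (h : WellBehaved L R U β μ)
    (hβ : 0 < β) {v : E d} (hv : ‖v‖ ≤ 1) :
    ∫⁻ x, ENNReal.ofReal (Real.exp (|inner ℝ v x| / (2 * β))) ∂μ ≤ ENNReal.ofReal 4 := by
  by_cases h0 : v = 0
  · subst h0
    simp
  · have hpos : 0 < ‖v‖ := norm_pos_iff.2 h0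
    refine le_trans (lintegral_mono fun x => ?_)
      (h.lintegral_exp_le_of_unit hβ (w := ‖v‖⁻¹ • v) (norm_smul_inv_norm h0))
    apply ENNReal.ofReal_le_ofReal
    apply Real.exp_le_exp.2
    refine div_le_div_of_nonneg_right ?_ (by positivity)
    rw [inner_smul_left, abs_mul]
    simp only [map_inv₀, conj_trivial, abs_inv, abs_norm]
    exact le_mul_of_one_le_left (abs_nonneg _) ((one_le_inv₀ hpos).2 hv)

/-- The constant in the bound for the mass of a smoothed strip. -/
noncomputable def stripConst (U β : ℝ) : ℝ := 16 * U * β * (1 + 16 * β ^ 2) + 4 * (1 + 32 * β ^ 2)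

lemma stripConst_pos (hU : 0 < U) (hβ : 0 < β) : 0 < stripConst U β := by
  unfold stripConst; positivity

/-- The moment `exp (|a|/(2β))` is split in two halves: one dominates the second moment, the other
turns `|a| ≥ r` into a small factor. -/
lemma exp_le_of_abs_gt {a r : ℝ} (hβ : 0 < β) (har : r ≤ |a|) :
    1 + a ^ 2 ≤ (1 + 32 * β ^ 2) * (Real.exp (|a| / (2 * β)) * Real.exp (-(r / (4 * β)))) := by
  have h1 := sq_half_le_exp_abs (a / (4 * β))
  rw [abs_div, abs_of_pos (by positivity : 0 < 4 * β)] at h1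
  have h2 : 1 ≤ Real.exp (|a| / (4 * β)) := Real.one_le_exp (by positivity)
  have h3 : a ^ 2 ≤ 32 * β ^ 2 * Real.exp (|a| / (4 * β)) := by
    have : a ^ 2 = 32 * β ^ 2 * ((a / (4 * β)) ^ 2 / 2) := by field_simp; ring
    rw [this]; gcongr
  calc 1 + a ^ 2 ≤ (1 + 32 * β ^ 2) * Real.exp (|a| / (4 * β)) := by linarith
    _ ≤ _ := by
      rw [← Real.exp_add]
      gcongr
      have : r / (4 * β) ≤ |a| / (4 * β) := by gcongr
      have e : |a| / (2 * β) = |a| / (4 * β) + |a| / (4 * β) := by field_simp; ring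
      linarith

/-- The `μ`-mass of a smoothed strip of width `σ`, also when weighted with a second moment in an
orthogonal direction. -/
lemma WellBehaved.lintegral_strip_le [IsProbabilityMeasure μ] (h : WellBehaved L R U β μ)
    (hU : 0 < U) (hβ : 0 < β) {u w : E d} (hu : ‖u‖ = 1) (hw : ‖w‖ = 1) (huw : inner ℝ u w = 0)
    {σ : ℝ} (hσ : 0 < σ) (hσ1 : 1 ≤ Real.log (1 / σ)) :
    ∫⁻ x, ENNReal.ofReal (Real.exp (-(|inner ℝ w x| / σ)) * (1 + inner ℝ u x ^ 2)) ∂μ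
      ≤ ENNReal.ofReal (stripConst U β * σ * Real.log (1 / σ) ^ 3) := by
  set l := Real.log (1 / σ) with hl
  have hl0 : 0 < l := by linarith
  -- The truncation radius is chosen so that the tail factor `exp (-r/(4β))` is exactly `σ`. Then
  -- the part outside the strip segment is of the same order as the part inside.
  set r := 4 * β * l with hr
  have hr0 : 0 < r := by positivity
  have hexp : Real.exp (-(r / (4 * β))) = σ := by
    rw [hr, mul_div_cancel_left₀ _ (by positivity), hl, one_div, Real.log_inv, neg_neg,
      Real.exp_log hσ]
  set F : ℝ × ℝ → ℝ≥0∞ := fun q => (Set.Icc (-r) r).indicator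
    (fun _ => ENNReal.ofReal ((1 + r ^ 2) * Real.exp (-(|q.2| / σ)))) q.1 with hF
  have hFm : Measurable F := by
    have : F = (Set.Icc (-r) r ×ˢ Set.univ).indicator
        (fun q => ENNReal.ofReal ((1 + r ^ 2) * Real.exp (-(|q.2| / σ)))) := by
      ext q
      simp [hF, Set.indicator_apply]
    rw [this]
    refine Measurable.indicator ?_ (measurableSet_Icc.prod MeasurableSet.univ)
    fun_prop
  have hpt : ∀ x, ENNReal.ofReal (Real.exp (-(|inner ℝ w x| / σ)) * (1 + inner ℝ u x ^ 2))
      ≤ F (inner ℝ u x, inner ℝ w x) + ENNReal.ofReal ((1 + 32 * β ^ 2) * σ)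
        * ENNReal.ofReal (Real.exp (|inner ℝ u x| / (2 * β))) := by
    intro x
    have hE1 : Real.exp (-(|inner ℝ w x| / σ)) ≤ 1 := Real.exp_le_one_iff.2 (by
      rw [neg_nonpos]; positivity)
    by_cases hx : inner ℝ u x ∈ Set.Icc (-r) r
    · refine le_add_right ?_
      simp only [hF, Set.indicator_of_mem hx]
      apply ENNReal.ofReal_le_ofReal
      rw [mul_comm]
      gcongr 1
      · have := sq_le_sq' hx.1 hx.2
        linarith
    · refine le_add_left ?_
      rw [← ENNReal.ofReal_mul (by positivity)]
      apply ENNReal.ofReal_le_ofReal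
      have har : r ≤ |inner ℝ u x| := by
        by_contra hc
        exact hx (abs_le.1 (not_le.1 hc).le)
      have := exp_le_of_abs_gt hβ har
      rw [hexp] at this
      calc _ ≤ 1 * (1 + inner ℝ u x ^ 2) := by gcongr
        _ ≤ _ := by rw [one_mul]; refine this.trans (le_of_eq (by ring))
  have hI1 : ∫⁻ x, F (inner ℝ u x, inner ℝ w x) ∂μ
      ≤ ENNReal.ofReal (U * ((1 + r ^ 2) * (2 * r) * (2 * σ))) := by
    refine (h.lintegral_le hu hw huw hFm).trans ?_
    rw [ENNReal.ofReal_mul hU.le]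
    gcongr
    -- Inside the cutoff the density is at most `U`: the `u`-direction contributes `2r(1 + r²)` and
    -- the `w`-direction `2σ`.
    have : ∀ b : ℝ, ∫⁻ a : ℝ, F (a, b)
        = ENNReal.ofReal ((1 + r ^ 2) * (2 * r)) * ENNReal.ofReal (Real.exp (-(|b| / σ))) := by
      intro b
      simp only [hF]
      rw [lintegral_indicator_const measurableSet_Icc, Real.volume_Icc,
        ← ENNReal.ofReal_mul (by positivity), ← ENNReal.ofReal_mul (by positivity)]
      congr 1; ring
    simp_rw [this]
    rw [lintegral_const_mul' _ _ ENNReal.ofReal_ne_top, lintegral_exp_neg_abs_div hσ,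
      ← ENNReal.ofReal_mul (by positivity)]
  have hFm' : Measurable fun x : E d => F (inner ℝ u x, inner ℝ w x) :=
    hFm.comp ((measurable_inner_right u).prodMk (measurable_inner_right w))
  calc _ ≤ ∫⁻ x, (F (inner ℝ u x, inner ℝ w x) + ENNReal.ofReal ((1 + 32 * β ^ 2) * σ)
        * ENNReal.ofReal (Real.exp (|inner ℝ u x| / (2 * β)))) ∂μ := lintegral_mono hpt
    _ ≤ ENNReal.ofReal (U * ((1 + r ^ 2) * (2 * r) * (2 * σ)))
        + ENNReal.ofReal ((1 + 32 * β ^ 2) * σ) * ENNReal.ofReal 4 := by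
        rw [lintegral_add_left hFm', lintegral_const_mul' _ _ ENNReal.ofReal_ne_top]
        gcongr
        exact h.lintegral_exp_le hβ hu.le
    _ ≤ _ := by
        rw [← ENNReal.ofReal_mul (by positivity), ← ENNReal.ofReal_add (by positivity)
          (by positivity)]
        apply ENNReal.ofReal_le_ofReal
        have hl2 : 1 ≤ l ^ 2 := one_le_pow₀ hσ1
        have hl3 : 1 ≤ l ^ 3 := one_le_pow₀ hσ1
        unfold stripConst
        have e1 : U * ((1 + r ^ 2) * (2 * r) * (2 * σ))
            = 16 * U * β * σ * l * (1 + 16 * β ^ 2 * l ^ 2) := by rw [hr]; ring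
        have e2 : 1 + 16 * β ^ 2 * l ^ 2 ≤ (1 + 16 * β ^ 2) * l ^ 2 := by linarith
        calc _ = 16 * U * β * σ * l * (1 + 16 * β ^ 2 * l ^ 2) + 4 * (1 + 32 * β ^ 2) * σ * 1 := by
              rw [e1]; ring
          _ ≤ 16 * U * β * σ * l * ((1 + 16 * β ^ 2) * l ^ 2)
              + 4 * (1 + 32 * β ^ 2) * σ * l ^ 3 := by gcongr
          _ = _ := by ring

/-- Two halfspaces with a small angle disagree with small probability. -/
lemma WellBehaved.measure_halfspace_ne_le [IsProbabilityMeasure μ] (h : WellBehaved L R U β μ)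
    (hU : 0 < U) {u w : E d} (hu : ‖u‖ = 1) (hw : ‖w‖ = 1) (huw : inner ℝ u w = 0)
    {a b r : ℝ} (ha : 1 / 2 ≤ a) (hb : 0 ≤ b) (hr : 0 < r) :
    μ {x | halfspace w x ≠ halfspace (a • w + b • u) x}
      ≤ ENNReal.ofReal (Real.exp (1 - r / β) + 8 * U * b * r ^ 2) := by
  set F : ℝ × ℝ → ℝ≥0∞ :=
    (Set.Icc (-r) r ×ˢ Set.Icc (-(2 * b * r)) (2 * b * r)).indicator 1 with hF
  have hSm := (measurableSet_Icc (a := -r) (b := r)).prod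
    (measurableSet_Icc (a := -(2 * b * r)) (b := 2 * b * r))
  have hFm : Measurable F := measurable_one.indicator hSm
  have hsub : {x | halfspace w x ≠ halfspace (a • w + b • u) x}
      ⊆ {x | r ≤ |inner ℝ u x|} ∪ {x | (inner ℝ u x, inner ℝ w x) ∈
        (Set.Icc (-r) r ×ˢ Set.Icc (-(2 * b * r)) (2 * b * r))} := by
    intro x hx
    by_cases har : r ≤ |inner ℝ u x|
    · exact Or.inl har
    right
    have har' := (not_le.1 har).le
    have hub := abs_le.1 har'
    simp only [Set.mem_ofPred_eq, halfspace, inner_add_left, inner_smul_left, conj_trivial] at hx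
    -- Opposite signs of `⟨w,x⟩` and `a⟨w,x⟩ + b⟨u,x⟩` force `a|⟨w,x⟩| ≤ b|⟨u,x⟩|`, and `a ≥ 1/2`.
    have key : |inner ℝ w x| ≤ 2 * b * |inner ℝ u x| := by
      have h1 := neg_abs_le (inner ℝ u x)
      have h2 := le_abs_self (inner ℝ u x)
      by_cases hc : 0 ≤ inner ℝ w x
      · rw [if_pos hc] at hx
        have hc2 : ¬ 0 ≤ a * inner ℝ w x + b * inner ℝ u x := by
          intro hc3; rw [if_pos hc3] at hx; exact hx rfl
        rw [abs_of_nonneg hc]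
        nlinarith
      · rw [if_neg hc] at hx
        have hc2 : 0 ≤ a * inner ℝ w x + b * inner ℝ u x := by
          by_contra hc3; rw [if_neg hc3] at hx; exact hx rfl
        rw [abs_of_neg (not_le.1 hc)]
        nlinarith
    exact ⟨hub, abs_le.1 (key.trans (by gcongr))⟩
  refine (measure_mono hsub).trans ((measure_union_le _ _).trans ?_)
  rw [ENNReal.ofReal_add (by positivity) (by positivity)]
  gcongr
  · rw [← ofReal_measureReal]
    exact ENNReal.ofReal_le_ofReal (h.2 u hu r hr)
  · have hm : MeasurableSet {x : E d | (inner ℝ u x, inner ℝ w x) ∈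
        (Set.Icc (-r) r ×ˢ Set.Icc (-(2 * b * r)) (2 * b * r))} :=
      ((measurable_inner_right u).prodMk (measurable_inner_right w)) hSm
    have h1 := h.lintegral_le hu hw huw hFm
    have h2 : ∫⁻ q : ℝ, ∫⁻ p : ℝ, F (p, q) = ENNReal.ofReal (2 * r * (4 * b * r)) := by
      rw [← lintegral_prod_symm _ hFm.aemeasurable, hF, lintegral_indicator_one hSm,
        Measure.prod_prod, Real.volume_Icc, Real.volume_Icc, ← ENNReal.ofReal_mul (by linarith)]
      congr 1; ring
    rw [h2, ← ENNReal.ofReal_mul hU.le] at h1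
    rw [← lintegral_indicator_one hm]
    refine le_trans (le_of_eq ?_) (h1.trans (ENNReal.ofReal_le_ofReal (le_of_eq (by ring))))
    rfl

/-- The part of a smoothed strip that lies in a wedge around it. -/
lemma WellBehaved.lintegral_wedge_le (h : WellBehaved L R U β μ)
    (hU : 0 < U) {u w : E d} (hu : ‖u‖ = 1) (hw : ‖w‖ = 1) (huw : inner ℝ u w = 0)
    {σ b : ℝ} (hσ : 0 < σ) (hb : 0 < b) :
    ∫⁻ x, ENNReal.ofReal (if |inner ℝ u x| * b ≤ |inner ℝ w x| then
        Real.exp (-(|inner ℝ w x| / σ)) * |inner ℝ u x| else 0) ∂μ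
      ≤ ENNReal.ofReal (64 * U * σ ^ 3 / b ^ 2) := by
  set F : ℝ × ℝ → ℝ≥0∞ := fun q => ENNReal.ofReal (if |q.1| * b ≤ |q.2| then
        Real.exp (-(|q.2| / σ)) * |q.1| else 0) with hF
  have hFm : Measurable F := by
    refine Measurable.ennreal_ofReal (Measurable.ite ?_ (by fun_prop) measurable_const)
    exact measurableSet_le (by fun_prop) (by fun_prop)
  refine (h.lintegral_le hu hw huw hFm).trans ?_
  -- At height `y` the wedge is an interval of length `2|y|/b` on which `|x| ≤ |y|/b`. The resulting
  -- weight `y²` then produces `σ³` in the second integration.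
  have h1 : ∀ y : ℝ, ∫⁻ x : ℝ, F (x, y)
      ≤ ENNReal.ofReal (2 / b ^ 2) * ENNReal.ofReal (y ^ 2 * Real.exp (-(|y| / σ))) := by
    intro y
    calc ∫⁻ x : ℝ, F (x, y) ≤ ∫⁻ x : ℝ, (Set.Icc (-(|y| / b)) (|y| / b)).indicator
          (fun _ => ENNReal.ofReal (Real.exp (-(|y| / σ)) * (|y| / b))) x := by
          refine lintegral_mono fun x => ?_
          simp only [hF]
          split_ifs with hc
          · have hx : |x| ≤ |y| / b := by rwa [le_div_iff₀ hb]
            rw [Set.indicator_of_mem (Set.mem_Icc.2 (abs_le.1 hx))]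
            apply ENNReal.ofReal_le_ofReal
            gcongr
          · simp
      _ = _ := by
          rw [lintegral_indicator_const measurableSet_Icc, Real.volume_Icc,
            ← ENNReal.ofReal_mul (by positivity), ← ENNReal.ofReal_mul (by positivity)]
          congr 1
          rw [← sq_abs y]
          field_simp
          ring
  calc _ ≤ ENNReal.ofReal U * ∫⁻ y : ℝ, ENNReal.ofReal (2 / b ^ 2)
        * ENNReal.ofReal (y ^ 2 * Real.exp (-(|y| / σ))) := by gcongr with y; exact h1 y
    _ ≤ ENNReal.ofReal U * (ENNReal.ofReal (2 / b ^ 2) * ENNReal.ofReal (32 * σ ^ 3)) := by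
        rw [lintegral_const_mul' _ _ ENNReal.ofReal_ne_top]
        gcongr
        exact lintegral_sq_mul_exp_neg_abs_div_le hσ
    _ = _ := by
        rw [← ENNReal.ofReal_mul (by positivity), ← ENNReal.ofReal_mul hU.le]
        congr 1; ring

/-- A rectangle close to the origin has at least the mass given by the lower density bound. -/
lemma WellBehaved.le_measure_rectangle (h : WellBehaved L R U β μ) (hL : 0 < L) (hR : 0 < R)
    {u w : E d} (hu : ‖u‖ = 1) (hw : ‖w‖ = 1) (huw : inner ℝ u w = 0) {σ : ℝ} (hσ : 0 < σ)
    (hσR : σ ≤ R / 2) :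
    ENNReal.ofReal (L * R * σ / 2)
      ≤ μ {x | inner ℝ u x ∈ Set.Icc (R / 4) (R / 2) ∧ inner ℝ w x ∈ Set.Icc (-σ) σ} := by
  refine le_trans (le_of_eq ?_) (h.le_measure hu hw huw measurableSet_Icc measurableSet_Icc ?_ hR.le)
  · rw [Real.volume_Icc, Real.volume_Icc, ← ENNReal.ofReal_mul (by linarith),
      ← ENNReal.ofReal_mul hL.le]
    congr 1; ring
  · intro a ha b hb
    have h1 : a ^ 2 ≤ (R / 2) ^ 2 := sq_le_sq' (by linarith [ha.1]) ha.2
    have h2 : b ^ 2 ≤ (R / 2) ^ 2 := sq_le_sq' (by linarith [hb.1]) (by linarith [hb.2])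
    nlinarith

/-- The boundary of a halfspace is a null set. -/
lemma WellBehaved.measure_inner_eq_zero (h : WellBehaved L R U β μ)
    {u w : E d} (hu : ‖u‖ = 1) (hw : ‖w‖ = 1) (huw : inner ℝ u w = 0) :
    μ {x | inner ℝ w x = 0} = 0 := by
  have hSm : MeasurableSet (Set.univ ×ˢ {0} : Set (ℝ × ℝ)) :=
    MeasurableSet.univ.prod (measurableSet_singleton 0)
  have hFm : Measurable ((Set.univ ×ˢ {0} : Set (ℝ × ℝ)).indicator (1 : ℝ × ℝ → ℝ≥0∞)) :=
    measurable_one.indicator hSm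
  have h1 := h.lintegral_le hu hw huw hFm
  rw [← lintegral_prod_symm _ hFm.aemeasurable, lintegral_indicator_one hSm, Measure.prod_prod,
    Real.volume_singleton, mul_zero, mul_zero] at h1
  have hm : MeasurableSet {x : E d | inner ℝ w x = 0} :=
    (measurable_inner_right w) (measurableSet_singleton 0)
  rw [← lintegral_indicator_one hm]
  refine le_antisymm (le_trans (le_of_eq (lintegral_congr fun x => ?_)) h1) bot_le
  simp [Set.indicator_apply]

/-- Exponential moments of the norm. -/
lemma WellBehaved.lintegral_cosh_norm_le [IsProbabilityMeasure μ] (h : WellBehaved L R U β μ)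
    (hβ : 0 < β) (hd : 0 < d) :
    ∫⁻ x : E d, ENNReal.ofReal (Real.cosh (‖x‖ / (2 * β * √d))) ∂μ ≤ ENNReal.ofReal 4 := by
  have hd' : (0 : ℝ) < d := by exact_mod_cast hd
  -- `‖x‖²/d` is the average of the squared coordinates, so Jensen for `cosh √z` reduces the norm to
  -- one-dimensional tails. The dimension enters only through the scale `√d`.
  have hpt : ∀ x : E d, Real.cosh (‖x‖ / (2 * β * √d))
      ≤ ∑ j : Fin d, (1 / (d : ℝ))
        * Real.exp (|inner ℝ (EuclideanSpace.single j (1 : ℝ)) x| / (2 * β)) := by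
    intro x
    refine (cosh_le_sum_mul_cosh Finset.univ (fun _ => 1 / (d : ℝ))
      (fun j => |inner ℝ (EuclideanSpace.single j (1 : ℝ)) x| / (2 * β)) _
      (fun _ _ => by positivity) (by simp [hd'.ne']) (le_of_eq ?_)).trans ?_
    · simp only [div_pow, mul_pow, sq_abs, EuclideanSpace.inner_single_left, map_one, one_mul]
      rw [Real.sq_sqrt hd'.le, EuclideanSpace.real_norm_sq_eq, ← Finset.mul_sum, ← Finset.sum_div]
      field_simp
    · gcongr with j
      rw [Real.cosh_eq]
      set t := |inner ℝ (EuclideanSpace.single j (1 : ℝ)) x| / (2 * β)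
      have ht : 0 ≤ t := by positivity
      have : Real.exp (-t) ≤ Real.exp t := Real.exp_le_exp.2 (by linarith)
      linarith
  calc _ ≤ ∫⁻ x : E d, ∑ j : Fin d, ENNReal.ofReal (1 / (d : ℝ)) * ENNReal.ofReal
        (Real.exp (|inner ℝ (EuclideanSpace.single j (1 : ℝ)) x| / (2 * β))) ∂μ := by
        refine lintegral_mono fun x => (ENNReal.ofReal_le_ofReal (hpt x)).trans (le_of_eq ?_)
        rw [ENNReal.ofReal_sum_of_nonneg fun j _ => by positivity]
        exact Finset.sum_congr rfl fun j _ => ENNReal.ofReal_mul (by positivity)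
    _ = ∑ j : Fin d, ENNReal.ofReal (1 / (d : ℝ)) * ∫⁻ x : E d, ENNReal.ofReal
        (Real.exp (|inner ℝ (EuclideanSpace.single j (1 : ℝ)) x| / (2 * β))) ∂μ := by
        rw [lintegral_finsetSum _ fun j _ => by fun_prop]
        exact Finset.sum_congr rfl fun j _ => lintegral_const_mul' _ _ ENNReal.ofReal_ne_top
    _ ≤ ∑ j : Fin d, ENNReal.ofReal (1 / (d : ℝ)) * ENNReal.ofReal 4 := by
        gcongr with j
        exact h.lintegral_exp_le hβ (by simp)
    _ = _ := by
        rw [Finset.sum_const, Finset.card_univ, Fintype.card_fin, nsmul_eq_mul, ← mul_assoc,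
          ← ENNReal.ofReal_natCast d, ← ENNReal.ofReal_mul hd'.le, mul_one_div_cancel hd'.ne',
          ENNReal.ofReal_one, one_mul]

end WellBehaved

/-! ### The oracle -/

section Oracle

variable {d : ℕ} {L R U β σ : ℝ} {D : Measure (E d × ℝ)}

instance instIsProbabilityMeasureUnitInterval :
    IsProbabilityMeasure ((volume : Measure ℝ).restrict (Set.Icc (0 : ℝ) 1)) :=
  ⟨by simp⟩

instance instIsProbabilityMeasureDrawLaw [IsProbabilityMeasure D] :
    IsProbabilityMeasure (drawLaw D) := by
  unfold drawLaw; infer_instance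

lemma measurable_queryProb (σ : ℝ) :
    Measurable fun p : E d × E d => queryProb σ p.1 p.2 := by
  unfold queryProb
  have h := measurable_deriv (softmaxLoss σ)
  have h2 : Measurable fun p : E d × E d => (inner ℝ (‖p.1‖⁻¹ • p.1) p.2 : ℝ) := by fun_prop
  exact ((h.comp h2).norm).const_mul σ

lemma measurable_gradVec (σ : ℝ) :
    Measurable fun p : E d × (E d × ℝ) => gradVec σ p.1 p.2.1 p.2.2 := by
  unfold gradVec
  fun_prop

lemma measurableSet_query (σ : ℝ) :
    MeasurableSet {p : E d × Draw d | p.2.2 < queryProb σ p.1 p.2.1.1} := by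
  have h1 : Measurable fun p : E d × Draw d => p.2.2 := measurable_snd.comp measurable_snd
  have h2 : Measurable fun p : E d × Draw d => (p.1, p.2.1.1) :=
    measurable_fst.prodMk (measurable_fst.comp (measurable_fst.comp measurable_snd))
  have h3 : Measurable fun p : E d × Draw d => queryProb σ p.1 p.2.1.1 :=
    Measurable.comp (g := fun q : E d × E d => queryProb σ q.1 q.2)
      (f := fun p : E d × Draw d => (p.1, p.2.1.1)) (measurable_queryProb σ) h2
  exact measurableSet_lt h1 h3

lemma measurable_activeFO (σ : ℝ) :
    Measurable fun p : E d × Draw d => activeFO σ p.1 p.2 := by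
  unfold activeFO
  refine Measurable.ite (measurableSet_query σ) ?_ measurable_const
  exact (((measurable_gradVec σ).comp
    (by fun_prop : Measurable fun p : E d × Draw d => (p.1, p.2.1)))).prodMk measurable_const

lemma measurable_activeFO_left (σ : ℝ) (w : E d) : Measurable (activeFO (d := d) σ w) :=
  (measurable_activeFO σ).comp measurable_prodMk_left

lemma activeFO_snd_le_one (σ : ℝ) (w : E d) (ω : Draw d) : (activeFO σ w ω).2 ≤ 1 := by
  unfold activeFO; split_ifs <;> simp

lemma activeFO_snd_eq_one_iff (σ : ℝ) (w : E d) (ω : Draw d) :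
    (activeFO σ w ω).2 = 1 ↔ ω.2 < queryProb σ w ω.1.1 := by
  unfold activeFO; split_ifs with h <;> simp [h]

/-- The projection off `w` is self-adjoint and can be moved to the test vector. Moments of gradient
coordinates thus become moments of `x` in directions orthogonal to `w`, where the strip bound
applies. -/
lemma inner_gradVec {w : E d} (hw : ‖w‖ = 1) (σ : ℝ) (x : E d) (y : ℝ) (v : E d) :
    inner ℝ (gradVec σ w x y) v
      = -(1 / σ) * y * inner ℝ (v - (inner ℝ w v : ℝ) • w) x := by
  unfold gradVec
  simp only [hw, inner_smul_left, inner_sub_left, conj_trivial]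
  rw [real_inner_comm v x]
  simp
  left; ring

lemma inner_gradVec_self {w : E d} (hw : ‖w‖ = 1) (σ : ℝ) (x : E d) (y : ℝ) :
    inner ℝ (gradVec σ w x y) w = 0 := by
  rw [inner_gradVec hw, real_inner_self_eq_norm_sq, hw]
  simp

lemma inner_activeFO_self {w : E d} (hw : ‖w‖ = 1) (σ : ℝ) (ω : Draw d) :
    inner ℝ (activeFO σ w ω).1 w = 0 := by
  unfold activeFO
  split_ifs
  · exact inner_gradVec_self hw _ _ _
  · simp

lemma norm_proj_le {w : E d} (hw : ‖w‖ = 1) (v : E d) : ‖v - (inner ℝ w v : ℝ) • w‖ ≤ ‖v‖ := by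
  rw [← sq_le_sq₀ (norm_nonneg _) (norm_nonneg _), norm_sub_sq_real, inner_smul_right,
    norm_smul, hw, real_inner_comm]
  simp
  nlinarith [sq_nonneg (inner ℝ v w)]

lemma inner_proj {w : E d} (hw : ‖w‖ = 1) (v : E d) :
    inner ℝ (v - (inner ℝ w v : ℝ) • w) w = 0 := by
  rw [inner_sub_left, inner_smul_left, real_inner_self_eq_norm_sq, hw, real_inner_comm]
  simp

lemma norm_gradVec_le {w : E d} (hw : ‖w‖ = 1) (hσ : 0 < σ) (x : E d) (y : ℝ) :
    ‖gradVec σ w x y‖ ≤ 1 / σ * |y| * ‖x‖ := by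
  unfold gradVec
  rw [norm_smul, hw]
  have := norm_proj_le hw x
  simp only [one_pow, div_one, one_smul]
  rw [norm_mul, norm_neg, Real.norm_eq_abs, Real.norm_eq_abs, abs_of_pos (by positivity)]
  gcongr

lemma norm_activeFO_le {w : E d} (hw : ‖w‖ = 1) (hσ : 0 < σ) (ω : Draw d) :
    ‖(activeFO σ w ω).1‖ ≤ 1 / σ * |ω.1.2| * ‖ω.1.1‖ := by
  unfold activeFO
  split_ifs
  · exact norm_gradVec_le hw hσ _ _
  · simp; positivity

/-! ### Integrals against the law of a draw -/

lemma measurePreserving_fst_drawLaw :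
    MeasurePreserving (Prod.fst : Draw d → E d × ℝ) (drawLaw D) D := by
  unfold drawLaw
  exact measurePreserving_fst

variable [IsProbabilityMeasure D]

omit [IsProbabilityMeasure D] in
lemma measurePreserving_fst_fst :
    MeasurePreserving (Prod.fst : E d × ℝ → E d) D D.fst :=
  ⟨measurable_fst, rfl⟩

lemma setLIntegral_lt_const {q : ℝ} (hq1 : q ≤ 1) (c : ℝ≥0∞) :
    ∫⁻ u in Set.Icc (0 : ℝ) 1, (if u < q then c else 0) = ENNReal.ofReal q * c := by
  have h : (fun u : ℝ => if u < q then c else 0) = (Set.Iio q).indicator fun _ => c := by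
    ext u; simp [Set.indicator_apply]
  rw [h, lintegral_indicator_const measurableSet_Iio, Measure.restrict_apply measurableSet_Iio]
  have h2 : Set.Iio q ∩ Set.Icc 0 1 = Set.Ico 0 q := by
    ext u
    simp only [Set.mem_inter_iff, Set.mem_Iio, Set.mem_Icc, Set.mem_Ico]
    constructor
    · rintro ⟨h1, h2, h3⟩; exact ⟨h2, h1⟩
    · rintro ⟨h1, h2⟩; exact ⟨h2, h1, by linarith⟩
  rw [h2, Real.volume_Ico, sub_zero, mul_comm]

omit [IsProbabilityMeasure D] in
/-- The coin of the oracle is integrated out. -/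
lemma lintegral_query {w : E d} (hw : ‖w‖ = 1) (hσ : 0 < σ) {f : E d × ℝ → ℝ≥0∞}
    (hf : Measurable f) :
    ∫⁻ ω, (if ω.2 < queryProb σ w ω.1.1 then f ω.1 else 0) ∂(drawLaw D)
      = ∫⁻ z, ENNReal.ofReal (logistic σ (inner ℝ w z.1)) * f z ∂D := by
  unfold drawLaw
  rw [lintegral_prod]
  · refine lintegral_congr fun z => ?_
    simp only [queryProb_eq_of_norm hσ hw]
    exact setLIntegral_lt_const (logistic_le_one _ _) _
  · refine Measurable.aemeasurable (Measurable.ite ?_ (hf.comp measurable_fst) measurable_const)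
    exact (measurableSet_query σ).preimage (measurable_prodMk_left (x := w))

/-- The mass bound of a smoothed strip of width `σ`. -/
noncomputable def stripBound (U β σ : ℝ) : ℝ := stripConst U β * σ * Real.log (1 / σ) ^ 3

lemma stripBound_pos (hU : 0 < U) (hβ : 0 < β) (hσ : 0 < σ) (hσ1 : 1 ≤ Real.log (1 / σ)) :
    0 < stripBound U β σ := by
  have := stripConst_pos hU hβ
  unfold stripBound
  have : 0 < Real.log (1 / σ) := by linarith
  positivity

lemma exists_unit_orthogonal (hd : 2 ≤ d) {w : E d} (hw : ‖w‖ = 1) :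
    ∃ u : E d, ‖u‖ = 1 ∧ inner ℝ u w = 0 := by
  obtain ⟨n, rfl⟩ : ∃ n, d = n + 2 := ⟨d - 2, by omega⟩
  have : Fact (Module.finrank ℝ (E (n + 2)) = n + 1 + 1) := ⟨by simp⟩
  have hw0 : w ≠ 0 := by rintro rfl; simp at hw
  have h1 := Submodule.finrank_orthogonal_span_singleton (𝕜 := ℝ) (n := n + 1) hw0
  have : Nontrivial (Submodule.span ℝ {w})ᗮ := Module.nontrivial_of_finrank_pos (R := ℝ)
    (by rw [h1]; omega)
  obtain ⟨⟨v, hv⟩, hv0⟩ := exists_ne (0 : (Submodule.span ℝ {w})ᗮ)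
  have hv0' : v ≠ 0 := fun h => hv0 (by ext1; exact h)
  refine ⟨‖v‖⁻¹ • v, norm_smul_inv_norm hv0', ?_⟩
  rw [inner_smul_left, Submodule.mem_orthogonal_singleton_iff_inner_left.1 hv, mul_zero]

variable (hwb : WellBehaved L R U β D.fst) (hU : 0 < U) (hβ : 0 < β) (hσ : 0 < σ)
  (hσ1 : 1 ≤ Real.log (1 / σ)) (hlab : BinaryLabels D) (hd : 2 ≤ d) {w : E d} (hw : ‖w‖ = 1)

include hwb hU hβ hσ hσ1 hw in
lemma lintegral_logistic_weighted_le {u : E d} (hu : ‖u‖ = 1) (huw : inner ℝ u w = 0) :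
    ∫⁻ z, ENNReal.ofReal (logistic σ (inner ℝ w z.1) * (1 + inner ℝ u z.1 ^ 2)) ∂D
      ≤ ENNReal.ofReal (stripBound U β σ) := by
  refine le_trans ?_ (hwb.lintegral_strip_le hU hβ hu hw huw hσ hσ1)
  rw [← measurePreserving_fst_fst.lintegral_comp (by fun_prop)]
  refine lintegral_mono fun z => ENNReal.ofReal_le_ofReal ?_
  gcongr
  exact logistic_le _

include hwb hU hβ hσ hσ1 hw hd in
/-- The probability of a label query. -/
lemma drawLaw_query_le :
    drawLaw D {ω | (activeFO σ w ω).2 = 1} ≤ ENNReal.ofReal (stripBound U β σ) := by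
  obtain ⟨u, hu, huw⟩ := exists_unit_orthogonal hd hw
  have hm : MeasurableSet {ω : Draw d | (activeFO σ w ω).2 = 1} :=
    (measurable_activeFO_left σ w).snd (measurableSet_singleton 1)
  rw [← lintegral_indicator_one hm]
  have h1 := lintegral_query (D := D) hw hσ (f := 1) measurable_one
  calc _ = ∫⁻ ω, (if ω.2 < queryProb σ w ω.1.1 then (1 : E d × ℝ → ℝ≥0∞) ω.1 else 0)
        ∂(drawLaw D) := by
        refine lintegral_congr fun ω => ?_
        simp [Set.indicator_apply, activeFO_snd_eq_one_iff]
    _ ≤ _ := by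
        rw [h1]
        refine le_trans (lintegral_mono fun z => ?_)
          (lintegral_logistic_weighted_le hwb hU hβ hσ hσ1 hw hu huw)
        simp only [Pi.one_apply, mul_one]
        apply ENNReal.ofReal_le_ofReal
        have := logistic_pos σ (inner ℝ w z.1)
        nlinarith [sq_nonneg (inner ℝ u z.1)]

include hwb hU hβ hσ hσ1 hw in
lemma lintegral_logistic_sq_le {v : E d} (hv : ‖v‖ ≤ 1) (hvw : inner ℝ v w = 0) :
    ∫⁻ z, ENNReal.ofReal (logistic σ (inner ℝ w z.1) * inner ℝ v z.1 ^ 2) ∂D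
      ≤ ENNReal.ofReal (stripBound U β σ) := by
  by_cases h0 : v = 0
  · subst h0; simp
  · have hpos : 0 < ‖v‖ := norm_pos_iff.2 h0
    refine le_trans (lintegral_mono fun z => ?_)
      (lintegral_logistic_weighted_le hwb hU hβ hσ hσ1 hw (u := ‖v‖⁻¹ • v)
        (norm_smul_inv_norm h0) (by rw [inner_smul_left, hvw, mul_zero]))
    apply ENNReal.ofReal_le_ofReal
    have hl := logistic_pos σ (inner ℝ w z.1)
    gcongr
    rw [inner_smul_left, mul_pow]
    have h1 : 1 ≤ (‖v‖⁻¹) ^ 2 := one_le_pow₀ ((one_le_inv₀ hpos).2 hv)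
    simp only [conj_trivial]
    nlinarith [sq_nonneg (inner ℝ v z.1)]

include hwb hU hβ hσ hσ1 hw hlab in
/-- The second moment of the stochastic gradient. -/
lemma lintegral_norm_sq_activeFO_le :
    ∫⁻ ω, ENNReal.ofReal (‖(activeFO σ w ω).1‖ ^ 2) ∂(drawLaw D)
      ≤ ENNReal.ofReal (d * stripBound U β σ / σ ^ 2) := by
  have hQ := stripBound_pos hU hβ hσ hσ1
  -- Projected basis vectors: the `j`-th coordinate of the gradient pairs `x` with `P j`. Each of
  -- the `d` coordinates then contributes at most one strip mass over `σ²`.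
  set P : Fin d → E d := fun j =>
    EuclideanSpace.single j (1 : ℝ) - (inner ℝ w (EuclideanSpace.single j (1 : ℝ)) : ℝ) • w with hP
  set f : E d × ℝ → ℝ≥0∞ := fun z => ENNReal.ofReal (‖gradVec σ w z.1 z.2‖ ^ 2) with hf
  have hfm : Measurable f :=
    (((measurable_gradVec σ).comp measurable_prodMk_left).norm.pow_const 2).ennreal_ofReal
  have h1 : ∫⁻ ω, ENNReal.ofReal (‖(activeFO σ w ω).1‖ ^ 2) ∂(drawLaw D)
      = ∫⁻ z, ENNReal.ofReal (logistic σ (inner ℝ w z.1)) * f z ∂D := by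
    rw [← lintegral_query hw hσ hfm]
    refine lintegral_congr fun ω => ?_
    unfold activeFO
    split_ifs <;> simp [hf]
  rw [h1]
  have h2 : ∀ᵐ z ∂D, ENNReal.ofReal (logistic σ (inner ℝ w z.1)) * f z
      = ∑ j, ENNReal.ofReal (1 / σ ^ 2)
        * ENNReal.ofReal (logistic σ (inner ℝ w z.1) * inner ℝ (P j) z.1 ^ 2) := by
    filter_upwards [hlab] with z hz
    have hl := logistic_pos σ (inner ℝ w z.1)
    have hy : z.2 ^ 2 = 1 := by rcases hz with h | h <;> rw [h] <;> norm_num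
    rw [hf, ← ENNReal.ofReal_mul hl.le, EuclideanSpace.real_norm_sq_eq, Finset.mul_sum,
      ENNReal.ofReal_sum_of_nonneg fun j _ => by positivity]
    refine Finset.sum_congr rfl fun j _ => ?_
    rw [← ENNReal.ofReal_mul (by positivity)]
    congr 1
    have e : gradVec σ w z.1 z.2 j
        = inner ℝ (gradVec σ w z.1 z.2) (EuclideanSpace.single j (1 : ℝ)) := by
      rw [EuclideanSpace.inner_single_right]; simp
    rw [e, inner_gradVec hw, mul_pow, mul_pow, hy]
    ring
  rw [lintegral_congr_ae h2, lintegral_finsetSum']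
  · calc _ ≤ ∑ j : Fin d, ENNReal.ofReal (1 / σ ^ 2) * ENNReal.ofReal (stripBound U β σ) := by
          refine Finset.sum_le_sum fun j _ => ?_
          rw [lintegral_const_mul' _ _ ENNReal.ofReal_ne_top]
          gcongr
          exact lintegral_logistic_sq_le hwb hU hβ hσ hσ1 hw
            ((norm_proj_le hw _).trans (by simp)) (inner_proj hw _)
      _ = _ := by
          rw [Finset.sum_const, Finset.card_univ, Fintype.card_fin, nsmul_eq_mul,
            ← ENNReal.ofReal_mul (by positivity), ← ENNReal.ofReal_natCast d,
            ← ENNReal.ofReal_mul (by positivity)]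
          congr 1; ring
  · intro j _
    have := (continuous_logistic σ).measurable
    exact Measurable.aemeasurable (by fun_prop)

/-! ### Integrability -/

include hwb hβ hd hlab in
-- Since `cosh (ct) - 1 ≤ c² (cosh t - 1)` for `|c| ≤ 1`, the exponential moment at the single scale
-- `1/(2β√d)` gives a variance-like quadratic bound at all smaller scales. The factor 3 is the
-- moment bound 4 minus 1.
lemma integrable_cosh_norm {c : ℝ} (hc0 : 0 ≤ c) (hc : c ≤ 1 / (2 * β * √d)) :
    Integrable (fun z : E d × ℝ => Real.cosh (c * (|z.2| * ‖z.1‖))) D ∧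
      ∫ z, (Real.cosh (c * (|z.2| * ‖z.1‖)) - 1) ∂D ≤ 3 * (c * (2 * β * √d)) ^ 2 := by
  have hd0 : (0 : ℝ) < √d := Real.sqrt_pos.2 (by exact_mod_cast (by omega : 0 < d))
  have hb : 0 < 2 * β * √d := by positivity
  set f : E d × ℝ → ℝ := fun z => Real.cosh (‖z.1‖ / (2 * β * √d)) with hf
  have hlin : ∫⁻ z, ENNReal.ofReal (f z) ∂D ≤ ENNReal.ofReal 4 := by
    have := hwb.lintegral_cosh_norm_le hβ (by omega : 0 < d)
    rwa [← measurePreserving_fst_fst.lintegral_comp (by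
      have := Real.continuous_cosh.measurable; fun_prop)] at this
  have hfm : Measurable f := by
    have := Real.continuous_cosh.measurable
    fun_prop
  have hfI : Integrable f D := by
    refine ⟨hfm.aestronglyMeasurable, ?_⟩
    rw [hasFiniteIntegral_iff_ofReal (Filter.Eventually.of_forall fun z => (Real.cosh_pos _).le)]
    exact hlin.trans_lt ENNReal.ofReal_lt_top
  have hf4 : ∫ z, f z ∂D ≤ 4 := by
    rw [integral_eq_lintegral_of_nonneg_ae
      (Filter.Eventually.of_forall fun z => (Real.cosh_pos _).le) hfm.aestronglyMeasurable]
    exact ENNReal.toReal_le_of_le_ofReal (by norm_num) hlin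
  have hc1 : c * (2 * β * √d) ≤ 1 := by rwa [le_div_iff₀ hb] at hc
  have hpt : ∀ᵐ z ∂D, Real.cosh (c * (|z.2| * ‖z.1‖)) - 1
      ≤ (c * (2 * β * √d)) ^ 2 * (f z - 1) := by
    filter_upwards [hlab] with z hz
    have hy : |z.2| = 1 := by rcases hz with h | h <;> rw [h] <;> norm_num
    have e : c * (|z.2| * ‖z.1‖) = (c * (2 * β * √d)) * (‖z.1‖ / (2 * β * √d)) := by
      rw [hy]; field_simp
    rw [e]
    exact cosh_mul_sub_one_le (by
      rw [sq_le_one_iff_abs_le_one, abs_of_nonneg (by positivity)]; exact hc1)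
  have hm : Measurable fun z : E d × ℝ => Real.cosh (c * (|z.2| * ‖z.1‖)) := by
    have := Real.continuous_cosh.measurable
    have h2 : Measurable fun z : E d × ℝ => |z.2| := measurable_snd.norm
    fun_prop
  have hI1 : Integrable (fun z : E d × ℝ => Real.cosh (c * (|z.2| * ‖z.1‖)) - 1) D := by
    refine Integrable.mono' ((hfI.sub (integrable_const 1)).const_mul ((c * (2 * β * √d)) ^ 2))
      (hm.sub_const 1).aestronglyMeasurable ?_
    filter_upwards [hpt] with z hz
    rw [Real.norm_eq_abs, abs_of_nonneg (sub_nonneg.2 (Real.one_le_cosh _))]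
    exact hz
  refine ⟨(hI1.add (integrable_const 1)).congr
    (Filter.Eventually.of_forall fun z => by simp), ?_⟩
  have hI2 : Integrable (fun z => (c * (2 * β * √d)) ^ 2 * (f z - 1)) D :=
    (hfI.sub (integrable_const 1)).const_mul _
  refine (integral_mono_ae hI1 hI2 hpt).trans ?_
  rw [integral_const_mul, integral_sub hfI (integrable_const 1)]
  simp only [integral_const, probReal_univ, one_smul]
  nlinarith [sq_nonneg (c * (2 * β * √d))]

include hwb hβ hd hlab in
lemma integrable_label_mul_norm : Integrable (fun z : E d × ℝ => |z.2| * ‖z.1‖) D := by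
  have hd0 : (0 : ℝ) < √d := Real.sqrt_pos.2 (by exact_mod_cast (by omega : 0 < d))
  set c := 1 / (2 * β * √d) with hc
  have hc0 : 0 < c := by positivity
  have h1 := (integrable_cosh_norm hwb hβ hlab hd hc0.le le_rfl).1
  have h2 : Measurable fun z : E d × ℝ => |z.2| := measurable_snd.norm
  refine Integrable.mono' (h1.const_mul (1 / c)) (by fun_prop) ?_
  refine Filter.Eventually.of_forall fun z => ?_
  rw [Real.norm_eq_abs, abs_of_nonneg (by positivity)]
  have h3 := self_le_sinh (by positivity : 0 ≤ c * (|z.2| * ‖z.1‖))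
  have h4 := (Real.sinh_lt_cosh (c * (|z.2| * ‖z.1‖))).le
  rw [one_div, inv_mul_eq_div, le_div_iff₀ hc0]
  linarith

include hwb hβ hd hlab hσ hw in
lemma integrable_activeFO : Integrable (fun ω => (activeFO σ w ω).1) (drawLaw D) := by
  have h1 := (integrable_label_mul_norm hwb hβ hlab hd).const_mul (1 / σ)
  have h2 := (measurePreserving_fst_drawLaw (D := D)).integrable_comp_of_integrable h1
  refine Integrable.mono' h2 (measurable_activeFO_left σ w).fst.aestronglyMeasurable ?_
  refine Filter.Eventually.of_forall fun ω => ?_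
  simpa [mul_assoc] using norm_activeFO_le hw hσ ω

/-- The gradient of the smoothed loss: the mean of the oracle's answer. -/
noncomputable def lossGrad (D : Measure (E d × ℝ)) (σ : ℝ) (w : E d) : E d :=
  ∫ ω, (activeFO σ w ω).1 ∂(drawLaw D)

include hwb hβ hd hlab hσ hw in
lemma inner_lossGrad (v : E d) :
    inner ℝ (lossGrad D σ w) v = ∫ ω, inner ℝ (activeFO σ w ω).1 v ∂(drawLaw D) := by
  rw [lossGrad, real_inner_comm, ← integral_inner (integrable_activeFO hwb hβ hσ hlab hd hw)]
  simp_rw [real_inner_comm]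

include hwb hβ hd hlab in
lemma integrable_label_logistic_inner (w u : E d) :
    Integrable (fun z : E d × ℝ => z.2 * logistic σ (inner ℝ w z.1) * inner ℝ u z.1) D := by
  have := (continuous_logistic σ).measurable
  refine Integrable.mono' ((integrable_label_mul_norm hwb hβ hlab hd).const_mul ‖u‖)
    (by fun_prop) (Filter.Eventually.of_forall fun z => ?_)
  rw [norm_mul, norm_mul, Real.norm_eq_abs, Real.norm_eq_abs, Real.norm_eq_abs,
    abs_of_pos (logistic_pos _ _)]
  have h1 := abs_real_inner_le_norm u z.1
  have h2 := logistic_le_one σ (inner ℝ w z.1)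
  have h3 := (logistic_pos σ (inner ℝ w z.1)).le
  calc |z.2| * logistic σ (inner ℝ w z.1) * |inner ℝ u z.1|
      ≤ |z.2| * 1 * (‖u‖ * ‖z.1‖) := by gcongr
    _ = _ := by ring

include hwb hβ hd hlab hσ hw in
-- Integrating out the coin turns the query probability into the weight `logistic`, which is `-σ
-- φ_σ'`. The result is minus the initial derivative of `smoothLoss` along `cos t • w - sin t • u`.
lemma inner_lossGrad_of_orthogonal {u : E d} (huw : inner ℝ w u = 0) :
    inner ℝ (lossGrad D σ w) u
      = -(1 / σ) * ∫ z, z.2 * logistic σ (inner ℝ w z.1) * inner ℝ u z.1 ∂D := by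
  rw [inner_lossGrad hwb hβ hσ hlab hd hw, drawLaw, integral_prod, ← integral_const_mul]
  · refine integral_congr_ae (Filter.Eventually.of_forall fun z => ?_)
    set q := logistic σ (inner ℝ w z.1) with hq
    set c : ℝ := inner ℝ (gradVec σ w z.1 z.2) u with hc
    have h1 : ∀ t : ℝ, (inner ℝ (activeFO σ w (z, t)).1 u : ℝ)
        = (Set.Iio q).indicator (fun _ => c) t := by
      intro t
      unfold activeFO
      simp only [queryProb_eq_of_norm hσ hw, Set.indicator_apply, Set.mem_Iio]
      split_ifs <;> simp [hc]
    simp_rw [h1]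
    rw [integral_indicator_const _ measurableSet_Iio, measureReal_def,
      Measure.restrict_apply measurableSet_Iio]
    have h2 : Set.Iio q ∩ Set.Icc 0 1 = Set.Ico 0 q := by
      ext u
      have := logistic_le_one σ (inner ℝ w z.1)
      simp only [Set.mem_inter_iff, Set.mem_Iio, Set.mem_Icc, Set.mem_Ico]
      constructor
      · rintro ⟨h1, h2, h3⟩; exact ⟨h2, h1⟩
      · rintro ⟨h1, h2⟩; exact ⟨h2, h1, by linarith⟩
    rw [h2, Real.volume_Ico, sub_zero, ENNReal.toReal_ofReal (logistic_pos _ _).le, smul_eq_mul,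
      hc, inner_gradVec hw, huw, zero_smul, sub_zero]
    ring
  · exact (integrable_activeFO hwb hβ hσ hlab hd hw).inner_const u

end Oracle

/-! ### Descent of the smoothed loss along great circles -/

section Descent

/-- The second-order Taylor remainder, with an integrated bound on the second derivative. -/
lemma abs_taylor_remainder_le {f f' f'' h : ℝ → ℝ} (hf : ∀ t, HasDerivAt f (f' t) t)
    (hf' : ∀ t, HasDerivAt f' (f'' t) t) (hc : Continuous f'') (hh : Continuous h)
    (hb : ∀ t, |f'' t| ≤ h t) {s : ℝ} (hs : 0 ≤ s) :
    |f s - f 0 - s * f' 0| ≤ s * ∫ t in 0..s, h t := by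
  have h0 : ∀ t, 0 ≤ h t := fun t => (abs_nonneg _).trans (hb t)
  -- The bound stays integrated in `t`, with no supremum, so that expectations can later be taken at
  -- each fixed angle.
  have h1 : ∀ t ∈ Set.Icc 0 s, |f' t - f' 0| ≤ ∫ t in 0..s, h t := by
    intro t ht
    rw [← intervalIntegral.integral_eq_sub_of_hasDerivAt (fun x _ => hf' x)
      (hc.intervalIntegrable _ _)]
    calc |∫ x in 0..t, f'' x| ≤ ∫ x in 0..t, |f'' x| :=
          intervalIntegral.abs_integral_le_integral_abs ht.1
      _ ≤ ∫ x in 0..t, h x := intervalIntegral.integral_mono_on ht.1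
          (hc.abs.intervalIntegrable _ _) (hh.intervalIntegrable _ _) fun x _ => hb x
      _ ≤ _ := intervalIntegral.integral_mono_interval le_rfl ht.1 ht.2
          (Filter.Eventually.of_forall h0) (hh.intervalIntegrable _ _)
  have h2 := norm_image_sub_le_of_norm_deriv_le_segment' (f := fun t => f t - t * f' 0)
    (f' := fun t => f' t - f' 0) (a := 0) (b := s) (C := ∫ t in 0..s, h t)
    (fun t _ => ((hf t).fun_sub
      ((hasDerivAt_id' t).mul_const (f' 0))).hasDerivWithinAt.congr_deriv (by simp))
    (fun t ht => h1 t ⟨ht.1, ht.2.le⟩) s ⟨hs, le_rfl⟩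
  simp only [Real.norm_eq_abs, zero_mul, sub_zero] at h2
  calc |f s - f 0 - s * f' 0| = |f s - s * f' 0 - f 0| := by ring_nf
    _ ≤ _ := h2
    _ = _ := by ring

lemma abs_mul_logistic_le {σ : ℝ} (hσ : 0 < σ) (t : ℝ) : |t| * logistic σ t ≤ σ := by
  have h1 := logistic_le (σ := σ) t
  have h2 : |t| / σ ≤ Real.exp (|t| / σ) := by
    have := Real.add_one_le_exp (|t| / σ); linarith
  calc |t| * logistic σ t ≤ |t| * Real.exp (-(|t| / σ)) := by gcongr
    _ = σ * (|t| / σ * Real.exp (-(|t| / σ))) := by field_simp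
    _ ≤ σ * (Real.exp (|t| / σ) * Real.exp (-(|t| / σ))) := by gcongr
    _ = σ := by rw [← Real.exp_add]; simp

/-- Taylor expansion of the softmax loss along a rotation. -/
lemma abs_softmaxLoss_rotation_le {σ : ℝ} (hσ : 0 < σ) (p q : ℝ) {s : ℝ} (hs : 0 ≤ s) :
    |softmaxLoss σ (Real.cos s * p - Real.sin s * q) - softmaxLoss σ p
        - s * (logistic σ p / σ * q)|
      ≤ s * ∫ t in 0..s, (1 / σ ^ 2 * (logistic σ (Real.cos t * p - Real.sin t * q)
          * (1 + (Real.sin t * p + Real.cos t * q) ^ 2)) + 1) := by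
  -- `c` and `e` are the coordinates along the rotating frame, with `c' = -e` and `e' = c`.
  set c : ℝ → ℝ := fun t => Real.cos t * p - Real.sin t * q with hc
  set e : ℝ → ℝ := fun t => Real.sin t * p + Real.cos t * q with he
  have hdc : ∀ t, HasDerivAt c (-e t) t := fun t => by
    refine (((Real.hasDerivAt_cos t).mul_const p).sub
      ((Real.hasDerivAt_sin t).mul_const q)).congr_deriv ?_
    simp [he]; ring
  have hde : ∀ t, HasDerivAt e (c t) t := fun t => by
    refine (((Real.hasDerivAt_sin t).mul_const p).add
      ((Real.hasDerivAt_cos t).mul_const q)).congr_deriv ?_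
    simp [hc]; ring
  have hcc : Continuous c := by fun_prop
  have hec : Continuous e := by fun_prop
  have hlc := continuous_logistic σ
  have hsc := continuous_softmaxLoss σ
  have key := abs_taylor_remainder_le (f := fun t => softmaxLoss σ (c t))
    (f' := fun t => logistic σ (c t) / σ * e t)
    (f'' := fun t => logistic σ (c t) * (1 - 2 * softmaxLoss σ (c t)) / σ ^ 2 * e t ^ 2
      + logistic σ (c t) / σ * c t)
    -- The summand 1 covers the curvature term `logistic · c / σ` of the great circle, by
    -- `abs_mul_logistic_le`.
    (h := fun t => 1 / σ ^ 2 * (logistic σ (c t) * (1 + e t ^ 2)) + 1)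
    (fun t => by
      refine ((hasDerivAt_softmaxLoss σ (c t)).comp t (hdc t)).congr_deriv ?_
      ring)
    (fun t => by
      refine ((((hasDerivAt_logistic σ (c t)).comp t (hdc t)).div_const σ).mul
        (hde t)).congr_deriv ?_
      simp only [Function.comp_apply]
      field_simp)
    (by fun_prop) (by fun_prop)
    (fun t => by
      have h1 := logistic_pos σ (c t)
      have h2 := abs_mul_logistic_le hσ (c t)
      have h3 : |1 - 2 * softmaxLoss σ (c t)| ≤ 1 := abs_le.2
        ⟨by linarith [softmaxLoss_lt_one σ (c t)], by linarith [softmaxLoss_pos σ (c t)]⟩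
      refine (abs_add_le _ _).trans (add_le_add ?_ ?_)
      · rw [abs_mul, abs_div, abs_mul, abs_of_pos h1, abs_of_nonneg (sq_nonneg (e t)),
          abs_of_pos (by positivity : 0 < σ ^ 2)]
        calc logistic σ (c t) * |1 - 2 * softmaxLoss σ (c t)| / σ ^ 2 * e t ^ 2
            ≤ logistic σ (c t) * 1 / σ ^ 2 * (1 + e t ^ 2) := by
              gcongr
              linarith
          _ = _ := by ring
      · rw [abs_mul, abs_div, abs_of_pos h1, abs_of_pos hσ, div_mul_eq_mul_div, div_le_one hσ]
        linarith) hs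
  have e1 : c 0 = p := by simp [hc]
  have e2 : e 0 = q := by simp [he]
  simp only [e1, e2] at key
  exact key

/-- A tangential step of length `t` followed by normalization turns by the angle `arctan t`. The
discrepancy is second order, so it can be charged to the smoothness term. -/
lemma self_sub_arctan_le {t : ℝ} (ht : 0 ≤ t) : t - Real.arctan t ≤ t ^ 2 := by
  have h0 : 0 ≤ Real.arctan t := Real.arctan_nonneg.2 ht
  have h1 := Real.sin_le h0
  rw [Real.sin_arctan] at h1
  have hs : 0 < √(1 + t ^ 2) := Real.sqrt_pos.2 (by positivity)
  have h2 : √(1 + t ^ 2) ≤ 1 + t := Real.sqrt_le_iff.2 ⟨by linarith, by nlinarith⟩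
  have h3 : t / (1 + t) ≤ t / √(1 + t ^ 2) := by gcongr
  have h4 : t - t ^ 2 ≤ t / (1 + t) := by
    rw [le_div_iff₀ (by linarith)]
    nlinarith [mul_nonneg ht (mul_nonneg ht ht)]
  linarith

lemma arctan_le_self {t : ℝ} (ht : 0 ≤ t) : Real.arctan t ≤ t := by
  have h := Real.le_tan (Real.arctan_nonneg.2 ht) (Real.arctan_lt_pi_div_two t)
  rwa [Real.tan_arctan] at h

variable {d : ℕ} {L R U β σ : ℝ} {D : Measure (E d × ℝ)} [IsProbabilityMeasure D]

/-- The smoothed loss, up to an additive constant. -/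
noncomputable def smoothLoss (D : Measure (E d × ℝ)) (σ : ℝ) (w : E d) : ℝ :=
  ∫ z, z.2 * softmaxLoss σ (inner ℝ w z.1) ∂D

omit [IsProbabilityMeasure D] in
lemma norm_label_mul_softmaxLoss_le (hlab : BinaryLabels D) (w : E d) :
    ∀ᵐ z ∂D, ‖z.2 * softmaxLoss σ (inner ℝ w z.1)‖ ≤ 1 := by
  filter_upwards [hlab] with z hz
  have hy : |z.2| = 1 := by rcases hz with h | h <;> rw [h] <;> norm_num
  rw [norm_mul, Real.norm_eq_abs, hy, one_mul, Real.norm_eq_abs, abs_of_pos (softmaxLoss_pos _ _)]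
  exact (softmaxLoss_lt_one _ _).le

lemma integrable_label_mul_softmaxLoss (hlab : BinaryLabels D) (w : E d) :
    Integrable (fun z : E d × ℝ => z.2 * softmaxLoss σ (inner ℝ w z.1)) D := by
  have := (continuous_softmaxLoss σ).measurable
  exact Integrable.of_bound (Measurable.aestronglyMeasurable (by fun_prop)) 1
    (norm_label_mul_softmaxLoss_le hlab w)

lemma abs_smoothLoss_le (hlab : BinaryLabels D) (w : E d) : |smoothLoss D σ w| ≤ 1 := by
  have := norm_integral_le_of_norm_le_const (norm_label_mul_softmaxLoss_le (σ := σ) hlab w)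
  simpa [smoothLoss] using this

/-- The Lipschitz constant of the gradient of the smoothed loss along great circles. -/
noncomputable def smoothnessBound (U β σ : ℝ) : ℝ :=
  stripBound U β σ / σ ^ 2 + 1 + stripBound U β σ / σ

lemma norm_rotation {u w : E d} (hu : ‖u‖ = 1) (hw : ‖w‖ = 1) (huw : inner ℝ u w = 0) (t : ℝ) :
    ‖Real.cos t • w - Real.sin t • u‖ = 1 := by
  rw [← sq_eq_sq₀ (norm_nonneg _) zero_le_one, norm_sub_sq_real, norm_smul, norm_smul, hu, hw,
    inner_smul_left, inner_smul_right, real_inner_comm, huw]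
  simp

lemma norm_rotation' {u w : E d} (hu : ‖u‖ = 1) (hw : ‖w‖ = 1) (huw : inner ℝ u w = 0) (t : ℝ) :
    ‖Real.sin t • w + Real.cos t • u‖ = 1 := by
  rw [← sq_eq_sq₀ (norm_nonneg _) zero_le_one, norm_add_sq_real, norm_smul, norm_smul, hu, hw,
    inner_smul_left, inner_smul_right, real_inner_comm, huw]
  simp

lemma inner_rotation {u w : E d} (hu : ‖u‖ = 1) (hw : ‖w‖ = 1) (huw : inner ℝ u w = 0) (t : ℝ) :
    inner ℝ (Real.sin t • w + Real.cos t • u) (Real.cos t • w - Real.sin t • u) = 0 := by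
  simp only [inner_add_left, inner_sub_right, inner_smul_left, inner_smul_right,
    real_inner_self_eq_norm_sq, hu, hw, huw, real_inner_comm u w, conj_trivial]
  ring

variable (hwb : WellBehaved L R U β D.fst) (hU : 0 < U) (hβ : 0 < β) (hσ : 0 < σ)
  (hσ1 : 1 ≤ Real.log (1 / σ)) (hlab : BinaryLabels D) (hd : 2 ≤ d) {w : E d} (hw : ‖w‖ = 1)

include hwb hU hβ hσ hσ1 hlab hd hw in
lemma smoothLoss_rotation_le {u : E d} (hu : ‖u‖ = 1) (huw : inner ℝ u w = 0) {s : ℝ}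
    (hs : 0 ≤ s) :
    smoothLoss D σ (Real.cos s • w - Real.sin s • u)
      ≤ smoothLoss D σ w - s * inner ℝ (lossGrad D σ w) u
        + (stripBound U β σ / σ ^ 2 + 1) * s ^ 2 := by
  have hQ := stripBound_pos hU hβ hσ hσ1
  set K := stripBound U β σ / σ ^ 2 + 1 with hK
  have hlm := (continuous_logistic σ).measurable
  have hlc := continuous_logistic σ
  have hsm := (continuous_softmaxLoss σ).measurable
  set wt : ℝ → E d := fun t => Real.cos t • w - Real.sin t • u with hwt
  set et : ℝ → E d := fun t => Real.sin t • w + Real.cos t • u with het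
  set h : ℝ → E d × ℝ → ℝ := fun t z =>
    1 / σ ^ 2 * (logistic σ (inner ℝ (wt t) z.1) * (1 + inner ℝ (et t) z.1 ^ 2)) + 1 with hh
  have hin1 : ∀ t (x : E d), (inner ℝ (wt t) x : ℝ)
      = Real.cos t * inner ℝ w x - Real.sin t * inner ℝ u x := fun t x => by
    simp [hwt, inner_sub_left, inner_smul_left]
  have hin2 : ∀ t (x : E d), (inner ℝ (et t) x : ℝ)
      = Real.sin t * inner ℝ w x + Real.cos t * inner ℝ u x := fun t x => by
    simp [het, inner_add_left, inner_smul_left]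
  have hpos : ∀ t z, 0 ≤ h t z := fun t z => by
    have := logistic_pos σ (inner ℝ (wt t) z.1)
    simp only [hh]; positivity
  have hcont : ∀ z, Continuous fun t => h t z := fun z => by
    simp only [hh, hin1, hin2]; fun_prop
  have hmeas : Measurable fun p : (E d × ℝ) × ℝ => ENNReal.ofReal (h p.2 p.1) := by
    simp only [hh, hin1, hin2]; fun_prop
  set rem : E d × ℝ → ℝ := fun z => z.2 * softmaxLoss σ (inner ℝ (wt s) z.1)
    - z.2 * softmaxLoss σ (inner ℝ w z.1)
    - s / σ * (z.2 * logistic σ (inner ℝ w z.1) * inner ℝ u z.1) with hrem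
  have hpt : ∀ᵐ z ∂D, ENNReal.ofReal |rem z|
      ≤ ENNReal.ofReal s * ∫⁻ t in Set.Ioc 0 s, ENNReal.ofReal (h t z) := by
    filter_upwards [hlab] with z hz
    have hy : |z.2| = 1 := by rcases hz with h | h <;> rw [h] <;> norm_num
    have h1 := abs_softmaxLoss_rotation_le hσ (inner ℝ w z.1) (inner ℝ u z.1) hs
    simp only [← hin1, ← hin2] at h1
    have e : rem z = z.2 * (softmaxLoss σ (inner ℝ (wt s) z.1) - softmaxLoss σ (inner ℝ w z.1)
        - s * (logistic σ (inner ℝ w z.1) / σ * inner ℝ u z.1)) := by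
      simp only [hrem]; field_simp
    rw [e, abs_mul, hy, one_mul, ← ofReal_integral_eq_lintegral_ofReal
      ((hcont z).integrableOn_Ioc) (Filter.Eventually.of_forall fun t => hpos t z),
      ← intervalIntegral.integral_of_le hs, ← ENNReal.ofReal_mul hs]
    exact ENNReal.ofReal_le_ofReal h1
  -- Tonelli exchanges the angle and the expectation. At every angle the frame `(et, wt)` is
  -- orthonormal, so the strip bound holds with the same constant.
  have hlin : ∫⁻ z, ENNReal.ofReal |rem z| ∂D ≤ ENNReal.ofReal (K * s ^ 2) := by
    calc _ ≤ ∫⁻ z, (ENNReal.ofReal s * ∫⁻ t in Set.Ioc 0 s, ENNReal.ofReal (h t z)) ∂D :=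
          lintegral_mono_ae hpt
      _ = ENNReal.ofReal s * ∫⁻ t in Set.Ioc 0 s, ∫⁻ z, ENNReal.ofReal (h t z) ∂D := by
          rw [lintegral_const_mul' _ _ ENNReal.ofReal_ne_top, lintegral_lintegral_swap]
          exact hmeas.aemeasurable
      _ ≤ ENNReal.ofReal s * ∫⁻ t in Set.Ioc 0 s, ENNReal.ofReal K := by
          gcongr with t
          calc ∫⁻ z, ENNReal.ofReal (h t z) ∂D
              = ENNReal.ofReal (1 / σ ^ 2) * ∫⁻ z, ENNReal.ofReal
                (logistic σ (inner ℝ (wt t) z.1) * (1 + inner ℝ (et t) z.1 ^ 2)) ∂D + 1 := by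
                rw [← lintegral_const_mul' _ _ ENNReal.ofReal_ne_top]
                have : (1 : ℝ≥0∞) = ∫⁻ _ : E d × ℝ, 1 ∂D := by simp
                rw [this, ← lintegral_add_right _ measurable_const]
                refine lintegral_congr fun z => ?_
                have := logistic_pos σ (inner ℝ (wt t) z.1)
                rw [← ENNReal.ofReal_mul (by positivity), ← ENNReal.ofReal_one,
                  ← ENNReal.ofReal_add (by positivity) zero_le_one]
            _ ≤ ENNReal.ofReal (1 / σ ^ 2) * ENNReal.ofReal (stripBound U β σ)
                + ENNReal.ofReal 1 := by
                rw [ENNReal.ofReal_one]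
                gcongr
                exact lintegral_logistic_weighted_le hwb hU hβ hσ hσ1
                  (norm_rotation hu hw huw t) (norm_rotation' hu hw huw t)
                  (inner_rotation hu hw huw t)
            _ = _ := by
                rw [← ENNReal.ofReal_mul (by positivity),
                  ← ENNReal.ofReal_add (by positivity) zero_le_one, hK]
                congr 1; ring
      _ = _ := by
          rw [setLIntegral_const, Real.volume_Ioc, sub_zero,
            ← ENNReal.ofReal_mul (by positivity), ← ENNReal.ofReal_mul hs]
          congr 1; ring
  have hi1 := integrable_label_mul_softmaxLoss (σ := σ) hlab (wt s)
  have hi2 := integrable_label_mul_softmaxLoss (σ := σ) hlab w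
  have hi3 := (integrable_label_logistic_inner (σ := σ) hwb hβ hlab hd w u).const_mul (s / σ)
  have hint : ∫ z, rem z ∂D = smoothLoss D σ (wt s) - smoothLoss D σ w
      + s * inner ℝ (lossGrad D σ w) u := by
    rw [inner_lossGrad_of_orthogonal hwb hβ hσ hlab hd hw (by rw [real_inner_comm, huw]),
      smoothLoss, smoothLoss, ← integral_sub hi1 hi2]
    simp only [hrem]
    have hi4 : Integrable (fun z : E d × ℝ => z.2 * softmaxLoss σ (inner ℝ (wt s) z.1)
      - z.2 * softmaxLoss σ (inner ℝ w z.1)) D := hi1.sub hi2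
    rw [integral_sub hi4 hi3, integral_const_mul]
    ring
  have hle : ∫ z, rem z ∂D ≤ K * s ^ 2 := by
    calc ∫ z, rem z ∂D ≤ ∫ z, |rem z| ∂D := by
          refine integral_mono ((hi1.sub hi2).sub hi3) ((hi1.sub hi2).sub hi3).abs ?_
          exact fun z => le_abs_self _
      _ = (∫⁻ z, ENNReal.ofReal |rem z| ∂D).toReal :=
          integral_eq_lintegral_of_nonneg_ae (Filter.Eventually.of_forall fun z => abs_nonneg _)
            ((hi1.sub hi2).sub hi3).abs.aestronglyMeasurable
      _ ≤ _ := ENNReal.toReal_le_of_le_ofReal (by positivity) hlin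
  rw [hint] at hle
  linarith

include hwb hU hβ hσ hσ1 hlab hd hw in
-- The weighted strip bound applies because `|a| ≤ 1 + a²`. This controls the error made when the
-- rotation angle replaces the step length.
lemma abs_inner_lossGrad_le {u : E d} (hu : ‖u‖ = 1) (huw : inner ℝ u w = 0) :
    |inner ℝ (lossGrad D σ w) u| ≤ stripBound U β σ / σ := by
  have hQ := stripBound_pos hU hβ hσ hσ1
  have hlm := (continuous_logistic σ).measurable
  rw [inner_lossGrad_of_orthogonal hwb hβ hσ hlab hd hw (by rw [real_inner_comm, huw]), abs_mul,
    abs_neg, abs_of_pos (by positivity), one_div, inv_mul_eq_div]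
  gcongr
  refine (abs_integral_le_integral_abs).trans ?_
  rw [integral_eq_lintegral_of_nonneg_ae (Filter.Eventually.of_forall fun z => abs_nonneg _)
    (integrable_label_logistic_inner hwb hβ hlab hd w u).abs.aestronglyMeasurable]
  refine ENNReal.toReal_le_of_le_ofReal hQ.le (le_trans (lintegral_mono_ae ?_)
    (lintegral_logistic_weighted_le hwb hU hβ hσ hσ1 hw hu huw))
  filter_upwards [hlab] with z hz
  have hy : |z.2| = 1 := by rcases hz with h | h <;> rw [h] <;> norm_num
  apply ENNReal.ofReal_le_ofReal
  rw [abs_mul, abs_mul, hy, one_mul, abs_of_pos (logistic_pos _ _)]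
  have := logistic_pos σ (inner ℝ w z.1)
  gcongr
  nlinarith [sq_nonneg (|inner ℝ u z.1| - 1), sq_abs (inner ℝ u z.1 : ℝ)]

include hwb hU hβ hσ hσ1 hlab hd hw in
/-- One projected gradient step decreases the smoothed loss up to a second-order error. -/
lemma smoothLoss_step_le {γ : ℝ} (hγ : 0 < γ) {g : E d} (hg : inner ℝ g w = 0) :
    smoothLoss D σ (‖w - γ • g‖⁻¹ • (w - γ • g))
      ≤ smoothLoss D σ w - γ * inner ℝ (lossGrad D σ w) g
        + smoothnessBound U β σ * γ ^ 2 * ‖g‖ ^ 2 := by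
  by_cases h0 : g = 0
  · subst h0; simp [hw]
  have hgn : 0 < ‖g‖ := norm_pos_iff.2 h0
  set u : E d := ‖g‖⁻¹ • g with hu
  have hun : ‖u‖ = 1 := norm_smul_inv_norm h0
  have huw : inner ℝ u w = 0 := by rw [hu, inner_smul_left, hg, mul_zero]
  set t := γ * ‖g‖ with ht
  have ht0 : 0 < t := by positivity
  have hgu : γ • g = t • u := by
    rw [hu, ht, smul_smul, mul_assoc, mul_inv_cancel₀ hgn.ne', mul_one]
  have hnorm : ‖w - t • u‖ = √(1 + t ^ 2) := by
    rw [← Real.sqrt_sq (norm_nonneg (w - t • u)), norm_sub_sq_real, norm_smul, hun, hw,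
      inner_smul_right, real_inner_comm, huw]
    simp [sq_abs]
  set s := Real.arctan t with hs
  have hs0 : 0 ≤ s := Real.arctan_nonneg.2 ht0.le
  -- Normalizing a tangential step of length `t` is the rotation by `s = arctan t`.
  have hvec : ‖w - t • u‖⁻¹ • (w - t • u) = Real.cos s • w - Real.sin s • u := by
    rw [hnorm, hs, Real.cos_arctan, Real.sin_arctan, smul_sub, smul_smul]
    simp [div_eq_inv_mul]
  rw [hgu, hvec]
  have h1 := smoothLoss_rotation_le hwb hU hβ hσ hσ1 hlab hd hw hun huw hs0
  have h2 := abs_inner_lossGrad_le hwb hU hβ hσ hσ1 hlab hd hw hun huw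
  have h3 := self_sub_arctan_le ht0.le
  have h4 := arctan_le_self ht0.le
  rw [← hs] at h3 h4
  have hQ := stripBound_pos hU hβ hσ hσ1
  set I : ℝ := inner ℝ (lossGrad D σ w) u with hI
  have hIg : γ * inner ℝ (lossGrad D σ w) g = t * I := by
    rw [hI, ← inner_smul_right, ← inner_smul_right, hgu]
  -- The first-order gain is `s * I`, while `t * I` is wanted. The difference accounts for the last
  -- summand of `smoothnessBound`.
  have h5 : (t - s) * I ≤ t ^ 2 * (stripBound U β σ / σ) :=
    calc (t - s) * I ≤ (t - s) * |I| := by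
          gcongr
          exact le_abs_self _
      _ ≤ _ := by gcongr
  have h6 : (stripBound U β σ / σ ^ 2 + 1) * s ^ 2 ≤ (stripBound U β σ / σ ^ 2 + 1) * t ^ 2 := by
    gcongr
  rw [hIg, show smoothnessBound U β σ * γ ^ 2 * ‖g‖ ^ 2 = (stripBound U β σ / σ ^ 2 + 1) * t ^ 2
    + t ^ 2 * (stripBound U β σ / σ) by rw [ht, smoothnessBound]; ring]
  nlinarith

end Descent

/-! ### Noise -/

section Noise

variable {d : ℕ} {D : Measure (E d × ℝ)}

lemma measurable_halfspace (w : E d) : Measurable (halfspace w) := by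
  unfold halfspace
  exact Measurable.ite (measurableSet_le measurable_const (by fun_prop)) measurable_const
    measurable_const

lemma halfspace_eq_or (w x : E d) : halfspace w x = 1 ∨ halfspace w x = -1 := by
  unfold halfspace; split_ifs <;> simp

lemma halfspace_smul {c : ℝ} (hc : 0 < c) (w : E d) : halfspace (c • w) = halfspace w := by
  ext x
  unfold halfspace
  simp only [inner_smul_left, conj_trivial, mul_nonneg_iff_of_pos_left hc]

variable [IsProbabilityMeasure D]

lemma measurableSet_ne_halfspace (w : E d) :
    MeasurableSet {z : E d × ℝ | z.2 ≠ halfspace w z.1} :=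
  (measurableSet_eq_fun measurable_snd ((measurable_halfspace w).comp measurable_fst)).compl

lemma measurable_flipProb (w : E d) : Measurable (flipProb D w) := by
  unfold flipProb
  exact (Kernel.measurable_kernel_prodMk_left (measurableSet_ne_halfspace w)).ennreal_toReal

lemma flipProb_nonneg (w x : E d) : 0 ≤ flipProb D w x := measureReal_nonneg

lemma flipProb_le_one (w x : E d) : flipProb D w x ≤ 1 := measureReal_le_one

lemma integral_label_condKernel (hlab : BinaryLabels D) (w : E d) :
    ∀ᵐ x ∂D.fst, ∫ y, y * halfspace w x ∂(D.condKernel x) = 1 - 2 * flipProb D w x := by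
  have h1 : ∀ᵐ z ∂(D.fst ⊗ₘ D.condKernel), z.2 = 1 ∨ z.2 = -1 := by
    rw [D.disintegrate]; exact hlab
  filter_upwards [Measure.ae_ae_of_ae_compProd h1] with x hx
  have hm : MeasurableSet {y | y ≠ halfspace w x} := (measurableSet_singleton _).compl
  have h2 : (fun y => y * halfspace w x)
      =ᵐ[D.condKernel x] fun y => 1 - {y | y ≠ halfspace w x}.indicator (fun _ => (2 : ℝ)) y := by
    filter_upwards [hx] with y hy
    by_cases h : y = halfspace w x
    · rcases hy with h' | h' <;> simp [← h, h']
    · have h3 := halfspace_eq_or w x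
      rcases hy with h' | h' <;> rcases h3 with h'' | h'' <;>
        simp_all <;> norm_num
  rw [integral_congr_ae h2, integral_sub (integrable_const _)
    ((integrable_const _).indicator hm), integral_indicator_const _ hm]
  simp [flipProb, mul_comm]

/-- The mean of a function of the instance, weighted with the correlation of label and halfspace. -/
lemma integral_mul_label_halfspace (hlab : BinaryLabels D) (w : E d) {G : E d → ℝ}
    (hG : Integrable (fun z : E d × ℝ => G z.1 * (z.2 * halfspace w z.1)) D) :
    ∫ z, G z.1 * (z.2 * halfspace w z.1) ∂D = ∫ x, G x * (1 - 2 * flipProb D w x) ∂D.fst := by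
  rw [← Measure.integral_condKernel hG]
  refine integral_congr_ae ?_
  filter_upwards [integral_label_condKernel hlab w] with x hx
  rw [← hx, integral_const_mul]

variable {A α : ℝ} {wstar : E d}

/-- At `t = 1/2` the event in the noise condition is the whole space. -/
lemma TsybakovNoise.one_le (h : TsybakovNoise A α wstar D) (hα0 : 0 < α) (hα : α < 1)
    (hA : 0 < A) : 1 ≤ A := by
  have h1 := h.1 hα (1 / 2) (by norm_num) le_rfl
  have h2 : {x | 1 / 2 - flipProb D wstar x ≤ 1 / 2} = Set.univ := by
    ext x
    simp [flipProb_nonneg]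
  rw [h2, probReal_univ] at h1
  have h3 : (1 / 2 : ℝ) ^ (α / (1 - α)) ≤ 1 := by
    apply Real.rpow_le_one (by norm_num) (by norm_num)
    have : 0 < 1 - α := by linarith
    positivity
  nlinarith

lemma TsybakovNoise.ae_lt (h : TsybakovNoise A α wstar D) (hα0 : 0 < α) (hα : α ≤ 1) :
    ∀ᵐ x ∂D.fst, 0 < 1 / 2 - flipProb D wstar x := by
  have h0 : D.fst.real {x | 1 / 2 - flipProb D wstar x ≤ 0} = 0 := by
    rcases hα.lt_or_eq with hlt | heq
    · have h1 := h.1 hlt 0 le_rfl (by norm_num)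
      have : 0 < 1 - α := by linarith
      rw [Real.zero_rpow (by positivity), mul_zero] at h1
      exact le_antisymm h1 measureReal_nonneg
    · exact h.2 heq 0 le_rfl (by norm_num)
  rw [measureReal_eq_zero_iff] at h0
  rw [ae_iff]
  simpa using h0

/-- The threshold inverts `A t^(α/(1-α))`. The factor `1/4` keeps it below `1/2`, and for `α = 1`,
where the power is 1, it makes the threshold an admissible `1/4`, so both cases share one formula.
-/
lemma TsybakovNoise.measure_le (h : TsybakovNoise A α wstar D) (hα0 : 0 < α) (hα : α ≤ 1)
    (hA : 0 < A) {κ : ℝ} (hκ : 0 < κ) (hκ1 : κ ≤ 1) :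
    D.fst.real {x | 1 / 2 - flipProb D wstar x ≤ 1 / 4 * (κ / A) ^ ((1 - α) / α)} ≤ κ := by
  rcases hα.lt_or_eq with hlt | heq
  · have hA1 := h.one_le hα0 hlt hA
    have hp : 0 < 1 - α := by linarith
    have hκA : 0 < κ / A := by positivity
    have hκA1 : κ / A ≤ 1 := (div_le_one hA).2 (hκ1.trans hA1)
    have h1 : (κ / A) ^ ((1 - α) / α) ≤ 1 := Real.rpow_le_one hκA.le hκA1 (by positivity)
    refine (h.1 hlt _ (by positivity) (by linarith)).trans ?_
    rw [Real.mul_rpow (by norm_num) (by positivity), ← Real.rpow_mul hκA.le]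
    have e : (1 - α) / α * (α / (1 - α)) = 1 := by field_simp
    rw [e, Real.rpow_one]
    have h2 : (1 / 4 : ℝ) ^ (α / (1 - α)) ≤ 1 :=
      Real.rpow_le_one (by norm_num) (by norm_num) (by positivity)
    calc A * ((1 / 4 : ℝ) ^ (α / (1 - α)) * (κ / A)) ≤ A * (1 * (κ / A)) := by gcongr
      _ = κ := by field_simp
  · subst heq
    rw [h.2 rfl _ (by norm_num) (by norm_num)]
    exact hκ.le

/-- Correlation of the label with the optimal halfspace on a region of known mass. -/
lemma TsybakovNoise.le_integral (h : TsybakovNoise A α wstar D) (hα0 : 0 < α) (hα : α ≤ 1)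
    (hA : 0 < A) (hlab : BinaryLabels D) {G : E d → ℝ} (hG0 : ∀ x, 0 ≤ G x)
    (hG : Integrable (fun z : E d × ℝ => G z.1) D) (hGm : Measurable G) {S : Set (E d)}
    (hS : MeasurableSet S) {g₀ κ : ℝ} (hg₀ : 0 ≤ g₀) (hGS : ∀ x ∈ S, g₀ ≤ G x) (hκ : 0 < κ)
    (hκS : 2 * κ ≤ D.fst.real S) :
    1 / 2 * (κ / A) ^ ((1 - α) / α) * g₀ * κ
      ≤ ∫ z, G z.1 * (z.2 * halfspace wstar z.1) ∂D := by
  have hκ1 : κ ≤ 1 := by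
    have : D.fst.real S ≤ 1 := measureReal_le_one
    linarith
  have hGi : Integrable (fun z : E d × ℝ => G z.1 * (z.2 * halfspace wstar z.1)) D := by
    have := measurable_halfspace wstar
    refine hG.mono' (Measurable.aestronglyMeasurable (by fun_prop)) ?_
    filter_upwards [hlab] with z hz
    rw [norm_mul, Real.norm_eq_abs, abs_of_nonneg (hG0 _)]
    have : ‖z.2 * halfspace wstar z.1‖ = 1 := by
      rcases hz with h' | h' <;> rcases halfspace_eq_or wstar z.1 with h'' | h'' <;> rw [h', h''] <;>
        norm_num
    rw [this, mul_one]
  rw [integral_mul_label_halfspace hlab wstar hGi]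
  set t := 1 / 4 * (κ / A) ^ ((1 - α) / α) with ht
  have ht0 : 0 < t := by positivity
  set T := {x | 1 / 2 - flipProb D wstar x ≤ t} with hT
  have hTm : MeasurableSet T := by
    have := measurable_flipProb (D := D) wstar
    exact measurableSet_le (by fun_prop) measurable_const
  have hTκ : D.fst.real T ≤ κ := h.measure_le hα0 hα hA hκ hκ1
  -- The noisy set `T` takes at most half of the mass of `S`. On the rest `1 - 2η` exceeds `2t`, and
  -- everywhere else the integrand is almost surely nonnegative.
  have hST : κ ≤ D.fst.real (S \ T) := by
    have := le_measureReal_sdiff (μ := D.fst) (s₁ := S) (s₂ := T)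
    linarith
  have hGf : Integrable G D.fst :=
    ((measurePreserving_fst_fst (D := D)).integrable_comp hGm.aestronglyMeasurable).1 hG
  have hGi2 : Integrable (fun x => G x * (1 - 2 * flipProb D wstar x)) D.fst := by
    have := measurable_flipProb (D := D) wstar
    refine hGf.mono' (Measurable.aestronglyMeasurable (by fun_prop)) ?_
    refine Filter.Eventually.of_forall fun x => ?_
    rw [norm_mul, Real.norm_eq_abs, abs_of_nonneg (hG0 _)]
    have h1 := flipProb_nonneg (D := D) wstar x
    have h2 := flipProb_le_one (D := D) wstar x
    exact mul_le_of_le_one_right (hG0 x) (abs_le.2 ⟨by linarith, by linarith⟩)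
  calc 1 / 2 * (κ / A) ^ ((1 - α) / α) * g₀ * κ = κ * (g₀ * (2 * t)) := by rw [ht]; ring
    _ ≤ D.fst.real (S \ T) * (g₀ * (2 * t)) := by gcongr
    _ = ∫ x, (S \ T).indicator (fun _ => g₀ * (2 * t)) x ∂D.fst := by
        rw [integral_indicator_const _ (hS.diff hTm), smul_eq_mul]
    _ ≤ _ := by
        refine integral_mono_ae ((integrable_const _).indicator (hS.diff hTm)) hGi2 ?_
        filter_upwards [h.ae_lt hα0 hα] with x hx
        by_cases hxs : x ∈ S \ T
        · rw [Set.indicator_of_mem hxs]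
          have h1 : t < 1 / 2 - flipProb D wstar x := not_le.1 hxs.2
          have h2 := hGS x hxs.1
          exact mul_le_mul h2 (by linarith) (by linarith) (hG0 x)
        · rw [Set.indicator_of_notMem hxs]
          exact mul_nonneg (hG0 x) (by linarith)

lemma err_eq (hlab : BinaryLabels D) (w : E d) :
    err D w = 1 / 2 - 1 / 2 * ∫ z, z.2 * halfspace w z.1 ∂D := by
  have hm : MeasurableSet {z : E d × ℝ | halfspace w z.1 ≠ z.2} :=
    (measurableSet_eq_fun ((measurable_halfspace w).comp measurable_fst) measurable_snd).compl
  have h2 : (fun z : E d × ℝ => z.2 * halfspace w z.1)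
      =ᵐ[D] fun z => 1 - {z : E d × ℝ | halfspace w z.1 ≠ z.2}.indicator (fun _ => (2 : ℝ)) z := by
    filter_upwards [hlab] with z hz
    rcases hz with h' | h' <;> rcases halfspace_eq_or w z.1 with h'' | h'' <;>
      simp [Set.indicator_apply, h', h''] <;> norm_num
  rw [integral_congr_ae h2, integral_sub (integrable_const _)
    ((integrable_const _).indicator hm), integral_indicator_const _ hm]
  simp [err]
  ring

/-- The optimal halfspace is bounded away from random guessing. -/
lemma TsybakovNoise.err_le (h : TsybakovNoise A α wstar D) (hα0 : 1 / 3 < α) (hα : α ≤ 1)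
    (hA : 0 < A) (hlab : BinaryLabels D) :
    err D wstar ≤ 1 / 2 - 1 / 32 * (1 / A) ^ ((1 - α) / α) := by
  have hα0' : 0 < α := by linarith
  have h1 := h.le_integral hα0' hα hA hlab (G := fun _ => 1) (fun _ => zero_le_one)
    (integrable_const _) measurable_const MeasurableSet.univ (g₀ := 1) (κ := 1 / 2) zero_le_one
    (fun _ _ => le_rfl) (by norm_num) (by simp)
  simp only [one_mul, mul_one] at h1
  rw [err_eq hlab]
  -- Because `α > 1/3`, replacing `1/(2A)` by `1/A` in the power costs at most a factor 4. This
  -- yields `1/32 = 1/2 · 1/2 · 1/2 · 1/4`.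
  have hν : (1 - α) / α ≤ 2 := by rw [div_le_iff₀ hα0']; linarith
  have h2 : (1 / 4 : ℝ) ≤ (1 / 2 : ℝ) ^ ((1 - α) / α) := by
    calc (1 / 4 : ℝ) = (1 / 2 : ℝ) ^ (2 : ℝ) := by norm_num
      _ ≤ _ := Real.rpow_le_rpow_of_exponent_ge (by norm_num) (by norm_num) hν
  have h3 : ((1 : ℝ) / 2 / A) ^ ((1 - α) / α)
      = (1 / 2 : ℝ) ^ ((1 - α) / α) * (1 / A) ^ ((1 - α) / α) := by
    rw [← Real.mul_rpow (by norm_num) (by positivity)]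
    congr 1; ring
  rw [h3] at h1
  have h4 : 0 ≤ (1 / A) ^ ((1 - α) / α) := by positivity
  nlinarith

end Noise

/-! ### Approximate stationary points -/

section Stationary

variable {d : ℕ} {L R U β σ A α : ℝ} {D : Measure (E d × ℝ)} [IsProbabilityMeasure D]

lemma exists_orthogonal_decomposition (hd : 2 ≤ d) {w v : E d} (hw : ‖w‖ = 1) (hv : ‖v‖ = 1) :
    ∃ (u : E d) (a b : ℝ), ‖u‖ = 1 ∧ inner ℝ u w = 0 ∧ 0 ≤ b ∧ a ^ 2 + b ^ 2 = 1 ∧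
      v = a • w + b • u := by
  set p := v - (inner ℝ w v : ℝ) • w with hp
  have hpw : inner ℝ p w = 0 := inner_proj hw v
  -- If `v` is parallel to `w`, any unit vector orthogonal to `w` serves; one exists because `d ≥
  -- 2`.
  obtain ⟨u, hu, huw, hpu⟩ : ∃ u : E d, ‖u‖ = 1 ∧ inner ℝ u w = 0 ∧ p = ‖p‖ • u := by
    by_cases h0 : p = 0
    · obtain ⟨u, hu, huw⟩ := exists_unit_orthogonal hd hw
      exact ⟨u, hu, huw, by rw [h0]; simp⟩
    · refine ⟨‖p‖⁻¹ • p, norm_smul_inv_norm h0, by rw [inner_smul_left, hpw, mul_zero], ?_⟩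
      rw [smul_smul, mul_inv_cancel₀ (norm_ne_zero_iff.2 h0), one_smul]
  have hvd : v = (inner ℝ w v : ℝ) • w + ‖p‖ • u := by rw [← hpu, hp]; abel
  refine ⟨u, inner ℝ w v, ‖p‖, hu, huw, norm_nonneg _, ?_, hvd⟩
  have h1 : ‖v‖ ^ 2 = (inner ℝ w v) ^ 2 + ‖p‖ ^ 2 := by
    conv_lhs => rw [hvd]
    rw [norm_add_sq_real, norm_smul, norm_smul, hu, hw, inner_smul_left, inner_smul_right,
      real_inner_comm u w, huw]
    simp
  rw [← h1, hv, one_pow]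

/-- Where the halfspace of `a w + b u` disagrees with the sign of `⟨u, x⟩`, the point lies in a
wedge around the boundary of `w`. -/
lemma label_mul_inner_ge {u w x : E d} {a b y : ℝ} (ha : |a| ≤ 1)
    (hy : y = 1 ∨ y = -1) :
    y * halfspace (a • w + b • u) x * |inner ℝ u x|
      - 2 * (if |inner ℝ u x| * b ≤ |inner ℝ w x| then |inner ℝ u x| else 0)
      ≤ y * inner ℝ u x := by
  set p : ℝ := inner ℝ u x with hp
  set q : ℝ := inner ℝ w x with hq
  have hh : halfspace (a • w + b • u) x = if 0 ≤ a * q + b * p then 1 else -1 := by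
    simp [halfspace, inner_add_left, inner_smul_left, hp, hq]
  rw [hh]
  -- With `b|p| > |q|` the term `b p` decides the sign, so disagreement can occur only in the wedge.
  -- There it costs at most `2|p|`.
  have haq : |a * q| ≤ |q| := by
    rw [abs_mul]; exact mul_le_of_le_one_left (abs_nonneg _) ha
  have haq' := abs_le.1 haq
  rcases le_or_gt 0 p with h | h
  · rw [abs_of_nonneg h]
    by_cases hc : 0 ≤ a * q + b * p
    · rw [if_pos hc]
      split_ifs <;> rcases hy with rfl | rfl <;> linarith
    · rw [if_neg hc, if_pos (by nlinarith)]
      rcases hy with rfl | rfl <;> linarith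
  · rw [abs_of_neg h]
    by_cases hc : 0 ≤ a * q + b * p
    · rw [if_pos hc, if_pos (by nlinarith)]
      rcases hy with rfl | rfl <;> linarith
    · rw [if_neg hc]
      split_ifs <;> rcases hy with rfl | rfl <;> linarith

/-- The gradient of the smoothed loss is large at unit vectors that make a large angle with the
line through the optimal halfspace. -/
lemma le_norm_lossGrad (hwb : WellBehaved L R U β D.fst) (hL : 0 < L) (hR : 0 < R) (hU : 0 < U)
    (hβ : 0 < β) (hσ : 0 < σ) (hσR : σ ≤ R / 2) (hlab : BinaryLabels D) (hd : 2 ≤ d)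
    (hα0 : 0 < α) (hα : α ≤ 1) (hA : 0 < A) {u w : E d} {a b : ℝ} (hu : ‖u‖ = 1) (hw : ‖w‖ = 1)
    (huw : inner ℝ u w = 0) (ha : |a| ≤ 1) (hb : 0 < b)
    (hT : TsybakovNoise A α (a • w + b • u) D) :
    L * R ^ 2 / 384 * (L * R * σ / 4 / A) ^ ((1 - α) / α) - 128 * U * σ ^ 2 / b ^ 2
      ≤ ‖lossGrad D σ w‖ := by
  have hlm := (continuous_logistic σ).measurable
  set v := a • w + b • u with hv
  set G : E d → ℝ := fun x => logistic σ (inner ℝ w x) * |inner ℝ u x| with hG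
  have hGm : Measurable G :=
    Measurable.mul (by fun_prop) (Measurable.norm (by fun_prop : Measurable fun x : E d =>
      (inner ℝ u x : ℝ)))
  have hG0 : ∀ x, 0 ≤ G x := fun x => mul_nonneg (logistic_pos _ _).le (abs_nonneg _)
  have hI0 := integrable_label_logistic_inner (σ := σ) hwb hβ hlab hd w u
  have hGi : Integrable (fun z : E d × ℝ => G z.1) D := by
    refine hI0.abs.congr ?_
    filter_upwards [hlab] with z hz
    have hy : |z.2| = 1 := by rcases hz with h | h <;> rw [h] <;> norm_num
    rw [abs_mul, abs_mul, hy, one_mul, abs_of_pos (logistic_pos _ _)]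
  set S : Set (E d) := {x | inner ℝ u x ∈ Set.Icc (R / 4) (R / 2) ∧ inner ℝ w x ∈ Set.Icc (-σ) σ}
    with hS
  have hSm : MeasurableSet S :=
    ((measurable_inner_right u) measurableSet_Icc).inter
      ((measurable_inner_right w) measurableSet_Icc)
  have hSmass : L * R * σ / 2 ≤ D.fst.real S := by
    rw [measureReal_def]
    exact (ENNReal.ofReal_le_iff_le_toReal (measure_ne_top _ _)).1
      (hwb.le_measure_rectangle hL hR hu hw huw hσ hσR)
  -- On the rectangle the weight is at least `exp (-1)/4 ≥ 1/12`, and `⟨u,x⟩ ≥ R/4`.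
  have hGS : ∀ x ∈ S, R / 48 ≤ G x := by
    intro x hx
    have h1 : |(inner ℝ w x : ℝ)| ≤ σ := abs_le.2 hx.2
    have h2 : R / 4 ≤ |(inner ℝ u x : ℝ)| := hx.1.1.trans (le_abs_self _)
    have h3 : (1 / 12 : ℝ) ≤ logistic σ (inner ℝ w x) := by
      refine le_trans ?_ (le_logistic hσ _)
      have h4 : Real.exp (-1) ≤ Real.exp (-(|(inner ℝ w x : ℝ)| / σ)) := by
        apply Real.exp_le_exp.2
        rw [neg_le_neg_iff, div_le_one hσ]; exact h1
      have h5 : (1 / 3 : ℝ) ≤ Real.exp (-1) := by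
        have := Real.exp_neg_one_gt_d9; linarith
      linarith
    calc R / 48 = 1 / 12 * (R / 4) := by ring
      _ ≤ _ := by simp only [hG]; gcongr
  -- `κ` is half of the guaranteed mass `L R σ / 2` of the rectangle, as required for discarding the
  -- noisy points.
  have hgood := hT.le_integral hα0 hα hA hlab hG0 hGi hGm hSm (g₀ := R / 48)
    (κ := L * R * σ / 4) (by positivity) hGS (by positivity) (by linarith)
  set B : E d × ℝ → ℝ := fun z => if |inner ℝ u z.1| * b ≤ |inner ℝ w z.1| then G z.1 else 0 with hB
  have hBset : MeasurableSet {z : E d × ℝ | |inner ℝ u z.1| * b ≤ |inner ℝ w z.1|} :=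
    measurableSet_le
      ((Measurable.norm (by fun_prop : Measurable fun z : E d × ℝ => (inner ℝ u z.1 : ℝ))).mul_const b)
      (Measurable.norm (by fun_prop : Measurable fun z : E d × ℝ => (inner ℝ w z.1 : ℝ)))
  have hBi : Integrable B D := by
    have : B = {z : E d × ℝ | |inner ℝ u z.1| * b ≤ |inner ℝ w z.1|}.indicator fun z => G z.1 := by
      ext z; simp [hB, Set.indicator_apply]
    rw [this]
    exact hGi.indicator hBset
  have hB0 : ∀ z, 0 ≤ B z := fun z => by
    simp only [hB]; split_ifs
    · exact hG0 _
    · exact le_rfl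
  have hbad : ∫ z, B z ∂D ≤ 64 * U * σ ^ 3 / b ^ 2 := by
    rw [integral_eq_lintegral_of_nonneg_ae (Filter.Eventually.of_forall hB0)
      hBi.aestronglyMeasurable]
    refine ENNReal.toReal_le_of_le_ofReal (by positivity) ?_
    refine le_trans ?_ (hwb.lintegral_wedge_le hU hu hw huw hσ hb)
    rw [← measurePreserving_fst_fst.lintegral_comp]
    swap
    · have h1 : Measurable fun x : E d => |(inner ℝ u x : ℝ)| :=
        (measurable_inner_right u).norm
      have h2 : Measurable fun x : E d => |(inner ℝ w x : ℝ)| :=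
        (measurable_inner_right w).norm
      exact (Measurable.ite (measurableSet_le (h1.mul_const b) h2) (by fun_prop)
        measurable_const).ennreal_ofReal
    refine lintegral_mono fun z => ?_
    apply ENNReal.ofReal_le_ofReal
    simp only [hB, hG]
    split_ifs
    · gcongr
      exact logistic_le _
    · exact le_rfl
  have hGyi : Integrable (fun z : E d × ℝ => G z.1 * (z.2 * halfspace v z.1)) D := by
    have := measurable_halfspace v
    refine hGi.mono' (Measurable.aestronglyMeasurable (by fun_prop)) ?_
    filter_upwards [hlab] with z hz
    rw [norm_mul, Real.norm_eq_abs, abs_of_nonneg (hG0 _)]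
    have : ‖z.2 * halfspace v z.1‖ = 1 := by
      rcases hz with h' | h' <;> rcases halfspace_eq_or v z.1 with h'' | h'' <;> rw [h', h''] <;>
        norm_num
    rw [this, mul_one]
  -- The derivative has `sign ⟨u,x⟩` where the noise condition speaks about `halfspace v`.
  -- Exchanging one for the other costs twice the wedge integral.
  have hmain : ∫ z, G z.1 * (z.2 * halfspace v z.1) ∂D - 2 * ∫ z, B z ∂D
      ≤ ∫ z, z.2 * logistic σ (inner ℝ w z.1) * inner ℝ u z.1 ∂D := by
    rw [← integral_const_mul, ← integral_sub hGyi (hBi.const_mul 2)]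
    refine integral_mono_ae (hGyi.sub (hBi.const_mul 2)) hI0 ?_
    filter_upwards [hlab] with z hz
    have h1 := label_mul_inner_ge (u := u) (w := w) (x := z.1) (b := b) ha hz
    rw [← hv] at h1
    have hl := logistic_pos σ (inner ℝ w z.1)
    have h2 := mul_le_mul_of_nonneg_left h1 hl.le
    calc _ = logistic σ (inner ℝ w z.1) * (z.2 * halfspace v z.1 * |inner ℝ u z.1| -
          2 * if |inner ℝ u z.1| * b ≤ |inner ℝ w z.1| then |inner ℝ u z.1| else 0) := by
          simp only [hG, hB]
          split_ifs <;> ring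
      _ ≤ _ := h2
      _ = _ := by ring
  have hfin := inner_lossGrad_of_orthogonal hwb hβ hσ hlab hd hw (u := u)
    (by rw [real_inner_comm, huw])
  have hcs := abs_real_inner_le_norm (lossGrad D σ w) u
  rw [hu, mul_one] at hcs
  have hcs2 := (neg_le_abs _).trans hcs
  rw [hfin] at hcs2
  refine le_trans ?_ hcs2
  have : L * R ^ 2 / 384 * (L * R * σ / 4 / A) ^ ((1 - α) / α) - 128 * U * σ ^ 2 / b ^ 2
      = 1 / σ * (1 / 2 * (L * R * σ / 4 / A) ^ ((1 - α) / α) * (R / 48) * (L * R * σ / 4)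
        - 2 * (64 * U * σ ^ 3 / b ^ 2)) := by
    field_simp; ring
  rw [this, neg_mul, neg_neg]
  gcongr
  linarith

/-- If the sine `b` of the angle is below `θ ≤ 1/2`, one of `± w` has small excess error. -/
lemma measure_disagreement_le (hwb : WellBehaved L R U β D.fst) (hU : 0 < U) {u w : E d}
    {a b θ r : ℝ} (hu : ‖u‖ = 1) (hw : ‖w‖ = 1) (huw : inner ℝ u w = 0) (hab : a ^ 2 + b ^ 2 = 1)
    (hb : 0 ≤ b) (hbθ : b ≤ θ) (hθ : θ ≤ 1 / 2) (hr : 0 < r) :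
    ∃ s : ℝ, (s = 1 ∨ s = -1) ∧
      D.fst.real {x | halfspace (s • w) x ≠ halfspace (a • w + b • u) x}
        ≤ Real.exp (1 - r / β) + 8 * U * θ * r ^ 2 := by
  -- Hence `|a| ≥ 1/2`, and the sign of `a` tells which of `± w` is close.
  have ha : 3 / 4 ≤ a ^ 2 := by nlinarith
  have hle : Real.exp (1 - r / β) + 8 * U * b * r ^ 2
      ≤ Real.exp (1 - r / β) + 8 * U * θ * r ^ 2 := by gcongr
  rcases le_total 0 a with h | h
  · refine ⟨1, Or.inl rfl, le_trans ?_ hle⟩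
    rw [one_smul]
    exact ENNReal.toReal_le_of_le_ofReal (by positivity)
      (hwb.measure_halfspace_ne_le hU hu hw huw (by nlinarith) hb hr)
  · refine ⟨-1, Or.inr rfl, le_trans ?_ hle⟩
    have e : a • w + b • u = (-a) • ((-1 : ℝ) • w) + b • u := by simp
    rw [e]
    exact ENNReal.toReal_le_of_le_ofReal (by positivity)
      (hwb.measure_halfspace_ne_le hU hu (by simpa using hw) (by simp [huw]) (by nlinarith) hb hr)

lemma err_sub_le (w v : E d) :
    err D w - err D v ≤ D.fst.real {x | halfspace w x ≠ halfspace v x} := by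
  have hm : MeasurableSet {x : E d | halfspace w x ≠ halfspace v x} :=
    (measurableSet_eq_fun (measurable_halfspace w) (measurable_halfspace v)).compl
  have h1 : D.fst.real {x | halfspace w x ≠ halfspace v x}
      = D.real {z | halfspace w z.1 ≠ halfspace v z.1} := by
    rw [measureReal_def, measureReal_def, Measure.fst_apply hm]
    rfl
  rw [h1, sub_le_iff_le_add']
  refine le_trans (measureReal_mono ?_) (measureReal_union_le _ _)
  intro z hz
  by_cases h : halfspace v z.1 = z.2
  · right
    intro h'
    exact hz (h'.trans h)
  · exact Or.inl h

end Stationary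

/-! ### Projected stochastic gradient descent -/

section PSGD

variable {d N : ℕ} {L R U β σ γ : ℝ} {D : Measure (E d × ℝ)}

/-- One step of projected gradient descent. -/
noncomputable def psgdStep (σ γ : ℝ) (w : E d) (z : Draw d) : E d :=
  ‖w - γ • (activeFO σ w z).1‖⁻¹ • (w - γ • (activeFO σ w z).1)

lemma psgdIterate_succ {i : ℕ} (hi : i < N) (ω : Fin N → Draw d) :
    psgdIterate σ γ ω (i + 1) = psgdStep σ γ (psgdIterate σ γ ω i) (ω ⟨i, hi⟩) := by
  rw [psgdIterate, dif_pos hi]; rfl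

/-- Adaptedness: the `i`-th iterate depends only on draws with index below `i`. -/
lemma psgdIterate_update {i : ℕ} {j : Fin N} (hij : i ≤ j) (ω : Fin N → Draw d) (z : Draw d) :
    psgdIterate σ γ (Function.update ω j z) i = psgdIterate σ γ ω i := by
  induction i with
  | zero => rfl
  | succ i ih =>
    have hi : i < N := lt_of_lt_of_le (Nat.lt_of_succ_le hij) j.2.le
    rw [psgdIterate_succ hi, psgdIterate_succ hi, ih (by omega), Function.update_of_ne]
    intro h
    rw [← h] at hij
    simp at hij

lemma psgdIterate_update_succ {i : ℕ} (hi : i < N) (ω : Fin N → Draw d) (z : Draw d) :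
    psgdIterate σ γ (Function.update ω ⟨i, hi⟩ z) (i + 1)
      = psgdStep σ γ (psgdIterate σ γ ω i) z := by
  rw [psgdIterate_succ hi, psgdIterate_update le_rfl, Function.update_self]

lemma norm_e₁ (hd : 0 < d) : ‖e₁ d‖ = 1 := by
  have : e₁ d = EuclideanSpace.single ⟨0, hd⟩ (1 : ℝ) := by
    ext i
    simp [e₁, Fin.ext_iff]
  rw [this]; simp

/-- The oracle's answer is orthogonal to `w`, so the unnormalized step has inner product 1 with `w`
and cannot vanish. -/
lemma norm_psgdStep {w : E d} (hw : ‖w‖ = 1) (z : Draw d) : ‖psgdStep σ γ w z‖ = 1 := by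
  refine norm_smul_inv_norm fun h => ?_
  have h1 : inner ℝ (w - γ • (activeFO σ w z).1) w = 1 := by
    rw [inner_sub_left, inner_smul_left, inner_activeFO_self hw, real_inner_self_eq_norm_sq, hw]
    simp
  rw [h, inner_zero_left] at h1
  exact zero_ne_one h1

lemma norm_psgdIterate (hd : 0 < d) (ω : Fin N → Draw d) (i : ℕ) :
    ‖psgdIterate σ γ ω i‖ = 1 := by
  induction i with
  | zero => exact norm_e₁ hd
  | succ i ih =>
    by_cases hi : i < N
    · rw [psgdIterate_succ hi]; exact norm_psgdStep ih _
    · rw [psgdIterate, dif_neg hi]; exact ih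

lemma measurable_psgdStep (σ γ : ℝ) :
    Measurable fun p : E d × Draw d => psgdStep σ γ p.1 p.2 := by
  have h := (measurable_activeFO (d := d) σ).fst
  have h2 : Measurable fun p : E d × Draw d => p.1 - γ • (activeFO σ p.1 p.2).1 :=
    measurable_fst.sub (h.const_smul γ)
  exact h2.norm.inv.smul h2

lemma measurable_psgdIterate (σ γ : ℝ) (i : ℕ) :
    Measurable fun ω : Fin N → Draw d => psgdIterate σ γ ω i := by
  induction i with
  | zero => exact measurable_const
  | succ i ih =>
    by_cases hi : i < N
    · simp_rw [psgdIterate_succ hi]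
      exact Measurable.comp (g := fun p : E d × Draw d => psgdStep σ γ p.1 p.2)
        (f := fun ω : Fin N → Draw d => (psgdIterate σ γ ω i, ω ⟨i, hi⟩))
        (measurable_psgdStep σ γ) (ih.prodMk (measurable_pi_apply _))
    · simp_rw [psgdIterate, dif_neg hi]; exact ih

lemma measurable_psgdIterate_index (σ γ : ℝ) :
    Measurable fun p : (Fin N → Draw d) × Fin N => psgdIterate σ γ p.1 p.2 :=
  measurable_from_prod_countable_left fun i => measurable_psgdIterate σ γ i

variable [IsProbabilityMeasure D]

lemma measurable_smoothLoss (D : Measure (E d × ℝ)) [IsProbabilityMeasure D] (σ : ℝ) :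
    Measurable (smoothLoss D σ) := by
  have h1 := (continuous_softmaxLoss σ).measurable
  have h2 : Measurable fun p : E d × (E d × ℝ) =>
      p.2.2 * softmaxLoss σ (inner ℝ p.1 p.2.1) := by fun_prop
  exact (h2.stronglyMeasurable.integral_prod_right' (ν := D)).measurable

lemma measurable_lossGrad (D : Measure (E d × ℝ)) [IsProbabilityMeasure D] (σ : ℝ) :
    Measurable (lossGrad D σ) :=
  ((measurable_activeFO (d := d) σ).fst.stronglyMeasurable.integral_prod_right'
    (ν := drawLaw D)).measurable

/-- The variance bound of the stochastic gradient. -/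
noncomputable def varianceBound (d : ℕ) (U β σ : ℝ) : ℝ := d * stripBound U β σ / σ ^ 2

variable (hwb : WellBehaved L R U β D.fst) (hU : 0 < U) (hβ : 0 < β) (hσ : 0 < σ)
  (hσ1 : 1 ≤ Real.log (1 / σ)) (hlab : BinaryLabels D) (hd : 2 ≤ d) (hγ : 0 < γ)

include hwb hU hβ hσ hσ1 hlab in
lemma integrable_norm_sq_activeFO {w : E d} (hw : ‖w‖ = 1) :
    Integrable (fun z => ‖(activeFO σ w z).1‖ ^ 2) (drawLaw D) ∧
      ∫ z, ‖(activeFO σ w z).1‖ ^ 2 ∂(drawLaw D) ≤ varianceBound d U β σ := by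
  have h1 := lintegral_norm_sq_activeFO_le hwb hU hβ hσ hσ1 hlab hw
  have hm : Measurable fun z => ‖(activeFO σ w z).1‖ ^ 2 :=
    (measurable_activeFO_left σ w).fst.norm.pow_const 2
  have hpos : ∀ z, 0 ≤ ‖(activeFO σ w z).1‖ ^ 2 := fun z => by positivity
  have hV : 0 ≤ varianceBound d U β σ := by
    have := stripBound_pos hU hβ hσ hσ1
    unfold varianceBound; positivity
  refine ⟨⟨hm.aestronglyMeasurable, ?_⟩, ?_⟩
  · rw [hasFiniteIntegral_iff_ofReal (Filter.Eventually.of_forall hpos)]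
    exact h1.trans_lt ENNReal.ofReal_lt_top
  · rw [integral_eq_lintegral_of_nonneg_ae (Filter.Eventually.of_forall hpos)
      hm.aestronglyMeasurable]
    exact ENNReal.toReal_le_of_le_ofReal hV h1

include hwb hU hβ hσ hσ1 hlab hd hγ in
/-- Expected decrease of the smoothed loss in one step. -/
lemma integral_smoothLoss_psgdStep_le {w : E d} (hw : ‖w‖ = 1) :
    ∫ z, smoothLoss D σ (psgdStep σ γ w z) ∂(drawLaw D)
      ≤ smoothLoss D σ w - γ * ‖lossGrad D σ w‖ ^ 2
        + smoothnessBound U β σ * γ ^ 2 * varianceBound d U β σ := by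
  obtain ⟨hi, hv⟩ := integrable_norm_sq_activeFO hwb hU hβ hσ hσ1 hlab hw
  have hQ := stripBound_pos hU hβ hσ hσ1
  have hK : 0 ≤ smoothnessBound U β σ := by unfold smoothnessBound; positivity
  have hg := integrable_activeFO hwb hβ hσ hlab hd hw
  have h1 : Integrable (fun z => smoothLoss D σ (psgdStep σ γ w z)) (drawLaw D) :=
    Integrable.of_bound ((measurable_smoothLoss D σ).comp
      ((measurable_psgdStep σ γ).comp measurable_prodMk_left)).aestronglyMeasurable 1
      (Filter.Eventually.of_forall fun z => abs_smoothLoss_le hlab _)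
  have h2 : Integrable (fun z => smoothLoss D σ w
      - γ * inner ℝ (lossGrad D σ w) (activeFO σ w z).1) (drawLaw D) :=
    (integrable_const _).sub ((hg.const_inner _).const_mul γ)
  calc _ ≤ ∫ z, (smoothLoss D σ w - γ * inner ℝ (lossGrad D σ w) (activeFO σ w z).1
        + smoothnessBound U β σ * γ ^ 2 * ‖(activeFO σ w z).1‖ ^ 2) ∂(drawLaw D) :=
        integral_mono h1 (h2.add (hi.const_mul _)) fun z =>
          smoothLoss_step_le hwb hU hβ hσ hσ1 hlab hd hw hγ (inner_activeFO_self hw σ z)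
    _ ≤ _ := by
        rw [integral_add h2 (hi.const_mul _), integral_sub (integrable_const _)
          ((hg.const_inner _).const_mul γ), integral_const_mul, integral_const_mul,
          integral_inner hg, ← lossGrad, real_inner_self_eq_norm_sq]
        simp only [integral_const, probReal_univ, one_smul]
        gcongr

include hwb hU hβ hσ hσ1 hlab hd hγ in
/-- The expected squared gradient norms along the trajectory. -/
lemma lintegral_sum_norm_sq_lossGrad_le :
    ∫⁻ ω, ∑ j : Fin N, ENNReal.ofReal (‖lossGrad D σ (psgdIterate σ γ ω j)‖ ^ 2)
        ∂(Measure.pi fun _ : Fin N => drawLaw D)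
      ≤ ENNReal.ofReal ((2 + N * (smoothnessBound U β σ * γ ^ 2 * varianceBound d U β σ)) / γ) := by
  have hQ := stripBound_pos hU hβ hσ hσ1
  set e := smoothnessBound U β σ * γ ^ 2 * varianceBound d U β σ with he
  have he0 : 0 ≤ e := by rw [he]; unfold smoothnessBound varianceBound; positivity
  have hLge : ∀ w : E d, 0 ≤ smoothLoss D σ w + 1 := fun w => by
    have := (abs_le.1 (abs_smoothLoss_le (σ := σ) hlab w)).1; linarith
  set H : E d → ℝ≥0∞ := fun w => ENNReal.ofReal (γ * ‖lossGrad D σ w‖ ^ 2) with hH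
  have hHm : Measurable H := (((measurable_lossGrad D σ).norm.pow_const 2).const_mul γ).ennreal_ofReal
  set Φ : E d → ℝ≥0∞ := fun w => ENNReal.ofReal (smoothLoss D σ w + 1) with hΦ
  have hΦm : Measurable Φ := ((measurable_smoothLoss D σ).add_const 1).ennreal_ofReal
  -- The potential is the shifted loss plus the decrease promised so far. Its conditional mean grows
  -- by at most the second-order error `e` in each step. The shift by 1 keeps it nonnegative and is
  -- the reason for the bound 2 at the start.
  set F : ℕ → (Fin N → Draw d) → ℝ≥0∞ := fun i ω =>
    Φ (psgdIterate σ γ ω i) + partialSum (fun j : Fin N => H (psgdIterate σ γ ω j)) i with hF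
  have hFm : ∀ i, Measurable (F i) := fun i =>
    (hΦm.comp (measurable_psgdIterate σ γ i)).add
      (measurable_partialSum (fun j => hHm.comp (measurable_psgdIterate σ γ j)) i)
  have key := lintegral_le_add_of_step (drawLaw D) hFm (ENNReal.ofReal e) (by
    intro i hi ω
    set w := psgdIterate σ γ ω i with hw
    have hw1 : ‖w‖ = 1 := norm_psgdIterate (by omega) ω i
    have e1 : ∀ z, F (i + 1) (Function.update ω ⟨i, hi⟩ z) = Φ (psgdStep σ γ w z)
        + (partialSum (fun j : Fin N => H (psgdIterate σ γ ω j)) i + H w) := by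
      intro z
      simp only [hF]
      rw [psgdIterate_update_succ hi, partialSum_succ _ hi, psgdIterate_update le_rfl]
      congr 2
      refine partialSum_congr fun j hj => ?_
      rw [psgdIterate_update hj.le]
    simp_rw [e1]
    have h1 : Integrable (fun z => smoothLoss D σ (psgdStep σ γ w z)) (drawLaw D) :=
      Integrable.of_bound ((measurable_smoothLoss D σ).comp
        ((measurable_psgdStep σ γ).comp measurable_prodMk_left)).aestronglyMeasurable 1
        (Filter.Eventually.of_forall fun z => abs_smoothLoss_le hlab _)
    have h2 : ∫⁻ z, Φ (psgdStep σ γ w z) ∂(drawLaw D)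
        = ENNReal.ofReal (∫ z, smoothLoss D σ (psgdStep σ γ w z) ∂(drawLaw D) + 1) := by
      have h3 : Integrable (fun z => smoothLoss D σ (psgdStep σ γ w z) + 1) (drawLaw D) :=
        h1.add (integrable_const 1)
      simp only [hΦ]
      rw [← ofReal_integral_eq_lintegral_ofReal h3
        (Filter.Eventually.of_forall fun z => hLge _), integral_add h1 (integrable_const 1)]
      simp
    have h4 := integral_smoothLoss_psgdStep_le hwb hU hβ hσ hσ1 hlab hd hγ hw1
    rw [lintegral_add_right _ measurable_const, h2]
    simp only [lintegral_const, measure_univ, mul_one, hF]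
    rw [← hw, add_left_comm]
    calc _ = partialSum (fun j : Fin N => H (psgdIterate σ γ ω j)) i
          + (ENNReal.ofReal (∫ z, smoothLoss D σ (psgdStep σ γ w z) ∂(drawLaw D) + 1) + H w) := rfl
      _ ≤ partialSum (fun j : Fin N => H (psgdIterate σ γ ω j)) i
          + (Φ w + ENNReal.ofReal e) := by
        refine add_le_add le_rfl ?_
        simp only [hH, hΦ]
        rw [← ENNReal.ofReal_add (hLge w) he0]
        have h5 : 0 ≤ ∫ z, smoothLoss D σ (psgdStep σ γ w z) ∂(drawLaw D) + 1 := by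
          have : |∫ z, smoothLoss D σ (psgdStep σ γ w z) ∂(drawLaw D)| ≤ 1 := by
            have := norm_integral_le_of_norm_le_const (μ := drawLaw D)
              (f := fun z => smoothLoss D σ (psgdStep σ γ w z)) (C := 1)
              (Filter.Eventually.of_forall fun z =>
                abs_smoothLoss_le (σ := σ) hlab (psgdStep σ γ w z))
            simpa using this
          linarith [(abs_le.1 this).1]
        rw [← ENNReal.ofReal_add h5 (by positivity)]
        apply ENNReal.ofReal_le_ofReal
        linarith
      _ = _ := by abel) N le_rfl
  have hF0 : ∫⁻ ω, F 0 ω ∂(Measure.pi fun _ : Fin N => drawLaw D) ≤ ENNReal.ofReal 2 := by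
    calc _ ≤ ∫⁻ _, ENNReal.ofReal 2 ∂(Measure.pi fun _ : Fin N => drawLaw D) := by
          refine lintegral_mono fun ω => ?_
          simp only [hF, partialSum_zero, add_zero, hΦ]
          apply ENNReal.ofReal_le_ofReal
          have := (abs_le.1 (abs_smoothLoss_le (σ := σ) hlab (psgdIterate σ γ ω 0))).2
          linarith
      _ = _ := by simp
  have h6 : ENNReal.ofReal γ * ∫⁻ ω, ∑ j : Fin N,
      ENNReal.ofReal (‖lossGrad D σ (psgdIterate σ γ ω j)‖ ^ 2)
        ∂(Measure.pi fun _ : Fin N => drawLaw D) ≤ ENNReal.ofReal (2 + N * e) := by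
    calc _ ≤ ∫⁻ ω, F N ω ∂(Measure.pi fun _ : Fin N => drawLaw D) := by
          rw [← lintegral_const_mul' _ _ ENNReal.ofReal_ne_top]
          refine lintegral_mono fun ω => ?_
          simp only [hF, partialSum_full, Finset.mul_sum]
          refine le_add_left (le_of_eq (Finset.sum_congr rfl fun j _ => ?_))
          exact (ENNReal.ofReal_mul hγ.le).symm
      _ ≤ _ := key
      _ ≤ ENNReal.ofReal 2 + N * ENNReal.ofReal e := by gcongr
      _ = _ := by
          rw [ENNReal.ofReal_add (by norm_num) (mul_nonneg (Nat.cast_nonneg N) he0),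
            ENNReal.ofReal_mul (p := (N : ℝ)) (Nat.cast_nonneg N), ENNReal.ofReal_natCast]
  rw [ENNReal.ofReal_div_of_pos hγ, ENNReal.le_div_iff_mul_le (by simp [hγ]) (by simp), mul_comm]
  exact h6

lemma lintegral_uniformOn_univ (hN : 0 < N) (f : Fin N → ℝ≥0∞) :
    ∫⁻ i, f i ∂(uniformOn (Set.univ : Set (Fin N))) = ENNReal.ofReal (1 / N) * ∑ i, f i := by
  rw [uniformOn, ProbabilityTheory.cond, lintegral_smul_measure, Measure.restrict_univ, lintegral_count,
    tsum_fintype, Measure.count_univ]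
  simp only [ENat.card_eq_coe_fintype_card, Fintype.card_fin, smul_eq_mul]
  congr 1
  rw [one_div, ENNReal.ofReal_inv_of_pos (by exact_mod_cast hN), ENNReal.ofReal_natCast]
  rfl

include hwb hU hβ hσ hσ1 hlab hd hγ in
/-- A single trial finds an approximate stationary point with probability at least one half. -/
lemma measure_trial_fails_le (hN : 0 < N) {ρ : ℝ} (hρ : 0 < ρ)
    (hnum : (2 + N * (smoothnessBound U β σ * γ ^ 2 * varianceBound d U β σ)) / (γ * N)
      ≤ ρ ^ 2 / 32) :
    ((Measure.pi fun _ : Fin N => drawLaw D).prod (uniformOn (Set.univ : Set (Fin N))))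
      {p | ρ / 4 ≤ ‖lossGrad D σ (psgdIterate σ γ p.1 p.2)‖} ≤ ENNReal.ofReal (1 / 2) := by
  have : Nonempty (Fin N) := ⟨⟨0, hN⟩⟩
  have hN' : (0 : ℝ) < N := by exact_mod_cast hN
  set f : (Fin N → Draw d) × Fin N → ℝ≥0∞ := fun p =>
    ENNReal.ofReal (‖lossGrad D σ (psgdIterate σ γ p.1 p.2)‖ ^ 2) with hf
  have hfm : Measurable f :=
    (((measurable_lossGrad D σ).comp (measurable_psgdIterate_index σ γ)).norm.pow_const
      2).ennreal_ofReal
  have h1 : ∫⁻ p, f p ∂((Measure.pi fun _ : Fin N => drawLaw D).prod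
      (uniformOn (Set.univ : Set (Fin N)))) ≤ ENNReal.ofReal (ρ ^ 2 / 32) := by
    rw [lintegral_prod _ hfm.aemeasurable]
    simp_rw [lintegral_uniformOn_univ hN]
    rw [lintegral_const_mul' _ _ ENNReal.ofReal_ne_top]
    refine (mul_le_mul' le_rfl
      (lintegral_sum_norm_sq_lossGrad_le hwb hU hβ hσ hσ1 hlab hd hγ)).trans ?_
    rw [← ENNReal.ofReal_mul (by positivity)]
    apply ENNReal.ofReal_le_ofReal
    refine le_trans (le_of_eq ?_) hnum
    field_simp
  have h2 : {p : (Fin N → Draw d) × Fin N | ρ / 4 ≤ ‖lossGrad D σ (psgdIterate σ γ p.1 p.2)‖}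
      ⊆ {p | ENNReal.ofReal (ρ ^ 2 / 16) ≤ f p} := by
    intro p hp
    apply ENNReal.ofReal_le_ofReal
    have hp' : ρ / 4 ≤ ‖lossGrad D σ (psgdIterate σ γ p.1 p.2)‖ := hp
    calc ρ ^ 2 / 16 = (ρ / 4) ^ 2 := by ring
      _ ≤ _ := by gcongr
  -- Markov's inequality for the squared norm: mean at most `ρ²/32` against the level `(ρ/4)² =
  -- ρ²/16`.
  refine (measure_mono h2).trans ((meas_ge_le_lintegral_div hfm.aemeasurable
    (by simp; positivity) ENNReal.ofReal_ne_top).trans ?_)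
  refine (ENNReal.div_le_div_right h1 _).trans ?_
  rw [← ENNReal.ofReal_div_of_pos (by positivity)]
  apply ENNReal.ofReal_le_ofReal
  apply le_of_eq
  field_simp
  norm_num

/-- Events of independent trials. -/
lemma measure_forall_prod_le {S : ℕ} {X Y : Type*} [MeasurableSpace X] [MeasurableSpace Y]
    (μ : Measure X) (ν : Measure Y) [IsProbabilityMeasure μ] [IsProbabilityMeasure ν]
    {B : Set (X × Y)} (hB : MeasurableSet B) :
    ((Measure.pi fun _ : Fin S => μ).prod (Measure.pi fun _ : Fin S => ν))
      {p | ∀ s, (p.1 s, p.2 s) ∈ B} = (μ.prod ν B) ^ S := by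
  have h := measurePreserving_arrowProdEquivProdArrow X Y (Fin S) (fun _ => μ) (fun _ => ν)
  have hm : MeasurableSet {p : (Fin S → X) × (Fin S → Y) | ∀ s, (p.1 s, p.2 s) ∈ B} := by
    rw [Set.ofPred_forall]
    exact MeasurableSet.iInter fun s =>
      (((measurable_pi_apply s).comp measurable_fst).prodMk
        ((measurable_pi_apply s).comp measurable_snd)) hB
  rw [← h.measure_preimage hm.nullMeasurableSet]
  have e : (MeasurableEquiv.arrowProdEquivProdArrow X Y (Fin S)) ⁻¹'
      {p | ∀ s, (p.1 s, p.2 s) ∈ B} = Set.univ.pi fun _ => B := by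
    ext f
    simp [MeasurableEquiv.arrowProdEquivProdArrow, Equiv.arrowProdEquivProdArrow]
  rw [e, Measure.pi_pi]
  simp

end PSGD

section Estimates

variable {d : ℕ} {L R U β σ : ℝ} {D : Measure (E d × ℝ)} [IsProbabilityMeasure D]

/-! ### Accuracy of averaged gradients -/

lemma cosh_ge_tangent (b c : ℝ) : Real.cosh c + Real.sinh c * (b - c) ≤ Real.cosh b := by
  have h1 := Real.add_one_le_exp (b - c)
  have h2 := Real.add_one_le_exp (-(b - c))
  have e1 : Real.exp b = Real.exp c * Real.exp (b - c) := by rw [← Real.exp_add]; congr 1; ring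
  have e2 : Real.exp (-b) = Real.exp (-c) * Real.exp (-(b - c)) := by
    rw [← Real.exp_add]; congr 1; ring
  have h3 := mul_le_mul_of_nonneg_left h1 (Real.exp_pos c).le
  have h4 := mul_le_mul_of_nonneg_left h2 (Real.exp_pos (-c)).le
  rw [Real.cosh_eq, Real.cosh_eq, Real.sinh_eq, e1, e2]
  linarith

lemma cosh_le_of_le {a b : ℝ} (ha : 0 ≤ a) (hab : a ≤ b) : Real.cosh a ≤ Real.cosh b :=
  Real.cosh_le_cosh.2 (by rwa [abs_of_nonneg ha, abs_of_nonneg (ha.trans hab)])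

/-- Centring at most doubles the scale of the exponential moment of a random vector. -/
lemma integral_cosh_centred_le {Ω H : Type*} [MeasurableSpace Ω] [NormedAddCommGroup H]
    [InnerProductSpace ℝ H] [CompleteSpace H] {μ : Measure Ω} [IsProbabilityMeasure μ] {g : Ω → H}
    (hg : Integrable g μ) {l : ℝ} (hl : 0 ≤ l)
    (hc : Integrable (fun z => Real.cosh (2 * l * ‖g z‖)) μ) :
    Integrable (fun z => Real.cosh ‖l • (g z - ∫ z, g z ∂μ)‖) μ ∧
      ∫ z, (Real.cosh ‖l • (g z - ∫ z, g z ∂μ)‖ - 1) ∂μ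
        ≤ ∫ z, (Real.cosh (2 * l * ‖g z‖) - 1) ∂μ := by
  set G := ∫ z, g z ∂μ with hG
  -- Jensen's inequality, through the tangent of `cosh` at the mean `b` of `2 l ‖g‖`.
  have hJ : Real.cosh (2 * l * ‖G‖) ≤ ∫ z, Real.cosh (2 * l * ‖g z‖) ∂μ := by
    set b := ∫ z, 2 * l * ‖g z‖ ∂μ with hb
    have hn : Integrable (fun z => 2 * l * ‖g z‖) μ := hg.norm.const_mul _
    have h1 : 2 * l * ‖G‖ ≤ b := by
      rw [hb, integral_const_mul]
      exact mul_le_mul_of_nonneg_left (norm_integral_le_integral_norm _) (by positivity)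
    refine (cosh_le_of_le (by positivity) h1).trans ?_
    have h2 : Integrable (fun z => Real.cosh b + Real.sinh b * (2 * l * ‖g z‖ - b)) μ :=
      (integrable_const _).add ((hn.sub (integrable_const _)).const_mul _)
    have h3 := integral_mono h2 hc fun z => cosh_ge_tangent (2 * l * ‖g z‖) b
    have h4 : Integrable (fun z => Real.sinh b * (2 * l * ‖g z‖ - b)) μ :=
      (hn.sub (integrable_const _)).const_mul _
    rw [integral_add (integrable_const _) h4, integral_const_mul, integral_sub hn (integrable_const _), ← hb] at h3
    simpa using h3
  have hpt : ∀ z, Real.cosh ‖l • (g z - G)‖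
      ≤ 1 / 2 * Real.cosh (2 * l * ‖g z‖) + 1 / 2 * Real.cosh (2 * l * ‖G‖) := by
    intro z
    have h1 : ‖l • (g z - G)‖ ≤ (2 * l * ‖g z‖ + 2 * l * ‖G‖) / 2 := by
      rw [norm_smul, Real.norm_eq_abs, abs_of_nonneg hl]
      have := mul_le_mul_of_nonneg_left (norm_sub_le (g z) G) hl
      linarith
    refine (cosh_le_of_le (norm_nonneg _) h1).trans ?_
    have := cosh_le_sum_mul_cosh (Finset.univ : Finset (Fin 2)) ![1 / 2, 1 / 2]
      ![2 * l * ‖g z‖, 2 * l * ‖G‖] ((2 * l * ‖g z‖ + 2 * l * ‖G‖) / 2)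
      (by intro i _; fin_cases i <;> simp) (by simp; norm_num) (by
        simp only [Fin.sum_univ_two, Matrix.cons_val_zero, Matrix.cons_val_one]
        nlinarith [sq_nonneg (2 * l * ‖g z‖ - 2 * l * ‖G‖)])
    simpa using this
  have hI2 : Integrable (fun z => 1 / 2 * Real.cosh (2 * l * ‖g z‖)
      + 1 / 2 * Real.cosh (2 * l * ‖G‖)) μ := (hc.const_mul _).add (integrable_const _)
  have hm : AEStronglyMeasurable (fun z => Real.cosh ‖l • (g z - G)‖) μ :=
    Real.continuous_cosh.comp_aestronglyMeasurable
      ((hg.1.sub aestronglyMeasurable_const).const_smul l).norm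
  have hI1 : Integrable (fun z => Real.cosh ‖l • (g z - G)‖) μ := by
    refine hI2.mono' hm (Filter.Eventually.of_forall fun z => ?_)
    rw [Real.norm_eq_abs, abs_of_pos (Real.cosh_pos _)]
    exact hpt z
  refine ⟨hI1, ?_⟩
  have h5 := integral_mono hI1 hI2 hpt
  rw [integral_add (hc.const_mul _) (integrable_const _), integral_const_mul] at h5
  rw [integral_sub hI1 (integrable_const _), integral_sub hc (integrable_const _)]
  simp only [integral_const, probReal_univ, one_smul] at h5 ⊢
  linarith

variable (hwb : WellBehaved L R U β D.fst) (hU : 0 < U) (hβ : 0 < β) (hσ : 0 < σ)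
  (hσ1 : 1 ≤ Real.log (1 / σ)) (hlab : BinaryLabels D) (hd : 2 ≤ d) {w : E d} (hw : ‖w‖ = 1)

include hwb hβ hσ hlab hd hw in
-- The coin is ignored: the oracle's answer is dominated by `‖x‖/σ` almost surely, and the
-- exponential moments of `‖x‖/√d` feed the Bernstein-type bound.
lemma measure_avgGrad_far_le {M : ℕ} (hM : 0 < M) {ρ : ℝ} (hρ : 0 < ρ)
    (hσρ : σ * ρ ≤ 192 * β * √d) :
    (Measure.pi fun _ : Fin M => drawLaw D)
      {η | ρ / 4 ≤ ‖(1 / (M : ℝ)) • ∑ i, (activeFO σ w (η i)).1 - lossGrad D σ w‖}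
      ≤ ENNReal.ofReal (2 * Real.exp (-(M * (σ ^ 2 * ρ ^ 2 / (6144 * β ^ 2 * d))))) := by
  have hd' : (0 : ℝ) < d := by exact_mod_cast (by omega : 0 < d)
  have hM' : (0 : ℝ) < M := by exact_mod_cast hM
  have hsd : 0 < √(d : ℝ) := Real.sqrt_pos.2 hd'
  have hsd2 : √(d : ℝ) ^ 2 = d := Real.sq_sqrt hd'.le
  set G := lossGrad D σ w with hG
  -- This `l` minimizes the exponent `96 l² β² d / σ² - l ρ / 4` per sample. The condition `hσρ`
  -- keeps it in the range where the quadratic moment bound is available.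
  set l := σ ^ 2 * ρ / (768 * β ^ 2 * d) with hl
  have hl0 : 0 < l := by positivity
  set c := 2 * l / σ with hcdef
  have hc0 : 0 ≤ c := by positivity
  have hceq : c * (2 * β * √d) = σ * ρ / (192 * β * √d) := by
    have e : 1 / √(d : ℝ) = √d / d := by rw [div_eq_div_iff hsd.ne' hd'.ne']; linarith
    calc c * (2 * β * √d) = σ * ρ / (192 * β) * (√d / d) := by
          rw [hcdef, hl]; field_simp; ring
      _ = _ := by rw [← e]; field_simp
  have hc1 : c ≤ 1 / (2 * β * √d) := by
    rw [le_div_iff₀ (by positivity), hceq, div_le_one (by positivity)]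
    exact hσρ
  obtain ⟨hcI, hcv⟩ := integrable_cosh_norm hwb hβ hlab hd hc0 hc1
  have hg := integrable_activeFO hwb hβ hσ hlab hd hw
  have hgm : Measurable fun z => (activeFO σ w z).1 := (measurable_activeFO_left σ w).fst
  have hdom : ∀ z : Draw d, Real.cosh (2 * l * ‖(activeFO σ w z).1‖)
      ≤ Real.cosh (c * (|z.1.2| * ‖z.1.1‖)) := by
    intro z
    refine cosh_le_of_le (by positivity) ?_
    calc 2 * l * ‖(activeFO σ w z).1‖ ≤ 2 * l * (1 / σ * |z.1.2| * ‖z.1.1‖) := by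
          gcongr; exact norm_activeFO_le hw hσ z
      _ = _ := by rw [hcdef]; ring
  have hcomp : Integrable (fun z : Draw d => Real.cosh (c * (|z.1.2| * ‖z.1.1‖))) (drawLaw D) :=
    (measurePreserving_fst_drawLaw (D := D)).integrable_comp_of_integrable hcI
  have hIg : Integrable (fun z => Real.cosh (2 * l * ‖(activeFO σ w z).1‖)) (drawLaw D) := by
    refine hcomp.mono' (Real.continuous_cosh.measurable.comp
      (hgm.norm.const_mul _)).aestronglyMeasurable (Filter.Eventually.of_forall fun z => ?_)
    rw [Real.norm_eq_abs, abs_of_pos (Real.cosh_pos _)]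
    exact hdom z
  obtain ⟨hX1, hX2⟩ := integral_cosh_centred_le hg hl0.le hIg
  have hv : ∫ z, (Real.cosh ‖l • ((activeFO σ w z).1 - G)‖ - 1) ∂(drawLaw D)
      ≤ 3 * (σ * ρ / (192 * β * √d)) ^ 2 := by
    rw [← hceq]
    refine hX2.trans (le_trans ?_ hcv)
    have h1 : ∫ z : Draw d, (Real.cosh (c * (|z.1.2| * ‖z.1.1‖)) - 1) ∂(drawLaw D)
        = ∫ z, (Real.cosh (c * (|z.2| * ‖z.1‖)) - 1) ∂D := by
      have := integral_map (μ := drawLaw D) (φ := Prod.fst) measurable_fst.aemeasurable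
        (f := fun z : E d × ℝ => Real.cosh (c * (|z.2| * ‖z.1‖)) - 1) (by
          rw [(measurePreserving_fst_drawLaw (D := D)).map_eq]
          exact (hcI.sub (integrable_const 1)).1)
      rw [(measurePreserving_fst_drawLaw (D := D)).map_eq] at this
      exact this.symm
    rw [← h1]
    exact integral_mono (hIg.sub (integrable_const 1)) (hcomp.sub (integrable_const 1))
      fun z => sub_le_sub_right (hdom z) 1
  have htail := measure_norm_sum_ge_le (N := M) (drawLaw D) ((hgm.sub_const G).const_smul l)
    ((hg.sub (integrable_const G)).smul l) (by
      simp only [Pi.smul_apply]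
      rw [integral_smul, integral_sub hg (integrable_const G)]
      simp [hG, lossGrad]) hX1 hv (l * M * ρ / 4)
  refine le_trans (measure_mono fun η hη => ?_) (htail.trans (ENNReal.ofReal_le_ofReal ?_))
  · have hη' : ρ / 4 ≤ ‖(1 / (M : ℝ)) • ∑ i, (activeFO σ w (η i)).1 - G‖ := hη
    have e : ∑ i, l • ((activeFO σ w (η i)).1 - G)
        = (l * M) • ((1 / (M : ℝ)) • ∑ i, (activeFO σ w (η i)).1 - G) := by
      rw [← Finset.smul_sum, Finset.sum_sub_distrib, Finset.sum_const, Finset.card_univ,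
        Fintype.card_fin, mul_smul, smul_sub (M : ℝ), smul_smul (M : ℝ), mul_one_div_cancel hM'.ne',
        one_smul, Nat.cast_smul_eq_nsmul]
    change l * M * ρ / 4 ≤ ‖∑ i, l • ((activeFO σ w (η i)).1 - G)‖
    rw [e, norm_smul, Real.norm_eq_abs, abs_of_pos (by positivity)]
    calc l * M * ρ / 4 = l * M * (ρ / 4) := by ring
      _ ≤ _ := by gcongr
  · gcongr
    apply le_of_eq
    rw [hl, div_pow, mul_pow, mul_pow, hsd2]
    field_simp
    ring

/-! ### Numbers of label queries -/

include hwb hU hβ hσ hσ1 hd in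
-- The query probability is bounded uniformly over unit vectors, hence also conditionally on the
-- past of the adaptive trajectory.
lemma measure_psgdQueries_ge_le {N : ℕ} (γ t : ℝ) :
    (Measure.pi fun _ : Fin N => drawLaw D)
      {ω | 2 * stripBound U β σ * N + t ≤ (psgdQueries σ γ ω : ℝ)}
      ≤ ENNReal.ofReal (Real.exp (-t)) := by
  refine measure_sum_nat_ge_le (drawLaw D)
    (Z := fun i ω => (activeFO σ (psgdIterate σ γ ω i) (ω i)).2) (fun i => ?_)
    (fun i ω => activeFO_snd_le_one _ _ _) (fun i j ω z hij => ?_)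
    (stripBound_pos hU hβ hσ hσ1).le (fun i ω => ?_) t
  · exact Measurable.comp (g := fun p : E d × Draw d => (activeFO σ p.1 p.2).2)
      (f := fun ω : Fin N → Draw d => (psgdIterate σ γ ω i, ω i))
      (measurable_activeFO σ).snd ((measurable_psgdIterate σ γ i).prodMk (measurable_pi_apply i))
  · rw [psgdIterate_update hij.le, Function.update_of_ne hij.ne]
  · simp only [psgdIterate_update le_rfl, Function.update_self]
    exact drawLaw_query_le hwb hU hβ hσ hσ1 hd (norm_psgdIterate (by omega) ω i)

include hwb hU hβ hσ hσ1 hd hw in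
lemma measure_avgQueries_ge_le {M : ℕ} (t : ℝ) :
    (Measure.pi fun _ : Fin M => drawLaw D)
      {η | 2 * stripBound U β σ * M + t ≤ ((∑ i, (activeFO σ w (η i)).2 : ℕ) : ℝ)}
      ≤ ENNReal.ofReal (Real.exp (-t)) := by
  refine measure_sum_nat_ge_le (drawLaw D)
    (Z := fun i η => (activeFO σ w (η i)).2) (fun i => ?_)
    (fun i ω => activeFO_snd_le_one _ _ _) (fun i j ω z hij => ?_)
    (stripBound_pos hU hβ hσ hσ1).le (fun i ω => ?_) t
  · exact (measurable_activeFO_left σ w).snd.comp (measurable_pi_apply i)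
  · rw [Function.update_of_ne hij.ne]
  · simp only [Function.update_self]
    exact drawLaw_query_le hwb hU hβ hσ hσ1 hd hw

/-! ### Validation -/

/-- The difference of the losses of `w` and `-w` on one example. -/
noncomputable def lossDiff (w : E d) (z : E d × ℝ) : ℝ :=
  (if halfspace w z.1 ≠ z.2 then 1 else 0) - (if halfspace (-w) z.1 ≠ z.2 then 1 else 0)

lemma measurable_halfspace_uncurry : Measurable fun p : E d × E d => halfspace p.1 p.2 := by
  unfold halfspace
  exact Measurable.ite (measurableSet_le measurable_const (by fun_prop)) measurable_const
    measurable_const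

lemma measurableSet_halfspace_ne :
    MeasurableSet {p : E d × (E d × ℝ) | halfspace p.1 p.2.1 ≠ p.2.2} := by
  have h1 : Measurable fun p : E d × (E d × ℝ) => halfspace p.1 p.2.1 :=
    Measurable.comp (g := fun q : E d × E d => halfspace q.1 q.2)
      (f := fun p : E d × (E d × ℝ) => (p.1, p.2.1)) measurable_halfspace_uncurry (by fun_prop)
  exact (measurableSet_eq_fun h1 (by fun_prop)).compl

lemma measurable_lossDiff : Measurable fun p : E d × (E d × ℝ) => lossDiff p.1 p.2 := by
  unfold lossDiff
  refine Measurable.sub (Measurable.ite measurableSet_halfspace_ne measurable_const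
    measurable_const) (Measurable.ite ?_ measurable_const measurable_const)
  exact measurableSet_halfspace_ne.preimage
    (by fun_prop : Measurable fun p : E d × (E d × ℝ) => (-p.1, p.2))

lemma measurable_lossDiff_left (w : E d) : Measurable (lossDiff w) :=
  Measurable.comp (g := fun p : E d × (E d × ℝ) => lossDiff p.1 p.2) (f := fun z => (w, z))
    measurable_lossDiff measurable_prodMk_left

lemma abs_lossDiff_le (w : E d) (z : E d × ℝ) : |lossDiff w z| ≤ 1 := by
  unfold lossDiff
  split_ifs <;> norm_num

lemma measurable_err (D : Measure (E d × ℝ)) [IsProbabilityMeasure D] :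
    Measurable (err D) :=
  (measurable_measure_prodMk_left measurableSet_halfspace_ne).ennreal_toReal

lemma integral_lossDiff (w : E d) : ∫ z, lossDiff w z ∂D = err D w - err D (-w) := by
  have h : ∀ v : E d, MeasurableSet {z : E d × ℝ | halfspace v z.1 ≠ z.2} := fun v =>
    measurableSet_halfspace_ne.preimage (measurable_prodMk_left (x := v))
  have e : ∀ v : E d, (fun z : E d × ℝ => if halfspace v z.1 ≠ z.2 then (1 : ℝ) else 0)
      = {z : E d × ℝ | halfspace v z.1 ≠ z.2}.indicator fun _ => 1 := fun v => by
    ext z; simp [Set.indicator_apply]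
  have hi : ∀ v : E d, Integrable (fun z : E d × ℝ => if halfspace v z.1 ≠ z.2 then (1 : ℝ) else 0)
      D := fun v => by
    rw [e]; exact (integrable_const _).indicator (h v)
  have he : ∀ v : E d, ∫ z, (if halfspace v z.1 ≠ z.2 then (1 : ℝ) else 0) ∂D = err D v :=
    fun v => by
      rw [e, integral_indicator_const _ (h v)]
      simp [err]
  unfold lossDiff
  rw [integral_sub (hi w) (hi (-w)), he, he]

include hwb hlab hd hw in
-- With `sign 0 = +1` the halfspaces of `w` and `-w` agree on the boundary, so this needs the
-- boundary to be a null set.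
lemma err_neg : err D (-w) = 1 - err D w := by
  obtain ⟨u, hu, huw⟩ := exists_unit_orthogonal hd hw
  have h0 := hwb.measure_inner_eq_zero hu hw huw
  have hae : ∀ᵐ z ∂D, inner ℝ w z.1 ≠ 0 :=
    (measurePreserving_fst_fst (D := D)).quasiMeasurePreserving.ae
      (p := fun x => inner ℝ w x ≠ 0) (by rw [ae_iff]; simpa using h0)
  rw [err_eq hlab, err_eq hlab]
  have h1 : ∫ z, z.2 * halfspace (-w) z.1 ∂D = -∫ z, z.2 * halfspace w z.1 ∂D := by
    rw [← integral_neg]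
    refine integral_congr_ae ?_
    filter_upwards [hae] with z hz
    simp only [halfspace, inner_neg_left]
    rcases lt_or_gt_of_ne hz with h | h
    · rw [if_pos (by linarith), if_neg (by linarith)]; ring
    · rw [if_neg (by linarith), if_pos h.le]; ring
  rw [h1]; ring

lemma measure_lossDiff_nonneg_le {M : ℕ} {g : ℝ} (hg0 : 0 ≤ g) (hg1 : g ≤ 1)
    (hg : err D w - err D (-w) ≤ -g) :
    (Measure.pi fun _ : Fin M => D) {η | 0 ≤ ∑ i, lossDiff w (η i)}
      ≤ ENNReal.ofReal (Real.exp (-(M * (g ^ 2 / 4)))) :=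
  measure_sum_nonneg_le D (X := lossDiff w) (measurable_lossDiff_left w)
    (abs_lossDiff_le w) hg0 hg1 (by rw [integral_lossDiff]; exact hg)

lemma measure_lossDiff_nonpos_le {M : ℕ} {g : ℝ} (hg0 : 0 ≤ g) (hg1 : g ≤ 1)
    (hg : err D (-w) - err D w ≤ -g) :
    (Measure.pi fun _ : Fin M => D) {η | ∑ i, lossDiff w (η i) ≤ 0}
      ≤ ENNReal.ofReal (Real.exp (-(M * (g ^ 2 / 4)))) := by
  have h := measure_sum_nonneg_le (N := M) D (X := fun z => -lossDiff w z)
    (measurable_lossDiff_left w).neg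
    (fun z => by rw [abs_neg]; exact abs_lossDiff_le w z) hg0 hg1
    (by rw [integral_neg, integral_lossDiff]; linarith)
  simpa using h

end Estimates

/-! ### Laws of the parts of the tape and failure events -/

section Tape

/-- Used to condition on the trials: a tail bound that is uniform over fixed unit vectors carries
over to the random candidates, since the fresh samples are independent of them. -/
lemma prod_le_of_forall_section_le {X Y : Type*} [MeasurableSpace X] [MeasurableSpace Y]
    {μ : Measure X} {ν : Measure Y} [IsProbabilityMeasure μ] [SFinite ν] {B : Set (X × Y)}
    (hB : MeasurableSet B) {c : ℝ≥0∞} (h : ∀ x, ν (Prod.mk x ⁻¹' B) ≤ c) : μ.prod ν B ≤ c := by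
  rw [Measure.prod_apply hB]
  calc ∫⁻ x, ν (Prod.mk x ⁻¹' B) ∂μ ≤ ∫⁻ _, c ∂μ := lintegral_mono h
    _ = c := by simp

/-- As an inequality this holds for arbitrary sets, so tape events can be transferred without a
measurability proof. -/
lemma _root_.MeasureTheory.MeasurePreserving.measure_preimage_le_apply {X Y : Type*}
    [MeasurableSpace X] [MeasurableSpace Y] {μ : Measure X} {ν : Measure Y} {f : X → Y}
    (hf : MeasurePreserving f μ ν) (s : Set Y) : μ (f ⁻¹' s) ≤ ν s := by
  rw [← hf.map_eq]
  exact Measure.le_map_apply hf.aemeasurable s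

variable {d : ℕ} {P : Params} {D : Measure (E d × ℝ)} [IsProbabilityMeasure D]

/-- The law of the trajectories and returned indices. -/
noncomputable def trialLaw (D : Measure (E d × ℝ)) (P : Params) :
    Measure ((Fin P.S → Fin P.N → Draw d) × (Fin P.S → Fin P.N)) :=
  (Measure.pi fun _ => Measure.pi fun _ => drawLaw D).prod
    (Measure.pi fun _ => uniformOn (Set.univ : Set (Fin P.N)))

/-- The candidate of the `s`-th trial as a function of the trials only. -/
noncomputable def trialOutput (P : Params)
    (p : (Fin P.S → Fin P.N → Draw d) × (Fin P.S → Fin P.N)) (s : Fin P.S) : E d :=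
  psgdIterate P.σ P.step (p.1 s) (p.2 s)

lemma measurable_trialOutput (s : Fin P.S) :
    Measurable fun p : (Fin P.S → Fin P.N → Draw d) × (Fin P.S → Fin P.N) => trialOutput P p s :=
  Measurable.comp (g := fun q : (Fin P.N → Draw d) × Fin P.N => psgdIterate P.σ P.step q.1 q.2)
    (f := fun p : (Fin P.S → Fin P.N → Draw d) × (Fin P.S → Fin P.N) => (p.1 s, p.2 s))
    (measurable_psgdIterate_index P.σ P.step)
    (((measurable_pi_apply s).comp measurable_fst).prodMk
      ((measurable_pi_apply s).comp measurable_snd))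

lemma isProbabilityMeasure_uniformOn_fin {N : ℕ} (hN : 0 < N) :
    IsProbabilityMeasure (uniformOn (Set.univ : Set (Fin N))) :=
  isProbabilityMeasure_uniformOn Set.finite_univ ⟨⟨0, hN⟩, trivial⟩

variable (hN : 0 < P.N)

include hN in
lemma isProbabilityMeasure_trialLaw : IsProbabilityMeasure (trialLaw D P) := by
  have := isProbabilityMeasure_uniformOn_fin hN
  unfold trialLaw; infer_instance

include hN in
lemma isProbabilityMeasure_tapeLaw : IsProbabilityMeasure (tapeLaw D P) := by
  have := isProbabilityMeasure_uniformOn_fin hN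
  unfold tapeLaw; infer_instance

include hN in
lemma measurePreserving_trials : MeasurePreserving Prod.fst (tapeLaw D P) (trialLaw D P) := by
  have := isProbabilityMeasure_uniformOn_fin hN
  exact measurePreserving_fst

include hN in
lemma measurePreserving_trials_estimate (s : Fin P.S) :
    MeasurePreserving (fun ω : Tape d P => (ω.1, ω.2.1 s)) (tapeLaw D P)
      ((trialLaw D P).prod (Measure.pi fun _ : Fin P.M₁ => drawLaw D)) := by
  have := isProbabilityMeasure_trialLaw (D := D) hN
  exact (MeasurePreserving.id (trialLaw D P)).prod
    ((measurePreserving_eval (fun _ : Fin P.S => Measure.pi fun _ : Fin P.M₁ => drawLaw D) s).comp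
      measurePreserving_fst)

include hN in
lemma measurePreserving_trials_validation :
    MeasurePreserving (fun ω : Tape d P => (ω.1, ω.2.2)) (tapeLaw D P)
      ((trialLaw D P).prod (Measure.pi fun _ : Fin P.M₂ => D)) := by
  have := isProbabilityMeasure_trialLaw (D := D) hN
  exact (MeasurePreserving.id (trialLaw D P)).prod measurePreserving_snd

include hN in
lemma measurePreserving_trial (s : Fin P.S) :
    MeasurePreserving (fun ω : Tape d P => ω.1.1 s) (tapeLaw D P)
      (Measure.pi fun _ : Fin P.N => drawLaw D) := by
  have := isProbabilityMeasure_uniformOn_fin hN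
  exact (measurePreserving_eval (fun _ : Fin P.S => Measure.pi fun _ : Fin P.N => drawLaw D) s).comp
    (measurePreserving_fst.comp (measurePreserving_trials hN))

lemma measurableSet_avgGrad_far (ρ : ℝ) (s : Fin P.S) :
    MeasurableSet {q : ((Fin P.S → Fin P.N → Draw d) × (Fin P.S → Fin P.N)) ×
      (Fin P.M₁ → Draw d) | ρ / 4 ≤ ‖(1 / (P.M₁ : ℝ)) •
        ∑ i, (activeFO P.σ (trialOutput P q.1 s) (q.2 i)).1
          - lossGrad D P.σ (trialOutput P q.1 s)‖} := by
  have h1 : Measurable fun q : ((Fin P.S → Fin P.N → Draw d) × (Fin P.S → Fin P.N)) ×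
      (Fin P.M₁ → Draw d) => trialOutput P q.1 s := (measurable_trialOutput s).comp measurable_fst
  suffices h2 : Measurable fun q : ((Fin P.S → Fin P.N → Draw d) × (Fin P.S → Fin P.N)) ×
      (Fin P.M₁ → Draw d) => ∑ i, (activeFO P.σ (trialOutput P q.1 s) (q.2 i)).1 from
    measurableSet_le measurable_const
      ((h2.const_smul (1 / (P.M₁ : ℝ))).sub ((measurable_lossGrad D P.σ).comp h1)).norm
  refine Finset.measurable_sum _ fun i _ => ?_
  exact (Measurable.comp (g := fun p : E d × Draw d => activeFO P.σ p.1 p.2)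
    (f := fun q : ((Fin P.S → Fin P.N → Draw d) × (Fin P.S → Fin P.N)) ×
      (Fin P.M₁ → Draw d) => (trialOutput P q.1 s, q.2 i)) (measurable_activeFO P.σ)
    (h1.prodMk ((measurable_pi_apply i).comp measurable_snd))).fst

lemma measurableSet_avgQueries_ge (b : ℝ) (s : Fin P.S) :
    MeasurableSet {q : ((Fin P.S → Fin P.N → Draw d) × (Fin P.S → Fin P.N)) ×
      (Fin P.M₁ → Draw d) |
        b ≤ ((∑ i, (activeFO P.σ (trialOutput P q.1 s) (q.2 i)).2 : ℕ) : ℝ)} := by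
  have h1 : Measurable fun q : ((Fin P.S → Fin P.N → Draw d) × (Fin P.S → Fin P.N)) ×
      (Fin P.M₁ → Draw d) => trialOutput P q.1 s := (measurable_trialOutput s).comp measurable_fst
  refine measurableSet_le measurable_const (measurable_from_top.comp
    (Finset.measurable_sum _ fun i _ => ?_))
  exact (Measurable.comp (g := fun p : E d × Draw d => activeFO P.σ p.1 p.2)
    (f := fun q : ((Fin P.S → Fin P.N → Draw d) × (Fin P.S → Fin P.N)) ×
      (Fin P.M₁ → Draw d) => (trialOutput P q.1 s, q.2 i)) (measurable_activeFO P.σ)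
    (h1.prodMk ((measurable_pi_apply i).comp measurable_snd))).snd

/-- Validation examples on which the comparison of `w` and `-w` is misleading although their error
rates differ by at least `g`. -/
def misleading (D : Measure (E d × ℝ)) (g : ℝ) {M : ℕ} (w : E d) : Set (Fin M → E d × ℝ) :=
  {v | (err D w - err D (-w) ≤ -g ∧ 0 ≤ ∑ i, lossDiff w (v i)) ∨
    (err D (-w) - err D w ≤ -g ∧ ∑ i, lossDiff w (v i) ≤ 0)}

lemma measurableSet_misleading (g : ℝ) (s : Fin P.S) :
    MeasurableSet {q : ((Fin P.S → Fin P.N → Draw d) × (Fin P.S → Fin P.N)) ×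
      (Fin P.M₂ → E d × ℝ) | q.2 ∈ misleading D g (trialOutput P q.1 s)} := by
  have h1 : Measurable fun q : ((Fin P.S → Fin P.N → Draw d) × (Fin P.S → Fin P.N)) ×
      (Fin P.M₂ → E d × ℝ) => trialOutput P q.1 s := (measurable_trialOutput s).comp measurable_fst
  have h2 : Measurable fun q : ((Fin P.S → Fin P.N → Draw d) × (Fin P.S → Fin P.N)) ×
      (Fin P.M₂ → E d × ℝ) => ∑ i, lossDiff (trialOutput P q.1 s) (q.2 i) :=
    Finset.measurable_sum _ fun i _ =>
      Measurable.comp (g := fun p : E d × (E d × ℝ) => lossDiff p.1 p.2)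
        (f := fun q : ((Fin P.S → Fin P.N → Draw d) × (Fin P.S → Fin P.N)) ×
          (Fin P.M₂ → E d × ℝ) => (trialOutput P q.1 s, q.2 i)) measurable_lossDiff
        (h1.prodMk ((measurable_pi_apply i).comp measurable_snd))
  have h3 := (measurable_err D).comp h1
  have h4 := (measurable_err D).comp h1.neg
  exact ((measurableSet_le (h3.sub h4) measurable_const).inter
    (measurableSet_le measurable_const h2)).union
    ((measurableSet_le (h4.sub h3) measurable_const).inter
    (measurableSet_le h2 measurable_const))

lemma measure_misleading_le {M : ℕ} {g : ℝ} (hg0 : 0 < g) (hg1 : g ≤ 1) (w : E d) :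
    (Measure.pi fun _ : Fin M => D) (misleading D g w)
      ≤ ENNReal.ofReal (Real.exp (-(M * (g ^ 2 / 4)))) := by
  by_cases h1 : err D w - err D (-w) ≤ -g
  · refine le_trans (measure_mono fun v hv => ?_) (measure_lossDiff_nonneg_le hg0.le hg1 h1)
    rcases hv with h | h
    · exact h.2
    · exact absurd h.1 (by linarith)
  · by_cases h2 : err D (-w) - err D w ≤ -g
    · refine le_trans (measure_mono fun v hv => ?_) (measure_lossDiff_nonpos_le hg0.le hg1 h2)
      rcases hv with h | h
      · exact absurd h.1 h1
      · exact h.2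
    · have : misleading (M := M) D g w = ∅ := by
        ext v; simp [misleading, h1, h2]
      rw [this]; simp

/-! ### Deterministic analysis of the selection and validation steps -/

lemma exists_selected_eq (hS : 0 < P.S) (ω : Tape d P) :
    ∃ s, selected P ω = candidate P ω s ∧ ∀ s', ‖avgGrad P ω s‖ ≤ ‖avgGrad P ω s'‖ := by
  have hne : (List.finRange P.S).argmin (fun s => ‖avgGrad P ω s‖) ≠ none := by
    rw [Ne, List.argmin_eq_none]
    intro h
    have := congrArg List.length h
    simp at this
    omega
  obtain ⟨s, hs⟩ := Option.ne_none_iff_exists'.1 hne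
  refine ⟨s, by simp [selected, hs], fun s' => ?_⟩
  exact List.le_of_mem_argmin (f := fun s => ‖avgGrad P ω s‖) (List.mem_finRange s') hs

lemma empErr_le_iff (hM : 0 < P.M₂) (ω : Tape d P) (w : E d) :
    empErr P ω w ≤ empErr P ω (-w) ↔ ∑ i, lossDiff w (ω.2.2 i) ≤ 0 := by
  have hM' : (0 : ℝ) < 1 / P.M₂ := by positivity
  unfold empErr lossDiff
  rw [mul_le_mul_iff_right₀ hM', Finset.sum_sub_distrib, sub_nonpos]

/-- The errors of `± w` sum to 1, so an error at least `g/2` below one half is a gap of at least `g`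
between them. If validation is not misleading, the sign with this margin is chosen, whichever way
ties are broken. -/
lemma output_good {L R U β : ℝ} (hwb : WellBehaved L R U β D.fst) (hlab : BinaryLabels D)
    (hd : 2 ≤ d) (hS : 0 < P.S) (hM : 0 < P.M₂) {ρ g ε e : ℝ} (hρ : 0 < ρ)
    (hgood : ∀ w : E d, ‖w‖ = 1 → ‖lossGrad D P.σ w‖ < ρ →
      (err D w - e ≤ ε ∧ 2 * err D w - 1 ≤ -g) ∨ (err D (-w) - e ≤ ε ∧ 2 * err D (-w) - 1 ≤ -g))
    {ω : Tape d P} (h1 : ∃ s, ‖lossGrad D P.σ (candidate P ω s)‖ < ρ / 4)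
    (h2 : ∀ s, ‖avgGrad P ω s - lossGrad D P.σ (candidate P ω s)‖ < ρ / 4)
    (h3 : ∀ s, ω.2.2 ∉ misleading D g (candidate P ω s)) :
    err D (output P ω) - e ≤ ε := by
  obtain ⟨s, hs, hmin⟩ := exists_selected_eq hS ω
  obtain ⟨s', hs'⟩ := h1
  set w := candidate P ω s with hw
  have hn : ‖w‖ = 1 := norm_psgdIterate (by omega) _ _
  -- Three errors below `ρ/4` add up: the gradient at the good candidate `s'` and the two estimation
  -- errors at `s'` and `s`.
  have hG : ‖lossGrad D P.σ w‖ < ρ := by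
    have a1 := norm_sub_norm_le (lossGrad D P.σ w) (avgGrad P ω s)
    have a2 := norm_sub_norm_le (avgGrad P ω s') (lossGrad D P.σ (candidate P ω s'))
    have a3 := hmin s'
    have a4 := h2 s
    rw [norm_sub_rev] at a4
    linarith [h2 s']
  have hneg := err_neg hwb hlab hd hn
  have h3' := h3 s
  simp only [misleading, Set.mem_ofPred_eq, not_or, not_and, not_le] at h3'
  unfold output
  rw [hs]
  rcases hgood w hn hG with ⟨h, h'⟩ | ⟨h, h'⟩
  · rw [if_pos]
    · exact h
    · exact (empErr_le_iff hM ω _).2 (h3'.1 (by rw [← hw]; linarith)).le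
  · rw [if_neg]
    · exact h
    · rw [empErr_le_iff hM]
      exact not_le.2 (h3'.2 (by rw [← hw]; linarith))

lemma labelQueries_le {ω : Tape d P} {a b : ℝ}
    (h4 : ∀ s, (psgdQueries P.σ P.step (ω.1.1 s) : ℝ) ≤ a)
    (h5 : ∀ s, ((∑ i, (activeFO P.σ (candidate P ω s) (ω.2.1 s i)).2 : ℕ) : ℝ) ≤ b) :
    (labelQueries P ω : ℝ) ≤ P.S * a + P.S * b + P.M₂ := by
  unfold labelQueries
  rw [Nat.cast_add, Nat.cast_add, Nat.cast_sum, Nat.cast_sum]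
  have e1 := Finset.sum_le_card_nsmul (Finset.univ : Finset (Fin P.S)) _ a fun s _ => h4 s
  have e2 := Finset.sum_le_card_nsmul (Finset.univ : Finset (Fin P.S)) _ b fun s _ => h5 s
  simp only [Finset.card_univ, Fintype.card_fin, nsmul_eq_mul] at e1 e2
  linarith

/-! ### Probability of success -/

lemma measure_iUnion_fin_le {Ω : Type*} [MeasurableSpace Ω] (μ : Measure Ω) {S : ℕ}
    {B : Fin S → Set Ω} {c δ : ℝ} (_hc : 0 ≤ c) (h : ∀ s, μ (B s) ≤ ENNReal.ofReal c)
    (hδ : S * c ≤ δ) :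
    μ (⋃ s, B s) ≤ ENNReal.ofReal δ := by
  calc μ (⋃ s, B s) ≤ ∑ s, μ (B s) := measure_iUnion_fintype_le _ _
    _ ≤ ∑ _s : Fin S, ENNReal.ofReal c := Finset.sum_le_sum fun s _ => h s
    _ = ENNReal.ofReal (S * c) := by
        rw [Finset.sum_const, Finset.card_univ, Fintype.card_fin, nsmul_eq_mul,
          ENNReal.ofReal_mul (by positivity), ENNReal.ofReal_natCast]
    _ ≤ _ := ENNReal.ofReal_le_ofReal hδ

variable {L R U β : ℝ} (hwb : WellBehaved L R U β D.fst) (hU : 0 < U)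
  (hβ : 0 < β) (hlab : BinaryLabels D) (hd : 2 ≤ d) (hσ : 0 < P.σ)
  (hσ1 : 1 ≤ Real.log (1 / P.σ)) {ρ g ε e δ t : ℝ}

include hd in
lemma norm_trialOutput (p : (Fin P.S → Fin P.N → Draw d) × (Fin P.S → Fin P.N)) (s : Fin P.S) :
    ‖trialOutput P p s‖ = 1 :=
  norm_psgdIterate (by omega) _ _

include hwb hU hβ hσ hσ1 hlab hd hN in
lemma tapeLaw_trials_fail_le (hγ : 0 < P.step) (hρ : 0 < ρ)
    (hnum : (2 + P.N * (smoothnessBound U β P.σ * P.step ^ 2 * varianceBound d U β P.σ))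
      / (P.step * P.N) ≤ ρ ^ 2 / 32) (hδ1 : (1 / 2 : ℝ) ^ P.S ≤ δ) :
    tapeLaw D P {ω | ∀ s, ρ / 4 ≤ ‖lossGrad D P.σ (candidate P ω s)‖} ≤ ENNReal.ofReal δ := by
  have := isProbabilityMeasure_uniformOn_fin hN
  set T : Set ((Fin P.N → Draw d) × Fin P.N) :=
    {q | ρ / 4 ≤ ‖lossGrad D P.σ (psgdIterate P.σ P.step q.1 q.2)‖} with hT
  have hTm : MeasurableSet T := measurableSet_le measurable_const
    ((measurable_lossGrad D P.σ).comp (measurable_psgdIterate_index P.σ P.step)).norm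
  have h := (measurePreserving_trials (D := D) hN).measure_preimage_le_apply
    {p | ∀ s, (p.1 s, p.2 s) ∈ T}
  refine le_trans h ?_
  unfold trialLaw
  rw [measure_forall_prod_le _ _ hTm]
  calc _ ≤ ENNReal.ofReal (1 / 2) ^ P.S := by
        gcongr
        exact measure_trial_fails_le hwb hU hβ hσ hσ1 hlab hd hγ hN hρ hnum
    _ = ENNReal.ofReal ((1 / 2) ^ P.S) := (ENNReal.ofReal_pow (by norm_num) _).symm
    _ ≤ _ := ENNReal.ofReal_le_ofReal hδ1

include hwb hβ hσ hlab hd hN in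
lemma tapeLaw_avgGrad_far_le (hM₁ : 0 < P.M₁) (hρ : 0 < ρ) (hσρ : P.σ * ρ ≤ 192 * β * √d)
    (s : Fin P.S) :
    tapeLaw D P {ω | ρ / 4 ≤ ‖avgGrad P ω s - lossGrad D P.σ (candidate P ω s)‖}
      ≤ ENNReal.ofReal (2 * Real.exp (-(P.M₁ * (P.σ ^ 2 * ρ ^ 2 / (6144 * β ^ 2 * d))))) := by
  have := isProbabilityMeasure_trialLaw (D := D) hN
  have h := (measurePreserving_trials_estimate (D := D) hN s).measure_preimage_le_apply
    {q | ρ / 4 ≤ ‖(1 / (P.M₁ : ℝ)) • ∑ i, (activeFO P.σ (trialOutput P q.1 s) (q.2 i)).1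
          - lossGrad D P.σ (trialOutput P q.1 s)‖}
  refine le_trans h ?_
  refine prod_le_of_forall_section_le (measurableSet_avgGrad_far ρ s) fun p => ?_
  exact measure_avgGrad_far_le hwb hβ hσ hlab hd (norm_trialOutput hd p s) hM₁ hρ hσρ

include hN in
lemma tapeLaw_misleading_le (hg0 : 0 < g) (hg1 : g ≤ 1) (s : Fin P.S) :
    tapeLaw D P {ω | ω.2.2 ∈ misleading D g (candidate P ω s)}
      ≤ ENNReal.ofReal (Real.exp (-(P.M₂ * (g ^ 2 / 4)))) := by
  have := isProbabilityMeasure_trialLaw (D := D) hN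
  have h := (measurePreserving_trials_validation (D := D) hN).measure_preimage_le_apply
    {q | q.2 ∈ misleading D g (trialOutput P q.1 s)}
  refine le_trans h (prod_le_of_forall_section_le (measurableSet_misleading g s) fun p => ?_)
  have e : Prod.mk p ⁻¹' {q : ((Fin P.S → Fin P.N → Draw d) × (Fin P.S → Fin P.N)) ×
      (Fin P.M₂ → E d × ℝ) | q.2 ∈ misleading D g (trialOutput P q.1 s)}
      = misleading D g (trialOutput P p s) := by
    ext v; simp only [Set.mem_preimage, Set.mem_ofPred_eq]
  rw [e]
  exact measure_misleading_le hg0 hg1 (trialOutput P p s)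

include hwb hU hβ hσ hσ1 hd hN in
lemma tapeLaw_psgdQueries_ge_le (t : ℝ) (s : Fin P.S) :
    tapeLaw D P {ω | 2 * stripBound U β P.σ * P.N + t ≤ (psgdQueries P.σ P.step (ω.1.1 s) : ℝ)}
      ≤ ENNReal.ofReal (Real.exp (-t)) := by
  have h := (measurePreserving_trial (D := D) hN s).measure_preimage_le_apply
    {ω | 2 * stripBound U β P.σ * P.N + t ≤ (psgdQueries P.σ P.step ω : ℝ)}
  exact le_trans h (measure_psgdQueries_ge_le hwb hU hβ hσ hσ1 hd P.step t)

include hwb hU hβ hσ hσ1 hd hN in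
lemma tapeLaw_avgQueries_ge_le (t : ℝ) (s : Fin P.S) :
    tapeLaw D P {ω | 2 * stripBound U β P.σ * P.M₁ + t
      ≤ ((∑ i, (activeFO P.σ (candidate P ω s) (ω.2.1 s i)).2 : ℕ) : ℝ)}
      ≤ ENNReal.ofReal (Real.exp (-t)) := by
  have := isProbabilityMeasure_trialLaw (D := D) hN
  have h := (measurePreserving_trials_estimate (D := D) hN s).measure_preimage_le_apply
    {q | 2 * stripBound U β P.σ * P.M₁ + t
      ≤ ((∑ i, (activeFO P.σ (trialOutput P q.1 s) (q.2 i)).2 : ℕ) : ℝ)}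
  refine le_trans h ?_
  refine prod_le_of_forall_section_le (measurableSet_avgQueries_ge _ s) fun p => ?_
  exact measure_avgQueries_ge_le hwb hU hβ hσ hσ1 hd (norm_trialOutput hd p s) t

/-- The whole space is covered by `G` and the five failure events, so subadditivity suffices and `G`
need not be measurable. -/
lemma one_sub_le_measureReal_of_cover {Ω : Type*} [MeasurableSpace Ω] {μ : Measure Ω}
    [IsProbabilityMeasure μ] {δ : ℝ} (hδ : 0 < δ) {G B1 B2 B3 B4 B5 : Set Ω}
    (h1 : μ B1 ≤ ENNReal.ofReal (δ / 6)) (h2 : μ B2 ≤ ENNReal.ofReal (δ / 6))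
    (h3 : μ B3 ≤ ENNReal.ofReal (δ / 6)) (h4 : μ B4 ≤ ENNReal.ofReal (δ / 6))
    (h5 : μ B5 ≤ ENNReal.ofReal (δ / 6))
    (h : ∀ ω, ω ∉ B1 → ω ∉ B2 → ω ∉ B3 → ω ∉ B4 → ω ∉ B5 → ω ∈ G) : 1 - δ ≤ μ.real G := by
  have hsub : (Set.univ : Set Ω) ⊆ G ∪ (B1 ∪ (B2 ∪ (B3 ∪ (B4 ∪ B5)))) := by
    intro ω _
    by_contra hω
    simp only [Set.mem_union, not_or] at hω
    exact hω.1 (h ω hω.2.1 hω.2.2.1 hω.2.2.2.1 hω.2.2.2.2.1 hω.2.2.2.2.2)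
  have hr : ∀ {B : Set Ω}, μ B ≤ ENNReal.ofReal (δ / 6) → μ.real B ≤ δ / 6 :=
    fun h => ENNReal.toReal_le_of_le_ofReal (by positivity) h
  have hle : (1 : ℝ) ≤ μ.real G + (δ / 6 + (δ / 6 + (δ / 6 + (δ / 6 + δ / 6)))) :=
    calc (1 : ℝ) = μ.real Set.univ := probReal_univ.symm
      _ ≤ _ := measureReal_mono hsub
      _ ≤ _ := (measureReal_union_le _ _).trans (add_le_add le_rfl
          ((measureReal_union_le _ _).trans (add_le_add (hr h1)
          ((measureReal_union_le _ _).trans (add_le_add (hr h2)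
          ((measureReal_union_le _ _).trans (add_le_add (hr h3)
          ((measureReal_union_le _ _).trans (add_le_add (hr h4) (hr h5))))))))))
  linarith

include hwb hU hβ hlab hd hσ hσ1 hN in
/-- Correctness and label complexity of the main algorithm for any parameters that satisfy a list
of numerical conditions. -/
theorem one_sub_le_tapeLaw_real (hγ : 0 < P.step) (hS : 0 < P.S)
    (hM₁ : 0 < P.M₁) (hM₂ : 0 < P.M₂) (hρ : 0 < ρ) (hg0 : 0 < g) (hg1 : g ≤ 1)
    (hσρ : P.σ * ρ ≤ 192 * β * √d)
    (hgood : ∀ w : E d, ‖w‖ = 1 → ‖lossGrad D P.σ w‖ < ρ →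
      (err D w - e ≤ ε ∧ 2 * err D w - 1 ≤ -g) ∨ (err D (-w) - e ≤ ε ∧ 2 * err D (-w) - 1 ≤ -g))
    (hnum : (2 + P.N * (smoothnessBound U β P.σ * P.step ^ 2 * varianceBound d U β P.σ))
      / (P.step * P.N) ≤ ρ ^ 2 / 32)
    (hδ : 0 < δ) (hδ1 : (1 / 2 : ℝ) ^ P.S ≤ δ / 6)
    (hδ2 : P.S * (2 * Real.exp (-(P.M₁ * (P.σ ^ 2 * ρ ^ 2 / (6144 * β ^ 2 * d))))) ≤ δ / 6)
    (hδ3 : P.S * Real.exp (-(P.M₂ * (g ^ 2 / 4))) ≤ δ / 6)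
    (hδ4 : P.S * Real.exp (-t) ≤ δ / 6) :
    1 - δ ≤ (tapeLaw D P).real {ω | err D (output P ω) - e ≤ ε ∧
      (labelQueries P ω : ℝ) ≤ P.S * (2 * stripBound U β P.σ * P.N + t)
        + P.S * (2 * stripBound U β P.σ * P.M₁ + t) + P.M₂} := by
  have := isProbabilityMeasure_tapeLaw (D := D) hN
  refine one_sub_le_measureReal_of_cover hδ
    (tapeLaw_trials_fail_le hN hwb hU hβ hlab hd hσ hσ1 hγ hρ hnum hδ1)
    (measure_iUnion_fin_le _ (by positivity) (tapeLaw_avgGrad_far_le hN hwb hβ hlab hd hσ hM₁ hρ hσρ)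
      hδ2)
    (measure_iUnion_fin_le _ (by positivity) (tapeLaw_misleading_le hN hg0 hg1) hδ3)
    (measure_iUnion_fin_le _ (by positivity) (tapeLaw_psgdQueries_ge_le hN hwb hU hβ hd hσ hσ1 t)
      hδ4)
    (measure_iUnion_fin_le _ (by positivity) (tapeLaw_avgQueries_ge_le hN hwb hU hβ hd hσ hσ1 t)
      hδ4) ?_
  -- The excluded failures are, in order: no stationary candidate, an inaccurate gradient estimate,
  -- misleading validation, too many queries in a trial, too many queries in an estimate.
  intro ω h1 h2 h3 h4 h5
  simp only [Set.mem_iUnion, not_exists] at h2 h3 h4 h5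
  refine ⟨output_good hwb hlab hd hS hM₂ hρ hgood ?_ (fun s => not_le.1 (h2 s)) h3,
    labelQueries_le (fun s => (not_le.1 (h4 s)).le) fun s => (not_le.1 (h5 s)).le⟩
  by_contra hcon
  push Not at hcon
  exact h1 hcon

end Tape

/-! ### From small gradient to small excess error -/

section Stationary

variable {d : ℕ} {L R U β σ A α : ℝ} {D : Measure (E d × ℝ)} [IsProbabilityMeasure D]

omit [IsProbabilityMeasure D] in
lemma err_smul {c : ℝ} (hc : 0 < c) (w : E d) : err D (c • w) = err D w := by
  unfold err; rw [halfspace_smul hc]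

lemma TsybakovNoise.smul {w : E d} (h : TsybakovNoise A α w D) {c : ℝ} (hc : 0 < c) :
    TsybakovNoise A α (c • w) D := by
  unfold TsybakovNoise flipProb at *
  rwa [halfspace_smul hc]

/-- At an approximately stationary unit vector `w`, one of `± w` has small excess error. -/
lemma excess_err_le_of_norm_lossGrad_lt (hwb : WellBehaved L R U β D.fst) (hL : 0 < L) (hR : 0 < R)
    (hU : 0 < U) (hβ : 0 < β) (hσ : 0 < σ) (hσR : σ ≤ R / 2) (hlab : BinaryLabels D) (hd : 2 ≤ d)
    (hα0 : 0 < α) (hα : α ≤ 1) (hA : 0 < A) {wstar : E d} (hw0 : wstar ≠ 0)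
    (hT : TsybakovNoise A α wstar D) {θ ρ r κ : ℝ} (hθ : 0 < θ) (hθ1 : θ ≤ 1 / 2)
    (hρ : ρ ≤ L * R ^ 2 / 384 * (L * R * σ / 4 / A) ^ ((1 - α) / α) - 128 * U * σ ^ 2 / θ ^ 2)
    (hr : 0 < r) (hκ : Real.exp (1 - r / β) + 8 * U * θ * r ^ 2 ≤ κ) {w : E d} (hw : ‖w‖ = 1)
    (hwρ : ‖lossGrad D σ w‖ < ρ) :
    err D w - err D wstar ≤ κ ∨ err D (-w) - err D wstar ≤ κ := by
  have hn : 0 < ‖wstar‖⁻¹ := inv_pos.2 (norm_pos_iff.2 hw0)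
  have hv : ‖‖wstar‖⁻¹ • wstar‖ = 1 := by
    rw [norm_smul, norm_inv, norm_norm, inv_mul_cancel₀ (norm_ne_zero_iff.2 hw0)]
  obtain ⟨u, a, b, hu, huw, hb, hab, e⟩ := exists_orthogonal_decomposition hd hw hv
  have hT' := hT.smul hn
  rw [← err_smul hn wstar]
  rw [e] at hT' ⊢
  -- A larger angle would contradict stationarity: the lower bound on the gradient increases with
  -- `b` and already reaches `ρ` at `b = θ`.
  have hbθ : b ≤ θ := by
    by_contra hcon
    push Not at hcon
    have hb0 : 0 < b := hθ.trans hcon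
    have h1 := le_norm_lossGrad hwb hL hR hU hβ hσ hσR hlab hd hα0 hα hA hu hw huw
      (abs_le_one_iff_mul_self_le_one.2 (by nlinarith)) hb0 hT'
    have h2 : 128 * U * σ ^ 2 / b ^ 2 ≤ 128 * U * σ ^ 2 / θ ^ 2 := by gcongr
    linarith
  obtain ⟨s, hs, h⟩ := measure_disagreement_le hwb hU hu hw huw hab hb hbθ hθ1 hr
  have h1 := (err_sub_le (D := D) (s • w) (a • w + b • u)).trans (h.trans hκ)
  rcases hs with rfl | rfl
  · left; simpa using h1
  · right; simpa using h1

end Stationary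

/-! ### Numerical conditions -/

lemma log_six_le : Real.log 6 ≤ 2 := by
  rw [Real.log_le_iff_le_exp (by norm_num)]
  have := Real.exp_one_gt_d9
  have e : Real.exp 2 = Real.exp 1 * Real.exp 1 := by rw [← Real.exp_add]; norm_num
  rw [e]; nlinarith

/-! ### The number of trials and union bounds over them -/

section Trials

variable {δ : ℝ} (hδ : 0 < δ) (hδ1 : δ < 1)

include hδ hδ1

lemma six_lt_div : 6 < 6 / δ := by
  rw [lt_div_iff₀ hδ]; linarith

lemma three_le_numTrials : 3 ≤ numTrials δ := by
  have h6 := six_lt_div hδ hδ1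
  unfold numTrials
  have : (2 : ℝ) < Real.logb 2 (6 / δ) := by
    rw [Real.lt_logb_iff_rpow_lt (by norm_num) (by positivity)]
    norm_num; linarith
  have h2 : ((2 : ℕ) : ℝ) < Real.logb 2 (6 / δ) := by exact_mod_cast this
  exact Nat.lt_ceil.2 h2

omit hδ1 in
lemma half_pow_numTrials_le : (1 / 2 : ℝ) ^ numTrials δ ≤ δ / 6 := by
  have h : Real.logb 2 (6 / δ) ≤ (numTrials δ : ℝ) := Nat.le_ceil _
  rw [Real.logb_le_iff_le_rpow (by norm_num) (by positivity), Real.rpow_natCast] at h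
  rw [one_div, inv_pow, inv_le_comm₀ (by positivity) (by positivity), inv_div]
  exact h

lemma numTrials_lt : (numTrials δ : ℝ) < Real.logb 2 (6 / δ) + 1 :=
  Nat.ceil_lt_add_one (Real.logb_nonneg (by norm_num) (by linarith [six_lt_div hδ hδ1]))

/-- A crude comparison of a logarithm with its argument. It lets union bounds over the trials be
paid by a second factor `δ/6`. -/
lemma numTrials_le_div : (numTrials δ : ℝ) ≤ 6 / δ := by
  refine (numTrials_lt hδ hδ1).le.trans ?_
  have h6 := six_lt_div hδ hδ1
  set x := 6 / δ
  have h1 : Real.log x ≤ x / 2 - 1 + Real.log 2 := by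
    have := Real.log_le_sub_one_of_pos (x := x / 2) (by linarith)
    rw [Real.log_div (by linarith) (by norm_num)] at this
    linarith
  have h2 := Real.log_two_gt_d9
  have h3 : Real.logb 2 x ≤ x - 1 := by
    unfold Real.logb
    rw [div_le_iff₀ (by linarith)]
    nlinarith
  linarith

omit hδ1 in
lemma log_six_div_le {Λ : ℝ} (hΛ : 1 ≤ Λ) (hδΛ : Real.log (1 / δ) ≤ Λ) :
    Real.log (6 / δ) ≤ 3 * Λ := by
  have : Real.log (6 / δ) = Real.log 6 + Real.log (1 / δ) := by
    rw [← Real.log_mul (by norm_num) (by positivity)]; congr 1; ring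
  linarith [log_six_le]

lemma numTrials_le {Λ : ℝ} (hΛ : 1 ≤ Λ) (hδΛ : Real.log (1 / δ) ≤ Λ) :
    (numTrials δ : ℝ) ≤ 6 * Λ := by
  refine (numTrials_lt hδ hδ1).le.trans ?_
  have h1 := log_six_div_le hδ hΛ hδΛ
  have h2 := Real.log_two_gt_d9
  have h3 : Real.logb 2 (6 / δ) ≤ 5 * Λ := by
    unfold Real.logb
    rw [div_le_iff₀ (by linarith)]
    nlinarith
  linarith

lemma log_numTrials_div_le {Λ : ℝ} (hΛ : 1 ≤ Λ) (hδΛ : Real.log (1 / δ) ≤ Λ) :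
    Real.log (6 * numTrials δ / δ) ≤ 6 * Λ := by
  have hS : (3 : ℝ) ≤ numTrials δ := by exact_mod_cast three_le_numTrials hδ hδ1
  have h1 : Real.log (6 * numTrials δ / δ) ≤ Real.log (6 / δ * (6 / δ)) := by
    apply Real.log_le_log (by positivity)
    have := numTrials_le_div hδ hδ1
    calc 6 * (numTrials δ : ℝ) / δ = 6 / δ * numTrials δ := by ring
      _ ≤ _ := by gcongr
  rw [Real.log_mul (by positivity) (by positivity)] at h1
  linarith [log_six_div_le hδ hΛ hδΛ]

lemma numTrials_mul_exp_eq :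
    (numTrials δ : ℝ) * Real.exp (-Real.log (6 * numTrials δ / δ)) = δ / 6 := by
  have hS : (3 : ℝ) ≤ numTrials δ := by exact_mod_cast three_le_numTrials hδ hδ1
  rw [Real.exp_neg, Real.exp_log (by positivity)]
  field_simp

/-- The fourth power of `δ/S` is ample: with `S ≥ 3` the surplus `2 δ³/S³` is below `1/6`. -/
lemma numTrials_mul_two_exp_le {x : ℝ} (hx : 4 * Real.log (numTrials δ / δ) ≤ x) :
    (numTrials δ : ℝ) * (2 * Real.exp (-x)) ≤ δ / 6 := by
  have hS : (3 : ℝ) ≤ numTrials δ := by exact_mod_cast three_le_numTrials hδ hδ1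
  set S : ℝ := (numTrials δ : ℝ)
  have h1 : Real.exp (-x) ≤ (δ / S) ^ 4 := by
    calc Real.exp (-x) ≤ Real.exp (-(4 * Real.log (S / δ))) := by gcongr
      _ = (δ / S) ^ 4 := by
        rw [show -(4 * Real.log (S / δ)) = ((4 : ℕ) : ℝ) * Real.log (δ / S) by
          rw [← inv_div S δ, Real.log_inv]; push_cast; ring, Real.exp_nat_mul,
          Real.exp_log (by positivity)]
  have h2 : S * (2 * (δ / S) ^ 4) = δ * (2 * δ ^ 3 / S ^ 3) := by field_simp
  have h3 : 2 * δ ^ 3 / S ^ 3 ≤ 1 / 6 := by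
    rw [div_le_iff₀ (by positivity)]
    have : (3 : ℝ) ^ 3 ≤ S ^ 3 := by gcongr
    have : δ ^ 3 ≤ 1 := pow_le_one₀ hδ.le hδ1.le
    linarith
  calc S * (2 * Real.exp (-x)) ≤ S * (2 * (δ / S) ^ 4) := by gcongr
    _ = δ * (2 * δ ^ 3 / S ^ 3) := h2
    _ ≤ δ * (1 / 6) := by gcongr
    _ = δ / 6 := by ring

lemma numTrials_mul_exp_le {x : ℝ} (hx : 2 * Real.log (6 / δ) ≤ x) :
    (numTrials δ : ℝ) * Real.exp (-x) ≤ δ / 6 := by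
  have h1 : Real.exp (-x) ≤ (δ / 6) * (δ / 6) := by
    calc Real.exp (-x) ≤ Real.exp (-(2 * Real.log (6 / δ))) := by gcongr
      _ = (δ / 6) * (δ / 6) := by
        rw [show -(2 * Real.log (6 / δ)) = Real.log (δ / 6) + Real.log (δ / 6) by
          rw [← inv_div 6 δ, Real.log_inv]; ring, Real.exp_add, Real.exp_log (by positivity)]
  calc (numTrials δ : ℝ) * Real.exp (-x) ≤ (6 / δ) * ((δ / 6) * (δ / 6)) := by
        gcongr; exact numTrials_le_div hδ hδ1
    _ = δ / 6 := by field_simp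

end Trials

/-- The place where `α > 1/3` is decisive. The signal is of order `s^ν` with `ν = (1-α)/α < 2` and
the wedge loss of order `s²`, so a small `s` leaves half of the signal. The bound `s ≤ 1/3` later
gives `log (1/σ) ≥ 1`. -/
lemma exists_width_constants {α L R U β : ℝ} (hα : 1 / 3 < α) (hL : 0 < L) (hR : 0 < R)
    (hU : 0 < U) (hβ : 0 < β) :
    ∃ s r : ℝ, 0 < s ∧ s ≤ R / 2 ∧ s ≤ 1 / 3 ∧ 0 < r ∧ r ≤ 1 ∧ r ≤ 192 * β ∧
      r ≤ L * R ^ 2 / 384 * (L * R * s / 4) ^ ((1 - α) / α) - 128 * U * s ^ 2 := by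
  set ν := (1 - α) / α with hν
  have hν2 : 0 < 2 - ν := by
    rw [hν, sub_pos, div_lt_iff₀ (by linarith)]; linarith
  set κ := L * R ^ 2 / 384 * (L * R / 4) ^ ν with hκ
  have hκ0 : 0 < κ := by positivity
  set s := min (min (R / 2) (1 / 3)) ((κ / (256 * U)) ^ (1 / (2 - ν))) with hs
  have hs0 : 0 < s := by rw [hs]; positivity
  have hpow : 256 * U * s ^ (2 - ν) ≤ κ := by
    have h1 : s ^ (2 - ν) ≤ κ / (256 * U) := by
      calc s ^ (2 - ν) ≤ ((κ / (256 * U)) ^ (1 / (2 - ν))) ^ (2 - ν) :=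
            Real.rpow_le_rpow hs0.le (min_le_right _ _) hν2.le
        _ = _ := by
          rw [← Real.rpow_mul (by positivity), one_div_mul_cancel hν2.ne', Real.rpow_one]
    rw [le_div_iff₀ (by positivity)] at h1
    linarith
  have hs2 : s ^ 2 = s ^ ν * s ^ (2 - ν) := by
    rw [← Real.rpow_add hs0, add_sub_cancel, Real.rpow_two]
  have hsν : 0 < s ^ ν := by positivity
  refine ⟨s, min (min 1 (192 * β)) (κ * s ^ ν / 2), hs0,
    (min_le_left _ _).trans (min_le_left _ _), (min_le_left _ _).trans (min_le_right _ _),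
    by positivity, (min_le_left _ _).trans (min_le_left _ _),
    (min_le_left _ _).trans (min_le_right _ _), (min_le_right _ _).trans ?_⟩
  have e : L * R ^ 2 / 384 * (L * R * s / 4) ^ ν = κ * s ^ ν := by
    rw [hκ, show L * R * s / 4 = L * R / 4 * s by ring, Real.mul_rpow (by positivity) hs0.le]
    ring
  rw [e, hs2]
  nlinarith [mul_le_mul_of_nonneg_left hpow hsν.le]

/-- Smoothness is at most `(2K+1)Λ³/σ` and variance at most `dKΛ³/σ`. Their product explains the
step size and the power `Λ⁶`. The budget `ρ²/32` is shared equally by the second-order error and the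
initial gap `2/(γN)`. -/
lemma descent_condition {d : ℕ} {U β σ ρ K Λ c γ N : ℝ} (hd : 0 < d) (hσ : 0 < σ) (hσ1 : σ ≤ 1)
    (hρ : 0 < ρ) (hK : 0 < K) (hΛ : 1 ≤ Λ) (hQ0 : 0 < stripBound U β σ)
    (hQ : stripBound U β σ ≤ K * σ * Λ ^ 3) (hc0 : 0 < c) (hc : 64 * ((2 * K + 1) * K) * c ≤ 1)
    (hγ : γ = c * (ρ ^ 2 * σ ^ 2 / d) / Λ ^ 6) (hN : 128 / c * (d / (σ ^ 2 * ρ ^ 4)) * Λ ^ 6 ≤ N) :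
    (2 + N * (smoothnessBound U β σ * γ ^ 2 * varianceBound d U β σ)) / (γ * N) ≤ ρ ^ 2 / 32 := by
  have hd' : (0 : ℝ) < d := by exact_mod_cast hd
  have hΛ0 : 0 < Λ := by linarith
  have hγ0 : 0 < γ := by rw [hγ]; positivity
  have hN0 : 0 < N := lt_of_lt_of_le (by positivity) hN
  have hs : smoothnessBound U β σ ≤ (2 * K + 1) * Λ ^ 3 / σ := by
    have h1 : stripBound U β σ / σ ^ 2 ≤ K * Λ ^ 3 / σ := by
      rw [div_le_div_iff₀ (by positivity) hσ]
      calc stripBound U β σ * σ ≤ K * σ * Λ ^ 3 * σ := by gcongr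
        _ = _ := by ring
    have h2 : stripBound U β σ / σ ≤ K * Λ ^ 3 / σ := by
      gcongr
      calc stripBound U β σ ≤ K * σ * Λ ^ 3 := hQ
        _ ≤ K * 1 * Λ ^ 3 := by gcongr
        _ = _ := by ring
    have h3 : 1 ≤ Λ ^ 3 / σ := by
      rw [le_div_iff₀ hσ]
      have : 1 ≤ Λ ^ 3 := one_le_pow₀ hΛ
      linarith
    unfold smoothnessBound
    calc _ ≤ K * Λ ^ 3 / σ + Λ ^ 3 / σ + K * Λ ^ 3 / σ := by gcongr
      _ = _ := by ring
  have hv : varianceBound d U β σ ≤ d * K * Λ ^ 3 / σ := by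
    unfold varianceBound
    rw [div_le_div_iff₀ (by positivity) hσ]
    calc d * stripBound U β σ * σ ≤ d * (K * σ * Λ ^ 3) * σ := by gcongr
      _ = _ := by ring
  have hv0 : 0 ≤ varianceBound d U β σ := by unfold varianceBound; positivity
  have h1 : smoothnessBound U β σ * γ * varianceBound d U β σ ≤ ρ ^ 2 / 64 := by
    calc smoothnessBound U β σ * γ * varianceBound d U β σ
        ≤ (2 * K + 1) * Λ ^ 3 / σ * γ * (d * K * Λ ^ 3 / σ) := by gcongr
      _ = (2 * K + 1) * K * c * ρ ^ 2 := by rw [hγ]; field_simp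
      _ ≤ 1 / 64 * ρ ^ 2 := by gcongr; linarith
      _ = _ := by ring
  have h2 : 2 ≤ γ * N * (ρ ^ 2 / 64) := by
    calc (2 : ℝ) = γ * (128 / c * (d / (σ ^ 2 * ρ ^ 4)) * Λ ^ 6) * (ρ ^ 2 / 64) := by
          rw [hγ]; field_simp; norm_num
      _ ≤ _ := by gcongr
  rw [div_le_iff₀ (by positivity)]
  calc 2 + N * (smoothnessBound U β σ * γ ^ 2 * varianceBound d U β σ)
      = 2 + γ * N * (smoothnessBound U β σ * γ * varianceBound d U β σ) := by ring
    _ ≤ γ * N * (ρ ^ 2 / 64) + γ * N * (ρ ^ 2 / 64) := by gcongr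
    _ = _ := by ring

/-! ### Exponents of the width, the gradient threshold and the label bound -/

section Parameters

variable {A α θ : ℝ} (hα : 1 / 3 < α) (hα1 : α ≤ 1) (hA : 0 < A) (hA1 : α < 1 → 1 ≤ A)

include hα1 hA1 in
-- For `α = 1` the constant `A` may be smaller than 1, but then the exponent is 0.
lemma one_le_rpow_noise {s : ℝ} (hs : 0 ≤ s) : 1 ≤ A ^ ((1 - α) * s) := by
  rcases hα1.lt_or_eq with h | h
  · exact Real.one_le_rpow (hA1 h) (mul_nonneg (by linarith) hs)
  · simp [h]

include hα hα1 hA hA1 in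
-- This power `X` is the common scale of the parameters: the width is proportional to `θ X` and the
-- threshold to `X²`.
lemma scale_le_one (hθ : 0 < θ) (hθ1 : θ ≤ 1) : (θ / A) ^ ((1 - α) / (3 * α - 1)) ≤ 1 := by
  have h3 : 0 < 3 * α - 1 := by linarith
  rw [Real.div_rpow hθ.le hA.le]
  have h1 : θ ^ ((1 - α) / (3 * α - 1)) ≤ 1 :=
    Real.rpow_le_one hθ.le hθ1 (div_nonneg (by linarith) h3.le)
  have h2 := one_le_rpow_noise hα1 hA1 (s := 1 / (3 * α - 1)) (by positivity)
  rw [mul_one_div] at h2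
  rw [div_le_one (by linarith)]
  linarith

include hα in
lemma one_add_exponent : 1 + (1 - α) / (3 * α - 1) = 2 * α / (3 * α - 1) := by
  have h3 : 3 * α - 1 ≠ 0 := by linarith
  rw [one_add_div h3]; congr 1; ring

include hα hA in
lemma sigmaParam_eq {c : Constants} {ε : ℝ} (hθ : 0 < theta0 c ε) :
    sigmaParam c A α ε
      = c.cσ * (theta0 c ε * (theta0 c ε / A) ^ ((1 - α) / (3 * α - 1))) := by
  unfold sigmaParam
  rw [← one_add_exponent hα, Real.rpow_add hθ, Real.rpow_one, Real.div_rpow hθ.le hA.le, Real.div_rpow zero_le_one hA.le,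
    Real.one_rpow]
  ring

include hA in
lemma rhoParam_eq {c : Constants} {ε : ℝ} (hθ : 0 < theta0 c ε) :
    rhoParam c A α ε = c.cρ * ((theta0 c ε / A) ^ ((1 - α) / (3 * α - 1))) ^ 2 := by
  unfold rhoParam
  rw [show 2 * (1 - α) / (3 * α - 1) = (1 - α) / (3 * α - 1) * (2 : ℕ) by push_cast; ring,
    ← Real.mul_rpow (by positivity) hθ.le, one_div_mul_eq_div, Real.rpow_mul (by positivity),
    Real.rpow_natCast]

include hα hA in
-- The balance that determines the exponents: `p = (1-α)/(3α-1)` solves `(1 + p)(1-α)/α = 2p`. The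
-- Tsybakov signal at the chosen width is thus proportional to `X²`, like `σ²/θ²`.
lemma width_rpow_eq {a : ℝ} (ha : 0 < a) (hθ : 0 < θ) :
    (a * (θ * (θ / A) ^ ((1 - α) / (3 * α - 1))) / A) ^ ((1 - α) / α)
      = a ^ ((1 - α) / α) * ((θ / A) ^ ((1 - α) / (3 * α - 1))) ^ 2 := by
  have h3 : 3 * α - 1 ≠ 0 := by linarith
  have hα0 : α ≠ 0 := by linarith
  have hY : 0 < θ / A := by positivity
  set p := (1 - α) / (3 * α - 1) with hp
  have e : a * (θ * (θ / A) ^ p) / A = a * (θ / A) ^ (1 + p) := by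
    rw [Real.rpow_add hY, Real.rpow_one]; ring
  rw [e, Real.mul_rpow ha.le (by positivity), ← Real.rpow_mul hY.le, ← Real.rpow_natCast,
    ← Real.rpow_mul hY.le]
  congr 2
  rw [hp, one_add_exponent hα]
  push_cast
  generalize 3 * α - 1 = D at h3 ⊢
  field_simp

include hα hA in
-- `θ X⁹` is `σ ρ⁴` up to constants. Its inverse carries the exponents of the label bound.
lemma inv_scale_eq (hθ : 0 < θ) :
    1 / (θ * ((θ / A) ^ ((1 - α) / (3 * α - 1))) ^ 9)
      = A ^ ((9 - 9 * α) / (3 * α - 1)) * (1 / θ) ^ ((8 - 6 * α) / (3 * α - 1)) := by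
  have h3 : 3 * α - 1 ≠ 0 := by linarith
  have hY : 0 < θ / A := by positivity
  rw [← Real.rpow_natCast, ← Real.rpow_mul hY.le,
    show (1 - α) / (3 * α - 1) * ((9 : ℕ) : ℝ) = (9 - 9 * α) / (3 * α - 1) by push_cast; ring,
    show (8 - 6 * α) / (3 * α - 1) = 1 + (9 - 9 * α) / (3 * α - 1) by
      rw [one_add_div h3]; congr 1; ring,
    Real.rpow_add (by positivity), Real.rpow_one, Real.div_rpow hθ.le hA.le,
    Real.div_rpow zero_le_one hθ.le, Real.one_rpow]
  have h1 : 0 < A ^ ((9 - 9 * α) / (3 * α - 1)) := by positivity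
  have h2 : 0 < θ ^ ((9 - 9 * α) / (3 * α - 1)) := by positivity
  field_simp

include hα hα1 hA in
-- The width also depends on `A`. The restriction `ε ≤ (1/A)^((1-α)/α)` bounds the contribution of
-- `log A` by a multiple of `log (1/ε)`, so that constants stay independent of `A`.
lemma log_inv_width_le {ε c s Λ : ℝ} (hε : 0 < ε) (hε1 : ε ≤ 1 / 2)
    (hεA : ε ≤ (1 / A) ^ ((1 - α) / α)) (hc : 0 < c) (hc1 : c ≤ 1) (hs : 0 < s) (hs1 : s ≤ 1)
    (hΛ : 1 ≤ Λ) (hΛε : Real.log (1 / ε) ≤ Λ)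
    (hθ : θ = c * (1 / Real.log (1 / ε) ^ 2 * (ε / 2))) :
    Real.log (1 / (s * (θ * (θ / A) ^ ((1 - α) / (3 * α - 1)))))
      ≤ (Real.log (1 / s) + 2 * α / (3 * α - 1) * (Real.log (2 / c) + 3) + α / (3 * α - 1)) * Λ := by
  have h3 : 0 < 3 * α - 1 := by linarith
  have hα0 : 0 < α := by linarith
  set l := Real.log (1 / ε) with hl
  have hl0 : 0 < l := Real.log_pos (by rw [lt_div_iff₀ hε]; linarith)
  have hθ0 : 0 < θ := by rw [hθ]; positivity
  set p := (1 - α) / (3 * α - 1) with hp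
  have hp0 : 0 ≤ p := div_nonneg (by linarith) h3.le
  have e : Real.log (1 / (s * (θ * (θ / A) ^ p)))
      = Real.log (1 / s) + (1 + p) * Real.log (1 / θ) + p * Real.log A := by
    rw [one_div, Real.log_inv, Real.log_mul hs.ne' (by positivity),
      Real.log_mul hθ0.ne' (by positivity), Real.log_rpow (by positivity),
      Real.log_div hθ0.ne' hA.ne', one_div, Real.log_inv, one_div, Real.log_inv]
    ring
  have e2 : Real.log (1 / θ) = Real.log (2 / c) + 2 * Real.log l + l := by
    have : 1 / θ = 2 / c * l ^ 2 * (1 / ε) := by rw [hθ]; field_simp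
    rw [this, Real.log_mul (by positivity) (by positivity), Real.log_mul (by positivity)
      (by positivity), Real.log_pow, ← hl]
    push_cast; ring
  have h4 : Real.log l ≤ l := (Real.log_le_sub_one_of_pos hl0).trans (by linarith)
  have h5 : p * Real.log A ≤ α / (3 * α - 1) * l := by
    have h := Real.log_le_log hε hεA
    rw [Real.log_rpow (by positivity), one_div, Real.log_inv] at h
    have hl' : Real.log ε = -l := by rw [hl, one_div, Real.log_inv, neg_neg]
    have h' : (1 - α) / α * Real.log A ≤ l := by linarith
    have e3 : p * Real.log A = α / (3 * α - 1) * ((1 - α) / α * Real.log A) := by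
      rw [hp]; field_simp
    rw [e3]; gcongr
  have hs2 : 0 ≤ Real.log (1 / s) := Real.log_nonneg (by rw [le_div_iff₀ hs]; linarith)
  have hc2 : 0 ≤ Real.log (2 / c) := Real.log_nonneg (by rw [le_div_iff₀ hc]; linarith)
  have hp1 : 1 + p = 2 * α / (3 * α - 1) := one_add_exponent hα
  rw [e, ← hp1]
  have h6 : Real.log (1 / θ) ≤ (Real.log (2 / c) + 3) * Λ := by
    rw [e2]; nlinarith
  have h7 : α / (3 * α - 1) * l ≤ α / (3 * α - 1) * Λ := by gcongr
  calc _ ≤ Real.log (1 / s) * Λ + (1 + p) * ((Real.log (2 / c) + 3) * Λ)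
        + α / (3 * α - 1) * Λ := add_le_add (add_le_add (le_mul_of_one_le_right hs2 hΛ)
          (mul_le_mul_of_nonneg_left h6 (by linarith))) (h5.trans h7)
    _ = _ := by ring

include hα hα1 hA in
lemma inv_width_threshold_le {ε c s r Λ : ℝ} {d : ℕ} (hε : 0 < ε) (hε1 : ε ≤ 1 / 2)
    (hc : 0 < c) (hs : 0 < s) (hr : 0 < r) (hΛ : 1 ≤ Λ) (hΛε : Real.log (1 / ε) ≤ Λ)
    (hθ : θ = c * (1 / Real.log (1 / ε) ^ 2 * (ε / 2))) :
    d / (s * (θ * (θ / A) ^ ((1 - α) / (3 * α - 1))) *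
      (r * ((θ / A) ^ ((1 - α) / (3 * α - 1))) ^ 2) ^ 4)
      ≤ 1 / (s * r ^ 4) * (2 / c) ^ ((8 - 6 * α) / (3 * α - 1)) *
        (d * A ^ ((9 - 9 * α) / (3 * α - 1)) * (1 / ε) ^ ((8 - 6 * α) / (3 * α - 1))) *
        Λ ^ ⌈2 * ((8 - 6 * α) / (3 * α - 1))⌉₊ := by
  have h3 : 0 < 3 * α - 1 := by linarith
  set l := Real.log (1 / ε) with hl
  have hl0 : 0 < l := Real.log_pos (by rw [lt_div_iff₀ hε]; linarith)
  have hθ0 : 0 < θ := by rw [hθ]; positivity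
  set q := (8 - 6 * α) / (3 * α - 1) with hq
  have hq0 : 0 ≤ q := div_nonneg (by linarith) h3.le
  have e1 := inv_scale_eq hα hA hθ0
  set X := (θ / A) ^ ((1 - α) / (3 * α - 1)) with hX
  have hX0 : 0 < X := by rw [hX]; positivity
  have e2 : (d : ℝ) / (s * (θ * X) * (r * X ^ 2) ^ 4) = d / (s * r ^ 4) * (1 / (θ * X ^ 9)) := by
    field_simp
  have e3 : (1 / θ) ^ q = (2 / c) ^ q * (1 / ε) ^ q * l ^ (2 * q) := by
    have : 1 / θ = 2 / c * (1 / ε) * l ^ (2 : ℝ) := by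
      rw [hθ, Real.rpow_two]; field_simp
    rw [this, Real.mul_rpow (by positivity) (by positivity), Real.mul_rpow (by positivity)
      (by positivity), ← Real.rpow_mul hl0.le]
  have h4 : l ^ (2 * q) ≤ Λ ^ ⌈2 * q⌉₊ := by
    calc l ^ (2 * q) ≤ Λ ^ (2 * q) := Real.rpow_le_rpow hl0.le hΛε (by positivity)
      _ ≤ Λ ^ ((⌈2 * q⌉₊ : ℕ) : ℝ) := Real.rpow_le_rpow_of_exponent_le hΛ (Nat.le_ceil _)
      _ = _ := Real.rpow_natCast _ _
  rw [e2, e1, e3]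
  calc _ = 1 / (s * r ^ 4) * (2 / c) ^ q * (d * A ^ ((9 - 9 * α) / (3 * α - 1)) * (1 / ε) ^ q)
        * l ^ (2 * q) := by ring
    _ ≤ _ := by gcongr

include hα hα1 hA1 in
lemma validation_scale_le : A ^ ((2 - 2 * α) / α) ≤ A ^ ((9 - 9 * α) / (3 * α - 1)) := by
  have h3 : 0 < 3 * α - 1 := by linarith
  have hα0 : 0 < α := by linarith
  rcases hα1.lt_or_eq with h | h
  · apply Real.rpow_le_rpow_of_exponent_le (hA1 h)
    rw [div_le_div_iff₀ hα0 h3]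
    nlinarith
  · simp [h]

end Parameters

/-- The total number of queries in terms of the leading quantity `W` and a logarithm `Λ`. -/
lemma label_bound {S N M₁ M₂ Q t K σ ρ Λ Λ' cN cM₁ cM₂ H W V : ℝ} {d m : ℕ} (hd : 0 < d)
    (hS0 : 0 ≤ S) (hS : S ≤ 6 * Λ) (ht : t ≤ 6 * Λ) (hΛ : 1 ≤ Λ) (hΛ'0 : 0 ≤ Λ') (hΛ' : Λ' ≤ Λ)
    (hσ : 0 < σ) (hσ1 : σ ≤ 1) (hρ : 0 < ρ) (hρ1 : ρ ≤ 1) (hK : 0 < K) (hQ0 : 0 ≤ Q)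
    (hQ : Q ≤ K * σ * Λ ^ 3) (hcN : 0 < cN) (hcM₁ : 0 < cM₁) (hcM₂ : 0 < cM₂)
    (hN : N ≤ cN * (d / (σ ^ 2 * ρ ^ 4)) * Λ' ^ 6 + 1)
    (hM₁ : M₁ ≤ cM₁ * (d / (σ ^ 2 * ρ ^ 2)) * (6 * Λ) + 1)
    (hM₂ : M₂ ≤ cM₂ * (V * 9) * (3 * Λ) + 1) (hV : V ≤ W) (hW : 1 ≤ W) (hH : 0 < H)
    (hWH : d / (σ * ρ ^ 4) ≤ H * W * Λ ^ m) :
    S * (2 * Q * N + t) + S * (2 * Q * M₁ + t) + M₂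
      ≤ (12 * (K * (cN + 1) * H) + 12 * (K * (6 * cM₁ + 1) * H) + 73 + 27 * cM₂) * W
        * Λ ^ (m + 10) := by
  have hd' : (1 : ℝ) ≤ d := by exact_mod_cast hd
  have hΛ0 : 0 < Λ := by linarith
  have hWΛ : Λ ^ 2 ≤ W * Λ ^ (m + 10) := by
    calc Λ ^ 2 = 1 * Λ ^ 2 := by ring
      _ ≤ W * Λ ^ (m + 10) := by gcongr; first | exact hΛ | omega
  have hWΛ1 : W * Λ ≤ W * Λ ^ (m + 10) := by
    have : Λ ^ 1 ≤ Λ ^ (m + 10) := pow_le_pow_right₀ hΛ (by omega)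
    rw [pow_one] at this
    gcongr
  have h1Λ : 1 ≤ W * Λ ^ (m + 10) := le_trans (one_le_pow₀ hΛ) hWΛ
  set B := d / (σ * ρ ^ 4) with hB
  have hB0 : 0 < B := by positivity
  have hσB : σ ≤ B := by
    rw [hB, le_div_iff₀ (by positivity)]
    calc σ * (σ * ρ ^ 4) ≤ (1 : ℝ) * (1 * 1 ^ 4) := by gcongr
      _ ≤ (d : ℝ) := by linarith
  have hσB' : σ ≤ B * Λ ^ 6 :=
    hσB.trans (le_mul_of_one_le_right hB0.le (one_le_pow₀ hΛ))
  have hσB2 : σ ≤ B * Λ := hσB.trans (le_mul_of_one_le_right hB0.le hΛ)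
  -- The query probability cancels one factor `σ` of `d/(σ²ρ⁴)`. The powers of `Λ` are 3 from the
  -- strip and 6 from `N`; the number of trials adds one more.
  have e1 : Q * N ≤ K * (cN + 1) * (B * Λ ^ 9) := by
    calc Q * N ≤ Q * (cN * (d / (σ ^ 2 * ρ ^ 4)) * Λ ^ 6 + 1) := by
          gcongr; exact hN.trans (by gcongr)
      _ ≤ K * σ * Λ ^ 3 * (cN * (d / (σ ^ 2 * ρ ^ 4)) * Λ ^ 6 + 1) := by gcongr
      _ = K * (cN * (B * Λ ^ 6) + σ) * Λ ^ 3 := by rw [hB]; field_simp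
      _ ≤ K * (cN * (B * Λ ^ 6) + B * Λ ^ 6) * Λ ^ 3 := by gcongr
      _ = _ := by ring
  have e2 : Q * M₁ ≤ K * (6 * cM₁ + 1) * (B * Λ ^ 4) := by
    have hb : d / (σ * ρ ^ 2) ≤ B := by
      rw [hB]
      refine div_le_div_of_nonneg_left (by positivity) (by positivity) ?_
      exact mul_le_mul_of_nonneg_left (pow_le_pow_of_le_one hρ.le hρ1 (by norm_num)) hσ.le
    calc Q * M₁ ≤ Q * (cM₁ * (d / (σ ^ 2 * ρ ^ 2)) * (6 * Λ) + 1) := by gcongr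
      _ ≤ K * σ * Λ ^ 3 * (cM₁ * (d / (σ ^ 2 * ρ ^ 2)) * (6 * Λ) + 1) := by gcongr
      _ = K * (6 * cM₁ * (d / (σ * ρ ^ 2) * Λ) + σ) * Λ ^ 3 := by field_simp
      _ ≤ K * (6 * cM₁ * (B * Λ) + B * Λ) * Λ ^ 3 := by gcongr
      _ = _ := by ring
  have e3 : B * Λ ^ 9 ≤ H * (W * Λ ^ (m + 9)) := by
    calc B * Λ ^ 9 ≤ H * W * Λ ^ m * Λ ^ 9 := by gcongr
      _ = _ := by ring
  have e4 : B * Λ ^ 4 ≤ H * (W * Λ ^ (m + 9)) :=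
    le_trans (by gcongr; first | exact hΛ | norm_num) e3
  have f1 : S * (2 * Q * N + t) ≤ 12 * (K * (cN + 1) * H) * (W * Λ ^ (m + 10)) + 36 * Λ ^ 2 := by
    calc S * (2 * Q * N + t) ≤ S * (2 * (K * (cN + 1) * (H * (W * Λ ^ (m + 9)))) + 6 * Λ) := by
          have := e1.trans (mul_le_mul_of_nonneg_left e3 (by positivity))
          exact mul_le_mul_of_nonneg_left (by linarith) hS0
      _ ≤ 6 * Λ * (2 * (K * (cN + 1) * (H * (W * Λ ^ (m + 9)))) + 6 * Λ) := by gcongr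
      _ = _ := by ring
  have f2 : S * (2 * Q * M₁ + t)
      ≤ 12 * (K * (6 * cM₁ + 1) * H) * (W * Λ ^ (m + 10)) + 36 * Λ ^ 2 := by
    calc S * (2 * Q * M₁ + t)
        ≤ S * (2 * (K * (6 * cM₁ + 1) * (H * (W * Λ ^ (m + 9)))) + 6 * Λ) := by
          have := e2.trans (mul_le_mul_of_nonneg_left e4 (by positivity))
          exact mul_le_mul_of_nonneg_left (by linarith) hS0
      _ ≤ 6 * Λ * (2 * (K * (6 * cM₁ + 1) * (H * (W * Λ ^ (m + 9)))) + 6 * Λ) := by gcongr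
      _ = _ := by ring
  have f3 : M₂ ≤ 27 * cM₂ * (W * Λ ^ (m + 10)) + W * Λ ^ (m + 10) := by
    calc M₂ ≤ cM₂ * (V * 9) * (3 * Λ) + 1 := hM₂
      _ ≤ cM₂ * (W * 9) * (3 * Λ) + 1 := by gcongr
      _ = 27 * cM₂ * (W * Λ) + 1 := by ring
      _ ≤ _ := by gcongr
  calc _ ≤ _ := add_le_add (add_le_add f1 f2) f3
    _ ≤ 12 * (K * (cN + 1) * H) * (W * Λ ^ (m + 10)) + 36 * (W * Λ ^ (m + 10))
        + (12 * (K * (6 * cM₁ + 1) * H) * (W * Λ ^ (m + 10)) + 36 * (W * Λ ^ (m + 10)))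
        + (27 * cM₂ * (W * Λ ^ (m + 10)) + W * Λ ^ (m + 10)) := by gcongr
    _ = _ := by ring

/-- The constant in the bound of `log (1 / σ)` by `log (1 / ε)`. -/
noncomputable def logWidthConst (α cθ cσ : ℝ) : ℝ :=
  Real.log (1 / cσ) + 2 * α / (3 * α - 1) * (Real.log (2 / cθ) + 3) + α / (3 * α - 1)

lemma logWidthConst_pos {α cθ cσ : ℝ} (hα : 1 / 3 < α) (hθ : 0 < cθ) (hθ1 : cθ ≤ 1) (hσ : 0 < cσ)
    (hσ1 : cσ ≤ 1) : 0 < logWidthConst α cθ cσ := by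
  have h3 : 0 < 3 * α - 1 := by linarith
  have h1 : 0 ≤ Real.log (1 / cσ) := Real.log_nonneg (by rw [le_div_iff₀ hσ]; linarith)
  have h2 : 0 ≤ Real.log (2 / cθ) := Real.log_nonneg (by rw [le_div_iff₀ hθ]; linarith)
  have hα0 : 0 < α := by linarith
  unfold logWidthConst
  positivity

/-- The cutoff radius `9 β log (1/ε)` makes the tail `e ε⁹`, which is at most `ε/64` for `ε ≤ 1/2`.
The squared logarithm from this radius is the one divided out in the definition of `θ₀`. -/
lemma angle_condition {ε U β cθ : ℝ} (hε : 0 < ε) (hε1 : ε ≤ 1 / 2) (hβ : 0 < β)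
    (hc : 20736 * U * β ^ 2 * cθ ≤ 1) :
    Real.exp (1 - 9 * β * Real.log (1 / ε) / β)
      + 8 * U * (cθ * (1 / Real.log (1 / ε) ^ 2 * (ε / 2))) * (9 * β * Real.log (1 / ε)) ^ 2
      ≤ ε / 32 := by
  have hl0 : 0 < Real.log (1 / ε) := Real.log_pos (by rw [lt_div_iff₀ hε]; linarith)
  have h1 : Real.exp (1 - 9 * β * Real.log (1 / ε) / β) ≤ ε / 64 := by
    have e : 1 - 9 * β * Real.log (1 / ε) / β = 1 + (9 : ℕ) * Real.log ε := by
      rw [one_div, Real.log_inv]; push_cast; field_simp; ring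
    rw [e, Real.exp_add, Real.exp_nat_mul, Real.exp_log hε]
    have h8 : ε ^ 8 ≤ (1 / 2) ^ 8 := by gcongr
    have := Real.exp_one_lt_d9
    calc Real.exp 1 * ε ^ 9 = Real.exp 1 * ε ^ 8 * ε := by ring
      _ ≤ 3 * (1 / 2) ^ 8 * ε := by gcongr; linarith
      _ ≤ _ := by linarith
  have h2 : 8 * U * (cθ * (1 / Real.log (1 / ε) ^ 2 * (ε / 2))) * (9 * β * Real.log (1 / ε)) ^ 2
      = 20736 * U * β ^ 2 * cθ * (ε / 64) := by
    field_simp; ring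
  rw [h2]
  nlinarith

lemma theta_le_half {ε cθ : ℝ} (hε : 0 < ε) (hε1 : ε ≤ 1 / 2) (hc1 : cθ ≤ 1 / 2) :
    cθ * (1 / Real.log (1 / ε) ^ 2 * (ε / 2)) ≤ 1 / 2 := by
  have hl : 1 / 2 ≤ Real.log (1 / ε) := by
    have h1 : Real.log 2 ≤ Real.log (1 / ε) :=
      Real.log_le_log (by norm_num) (by rw [le_div_iff₀ hε]; linarith)
    linarith [Real.log_two_gt_d9]
  have h1 : 1 / Real.log (1 / ε) ^ 2 ≤ 4 := by
    rw [div_le_iff₀ (by positivity)]; nlinarith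
  calc cθ * (1 / Real.log (1 / ε) ^ 2 * (ε / 2)) ≤ 1 / 2 * (4 * ((1 / 2) / 2)) := by gcongr
    _ ≤ 1 / 2 := by norm_num

end ActiveHalfspace

/-! ### Choice of constants and assembly -/

set_option maxHeartbeats 1000000 in
theorem mainTheorem1 (α : ℝ) (hα : 1 / 3 < α) (hα1 : α ≤ 1)
    (L R U β : ℝ) (hL : 0 < L) (hR : 0 < R) (hU : 0 < U) (hβ : 0 < β) :
    -- constants that depend only on `α, L, R, U, β`
    ∃ c : Constants, c.Pos ∧ ∃ (c₀ C : ℝ) (k : ℕ), 0 < c₀ ∧ 0 < C ∧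
      ∀ (d : ℕ), 2 ≤ d → ∀ (A : ℝ), 0 < A →
      ∀ (D : Measure (E d × ℝ)) [IsProbabilityMeasure D] (wstar : E d),
        BinaryLabels D → WellBehaved L R U β D.fst → wstar ≠ 0 → TsybakovNoise A α wstar D →
      ∀ (ε δ : ℝ), 0 < ε →
        ε ≤ min (c₀ * (A * Real.log (1 / ε) ^ 2)) (1 / 2 * α * (1 / A) ^ ((1 - α) / α)) →
        0 < δ → δ < 1 →
        1 - δ ≤ (tapeLaw D (params c d A α ε δ)).real
          {ω | err D (output (params c d A α ε δ) ω) - err D wstar ≤ ε ∧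
            (labelQueries (params c d A α ε δ) ω : ℝ) ≤
              C * (d * A ^ ((9 - 9 * α) / (3 * α - 1)) *
                (1 / ε) ^ ((8 - 6 * α) / (3 * α - 1))) * Real.log (d / (ε * δ)) ^ k} := by
  have h3 : 0 < 3 * α - 1 := by linarith
  have hα0 : 0 < α := by linarith
  obtain ⟨s, r, hs0, hsR, hs3, hr0, hr1, hrβ, hrs⟩ := exists_width_constants hα hL hR hU hβ
  have hs1 : s ≤ 1 := by linarith
  -- The summand 2 gives `cθ ≤ 1/2`, the other one the hypothesis of `angle_condition`.
  obtain ⟨cθ, hcθ⟩ : ∃ x, x = 1 / (2 + 20736 * U * β ^ 2) := ⟨_, rfl⟩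
  have hcθ0 : 0 < cθ := by rw [hcθ]; positivity
  have hcθ1 : cθ ≤ 1 / 2 := by
    rw [hcθ]
    exact one_div_le_one_div_of_le (by norm_num) (by nlinarith [sq_nonneg β])
  have hcθU : 20736 * U * β ^ 2 * cθ ≤ 1 := by
    rw [hcθ, mul_one_div, div_le_one (by positivity)]; linarith
  obtain ⟨K, hK⟩ : ∃ x, x = stripConst U β * logWidthConst α cθ s ^ 3 := ⟨_, rfl⟩
  have hCl := logWidthConst_pos hα hcθ0 (by linarith) hs0 hs1
  have hK0 : 0 < K := by
    rw [hK]
    exact mul_pos (stripConst_pos hU hβ) (pow_pos hCl 3)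
  obtain ⟨cS, hcS⟩ : ∃ x, x = 1 / (64 * ((2 * K + 1) * K)) := ⟨_, rfl⟩
  have hcS0 : 0 < cS := by rw [hcS]; positivity
  set q := (8 - 6 * α) / (3 * α - 1) with hq
  set H := 1 / (s * r ^ 4) * (2 / cθ) ^ q with hH
  have hH0 : 0 < H := by positivity
  clear_value q H
  -- `cM₁` is 4 times the denominator in the gradient tail, `8192 = 2 · 4 · 32²` matches the
  -- validation margin `t₀/32`, and the log exponent 6 is the one of `descent_condition`.
  obtain ⟨c, hc⟩ : ∃ c : Constants, c = ⟨cθ, s, r, 128 / cS, cS, 6144 * β ^ 2 * 4, 8192, 6⟩ :=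
    ⟨_, rfl⟩
  have hcpos : c.Pos := by
    rw [hc]
    exact ⟨hcθ0, hs0, hr0, by positivity, hcS0, by positivity, by norm_num⟩
  refine ⟨c, hcpos, 1,
    12 * (K * (128 / cS + 1) * H) + 12 * (K * (6 * (6144 * β ^ 2 * 4) + 1) * H) + 73 + 27 * 8192,
    ⌈2 * q⌉₊ + 10, one_pos, by positivity, ?_⟩
  intro d hd A hA D _ wstar hlab hwb hw0 hT ε δ hε hεle hδ hδ1
  have hA1 : α < 1 → 1 ≤ A := fun h => hT.one_le hα0 h hA
  -- the noise scale and the range of the accuracy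
  set t₀ := (1 / A) ^ ((1 - α) / α) with ht₀
  have ht₀0 : 0 < t₀ := by positivity
  clear_value t₀
  have ht₀1 : t₀ ≤ 1 := by
    have h := one_le_rpow_noise hα1 hA1 (s := 1 / α) (by positivity)
    rw [mul_one_div] at h
    rw [ht₀, one_div, Real.inv_rpow hA.le]
    exact inv_le_one_of_one_le₀ h
  have hεt : ε ≤ 1 / 2 * α * t₀ := hεle.trans (min_le_right _ _)
  have hεt' : ε ≤ t₀ / 2 := hεt.trans (by
    have := mul_le_mul_of_nonneg_right hα1 ht₀0.le
    linarith)
  have hε1 : ε ≤ 1 / 2 := by linarith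
  have hd0 : 0 < d := by omega
  have hdR : (2 : ℝ) ≤ d := by exact_mod_cast hd
  -- logarithms
  set Λ' := Real.log (d / ε) with hΛ'
  set Λ := Real.log (d / (ε * δ)) with hΛ
  clear_value Λ Λ'
  have hε2 : 2 ≤ 1 / ε := by rw [le_div_iff₀ hε]; linarith
  have hδ2 : 1 ≤ 1 / δ := by rw [le_div_iff₀ hδ]; linarith
  have e1 : Λ' = Real.log d + Real.log (1 / ε) := by
    rw [hΛ', ← Real.log_mul (by positivity) (by positivity), mul_one_div]
  have e2 : Λ = Λ' + Real.log (1 / δ) := by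
    rw [hΛ, hΛ', ← Real.log_mul (by positivity) (by positivity)]; congr 1; field_simp
  have hl2 := Real.log_two_gt_d9
  have hlε : Real.log 2 ≤ Real.log (1 / ε) := Real.log_le_log (by norm_num) hε2
  have hld : Real.log 2 ≤ Real.log d := Real.log_le_log (by norm_num) hdR
  have hlδ : 0 ≤ Real.log (1 / δ) := Real.log_nonneg hδ2
  have hΛ'1 : 1 ≤ Λ' := by linarith
  have hΛ1 : 1 ≤ Λ := by linarith
  have hΛε' : Real.log (1 / ε) ≤ Λ' := by linarith
  have hΛε : Real.log (1 / ε) ≤ Λ := by linarith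
  have hΛδ : Real.log (1 / δ) ≤ Λ := by linarith
  -- the angle, the width and the gradient threshold
  obtain ⟨θ, hθ⟩ : ∃ θ, θ = theta0 c ε := ⟨_, rfl⟩
  have hθe : θ = cθ * (1 / Real.log (1 / ε) ^ 2 * (ε / 2)) := by rw [hθ, hc]; rfl
  have hlε0 : 0 < Real.log (1 / ε) := by linarith
  have hθ0 : 0 < θ := by rw [hθe]; positivity
  have hθ1 : θ ≤ 1 / 2 := by rw [hθe]; exact theta_le_half hε hε1 hcθ1
  have hX1 := scale_le_one hα hα1 hA hA1 hθ0 (by linarith)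
  have hσe : sigmaParam c A α ε = s * (θ * (θ / A) ^ ((1 - α) / (3 * α - 1))) := by
    rw [hθ] at hθ0 ⊢; rw [sigmaParam_eq hα hA hθ0, hc]
  have hρe : rhoParam c A α ε = r * ((θ / A) ^ ((1 - α) / (3 * α - 1))) ^ 2 := by
    rw [hθ] at hθ0 ⊢; rw [rhoParam_eq hA hθ0, hc]
  have hwidth := width_rpow_eq (α := α) (a := L * R * s / 4) hα hA (by positivity) hθ0
  have hlogσ := log_inv_width_le hα hα1 hA hε hε1 (by linarith) hcθ0 (by linarith) hs0 hs1 hΛ'1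
    hΛε' hθe
  have hthr := inv_width_threshold_le (d := d) hα hα1 hA hε hε1 hcθ0 hs0 hr0 hΛ1 hΛε hθe
  set X := (θ / A) ^ ((1 - α) / (3 * α - 1)) with hX
  have hX0 : 0 < X := by rw [hX]; positivity
  clear_value X
  obtain ⟨P, hP⟩ : ∃ P, P = params c d A α ε δ := ⟨_, rfl⟩
  rw [← hP]
  obtain ⟨ρ, hρ⟩ : ∃ ρ, ρ = rhoParam c A α ε := ⟨_, rfl⟩
  rw [← hρ] at hρe
  have hPσ : P.σ = s * (θ * X) := by rw [hP]; exact hσe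
  have hσ0 : 0 < P.σ := by rw [hPσ]; positivity
  have hσs : P.σ ≤ s := by
    rw [hPσ]
    exact mul_le_of_le_one_right hs0.le (mul_le_one₀ (by linarith) hX0.le hX1)
  have hσ1 : P.σ ≤ 1 := hσs.trans hs1
  have hρ0 : 0 < ρ := by rw [hρe]; positivity
  have hρr : ρ ≤ r := by
    rw [hρe]
    exact mul_le_of_le_one_right hr0.le (pow_le_one₀ hX0.le hX1)
  have hlog1 : 1 ≤ Real.log (1 / P.σ) := by
    rw [Real.le_log_iff_exp_le (by positivity), le_div_iff₀ hσ0]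
    have := Real.exp_one_lt_d9
    calc Real.exp 1 * P.σ ≤ 3 * (1 / 3) := by
          gcongr
          · linarith
          · exact hσs.trans hs3
      _ = 1 := by norm_num
  have hQ : stripBound U β P.σ ≤ K * P.σ * Λ' ^ 3 := by
    have h : Real.log (1 / P.σ) ≤ logWidthConst α cθ s * Λ' := by rw [hPσ]; exact hlogσ
    have hsc := stripConst_pos hU hβ
    unfold stripBound
    calc stripConst U β * P.σ * Real.log (1 / P.σ) ^ 3
        ≤ stripConst U β * P.σ * (logWidthConst α cθ s * Λ') ^ 3 := by gcongr
      _ = _ := by rw [hK]; ring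
  have hQ0 := stripBound_pos hU hβ hσ0 hlog1
  -- the integer parameters
  have hS3 := three_le_numTrials hδ hδ1
  have hS3' : (3 : ℝ) ≤ numTrials δ := by exact_mod_cast hS3
  have hPS : P.S = numTrials δ := by rw [hP]; rfl
  have hlS : 0 < Real.log (numTrials δ / δ) :=
    Real.log_pos (by rw [lt_div_iff₀ hδ]; linarith)
  have hl6 : 0 < Real.log (6 / δ) := Real.log_pos (by linarith [six_lt_div hδ hδ1])
  have hNdef : P.N = ⌈128 / cS * (d / (P.σ ^ 2 * ρ ^ 4)) * Λ' ^ 6⌉₊ := by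
    rw [hP, hρ, hΛ', hc]; rfl
  have hM₁def : P.M₁ = ⌈6144 * β ^ 2 * 4 * (d / (P.σ ^ 2 * ρ ^ 2))
    * Real.log (numTrials δ / δ)⌉₊ := by
    rw [hP, hρ, hc]; rfl
  have hM₂def : P.M₂ = ⌈8192 * (A ^ ((2 - 2 * α) / α) * (1 / α ^ 2)) * Real.log (6 / δ)⌉₊ := by
    rw [hP, hc]; rfl
  have hγdef : P.step = cS * (ρ ^ 2 * P.σ ^ 2 / d) / Λ' ^ 6 := by
    rw [hP, hρ, hΛ', hc]; rfl
  have hNpos : 0 < 128 / cS * (d / (P.σ ^ 2 * ρ ^ 4)) * Λ' ^ 6 := by positivity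
  have hM₁pos : 0 < 6144 * β ^ 2 * 4 * (d / (P.σ ^ 2 * ρ ^ 2)) * Real.log (numTrials δ / δ) := by
    positivity
  have hM₂pos : 0 < 8192 * (A ^ ((2 - 2 * α) / α) * (1 / α ^ 2)) * Real.log (6 / δ) := by
    positivity
  have hN : 0 < P.N := by rw [hNdef]; exact Nat.ceil_pos.2 hNpos
  have hM₁ : 0 < P.M₁ := by rw [hM₁def]; exact Nat.ceil_pos.2 hM₁pos
  have hM₂ : 0 < P.M₂ := by rw [hM₂def]; exact Nat.ceil_pos.2 hM₂pos
  have hNge : 128 / cS * (d / (P.σ ^ 2 * ρ ^ 4)) * Λ' ^ 6 ≤ P.N := by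
    rw [hNdef]; exact Nat.le_ceil _
  have hM₁ge : 6144 * β ^ 2 * 4 * (d / (P.σ ^ 2 * ρ ^ 2)) * Real.log (numTrials δ / δ) ≤ P.M₁ := by
    rw [hM₁def]; exact Nat.le_ceil _
  have hM₂ge : 8192 * (A ^ ((2 - 2 * α) / α) * (1 / α ^ 2)) * Real.log (6 / δ) ≤ P.M₂ := by
    rw [hM₂def]; exact Nat.le_ceil _
  have hNle : (P.N : ℝ) ≤ 128 / cS * (d / (P.σ ^ 2 * ρ ^ 4)) * Λ' ^ 6 + 1 := by
    rw [hNdef]; exact (Nat.ceil_lt_add_one hNpos.le).le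
  have hM₁le : (P.M₁ : ℝ) ≤ 6144 * β ^ 2 * 4 * (d / (P.σ ^ 2 * ρ ^ 2)) * (6 * Λ) + 1 := by
    rw [hM₁def]
    refine (Nat.ceil_lt_add_one hM₁pos.le).le.trans ?_
    have h : Real.log (numTrials δ / δ) ≤ 6 * Λ := by
      refine le_trans (Real.log_le_log (by positivity) ?_) (log_numTrials_div_le hδ hδ1 hΛ1 hΛδ)
      gcongr
      linarith
    gcongr
  have hM₂le : (P.M₂ : ℝ) ≤ 8192 * (A ^ ((2 - 2 * α) / α) * 9) * (3 * Λ) + 1 := by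
    rw [hM₂def]
    refine (Nat.ceil_lt_add_one hM₂pos.le).le.trans ?_
    have h : Real.log (6 / δ) ≤ 3 * Λ := log_six_div_le hδ hΛ1 hΛδ
    have h9 : 1 / α ^ 2 ≤ 9 := by 
      rw [one_div, inv_le_comm₀ (by positivity) (by norm_num)]
      calc (9 : ℝ)⁻¹ = (1 / 3) ^ 2 := by norm_num
        _ ≤ α ^ 2 := by gcongr
    gcongr
  -- one of `± w` is accurate at every approximately stationary unit vector `w`
  have hgood : ∀ w : E d, ‖w‖ = 1 → ‖lossGrad D P.σ w‖ < ρ →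
      (err D w - err D wstar ≤ ε ∧ 2 * err D w - 1 ≤ -(t₀ / 32)) ∨
        (err D (-w) - err D wstar ≤ ε ∧ 2 * err D (-w) - 1 ≤ -(t₀ / 32)) := by
    intro w hw hwρ
    have hρle : ρ ≤ L * R ^ 2 / 384 * (L * R * P.σ / 4 / A) ^ ((1 - α) / α)
        - 128 * U * P.σ ^ 2 / θ ^ 2 := by
      have e3 : L * R * P.σ / 4 / A = L * R * s / 4 * (θ * X) / A := by rw [hPσ]; ring
      have e4 : 128 * U * P.σ ^ 2 / θ ^ 2 = 128 * U * s ^ 2 * X ^ 2 := by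
        rw [hPσ]; field_simp
      rw [e3, hwidth, e4, hρe]
      calc r * X ^ 2 ≤ (L * R ^ 2 / 384 * (L * R * s / 4) ^ ((1 - α) / α) - 128 * U * s ^ 2)
            * X ^ 2 := by gcongr
        _ = _ := by ring
    -- The optimal error is at most `1/2 - t₀/32`. An excess of `ε/32 ≤ t₀/64` uses up half of this
    -- margin, which leaves `2 err - 1 ≤ -t₀/32`.
    have hstar := hT.err_le hα hα1 hA hlab
    rw [← ht₀] at hstar
    rcases excess_err_le_of_norm_lossGrad_lt hwb hL hR hU hβ hσ0 (hσs.trans hsR) hlab hd hα0 hα1 hA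
      hw0 hT hθ0 hθ1 hρle (r := 9 * β * Real.log (1 / ε)) (by positivity)
      (hθe ▸ angle_condition hε hε1 hβ hcθU) hw hwρ with h | h
    · left; constructor <;> linarith
    · right; constructor <;> linarith
  have hnum := descent_condition (β := β) (U := U) hd0 hσ0 hσ1 hρ0 hK0 hΛ'1 hQ0 hQ hcS0
    (by rw [hcS, mul_one_div]; exact (div_self (by positivity)).le) hγdef hNge
  have hsqd : (1 : ℝ) ≤ √d := Real.one_le_sqrt.2 (by linarith)
  have hσρ : P.σ * ρ ≤ 192 * β * √d := by
    calc P.σ * ρ ≤ 1 * r := by gcongr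
      _ ≤ 192 * β * 1 := by linarith
      _ ≤ _ := by gcongr
  have hδ2' : P.S * (2 * Real.exp (-(P.M₁ * (P.σ ^ 2 * ρ ^ 2 / (6144 * β ^ 2 * d))))) ≤ δ / 6 := by
    rw [hPS]
    refine numTrials_mul_two_exp_le hδ hδ1 ?_
    calc 4 * Real.log (numTrials δ / δ)
        = 6144 * β ^ 2 * 4 * (d / (P.σ ^ 2 * ρ ^ 2)) * Real.log (numTrials δ / δ)
          * (P.σ ^ 2 * ρ ^ 2 / (6144 * β ^ 2 * d)) := by field_simp
      _ ≤ _ := by gcongr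
  have hδ3 : P.S * Real.exp (-(P.M₂ * ((t₀ / 32) ^ 2 / 4))) ≤ δ / 6 := by
    rw [hPS]
    refine numTrials_mul_exp_le hδ hδ1 ?_
    -- The power of `A` in `M₂` is the inverse square of the margin scale `t₀`, so the exponent of
    -- the Hoeffding bound does not depend on `A`.
    have e5 : A ^ ((2 - 2 * α) / α) * t₀ ^ 2 = 1 := by
      rw [ht₀, one_div, Real.inv_rpow hA.le, ← Real.rpow_neg hA.le, ← Real.rpow_natCast,
        ← Real.rpow_mul hA.le, ← Real.rpow_add hA,
        show (2 - 2 * α) / α + -((1 - α) / α) * ((2 : ℕ) : ℝ) = 0 by push_cast; ring,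
        Real.rpow_zero]
    have h9 : 1 ≤ 1 / α ^ 2 := by
      rw [le_div_iff₀ (by positivity), one_mul]; exact pow_le_one₀ hα0.le hα1
    calc 2 * Real.log (6 / δ) ≤ 2 * (1 / α ^ 2) * Real.log (6 / δ) := by
          gcongr; linarith
      _ = 2 * (1 / α ^ 2) * Real.log (6 / δ) * (A ^ ((2 - 2 * α) / α) * t₀ ^ 2) := by
          rw [e5, mul_one]
      _ = 8192 * (A ^ ((2 - 2 * α) / α) * (1 / α ^ 2)) * Real.log (6 / δ)
          * ((t₀ / 32) ^ 2 / 4) := by ring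
      _ ≤ _ := by gcongr
  -- The query deviation is `t = log (6S/δ)`, fixed by the last argument, so that `S exp (-t)`
  -- equals `δ/6`.
  have key := one_sub_le_tapeLaw_real (D := D) (P := P) hN hwb hU hβ hlab hd hσ0 hlog1
    (by rw [hγdef]; positivity) (by omega) hM₁ hM₂ hρ0 (by positivity : 0 < t₀ / 32) (by linarith)
    hσρ hgood hnum hδ (hPS ▸ half_pow_numTrials_le hδ) hδ2' hδ3
    (hPS ▸ (numTrials_mul_exp_eq hδ hδ1).le)
  have := isProbabilityMeasure_tapeLaw (D := D) hN
  refine key.trans (measureReal_mono fun ω hω => ⟨hω.1, hω.2.trans ?_⟩)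
  -- the number of label queries
  have hQΛ : stripBound U β P.σ ≤ K * P.σ * Λ ^ 3 := hQ.trans (by gcongr; linarith)
  have hAW := one_le_rpow_noise hα1 hA1 (s := 9 / (3 * α - 1)) (by positivity)
  rw [show (1 - α) * (9 / (3 * α - 1)) = (9 - 9 * α) / (3 * α - 1) by ring] at hAW
  have hq0 : 0 ≤ q := by
    rw [hq]
    exact div_nonneg (by linarith) h3.le
  have hεW : 1 ≤ (1 / ε) ^ q := Real.one_le_rpow (by linarith) hq0
  have hdA : A ^ ((9 - 9 * α) / (3 * α - 1)) ≤ d * A ^ ((9 - 9 * α) / (3 * α - 1)) :=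
    le_mul_of_one_le_left (by positivity) (by linarith)
  have hVW : A ^ ((9 - 9 * α) / (3 * α - 1))
      ≤ d * A ^ ((9 - 9 * α) / (3 * α - 1)) * (1 / ε) ^ q :=
    hdA.trans (le_mul_of_one_le_right (by positivity) hεW)
  rw [← hPσ, ← hρe, ← hq, ← hH] at hthr
  exact label_bound hd0 (by positivity) (hPS ▸ numTrials_le hδ hδ1 hΛ1 hΛδ)
    (hPS ▸ log_numTrials_div_le hδ hδ1 hΛ1 hΛδ) hΛ1 (by linarith) (by linarith) hσ0 hσ1 hρ0
    (hρr.trans hr1) hK0 hQ0.le hQΛ (by positivity) (by positivity) (by norm_num) hNle hM₁le hM₂le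
    ((validation_scale_le hα hα1 hA1).trans hVW) (hAW.trans hVW) hH0 hthr
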